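/- Let $(C,J)$ be a small site and $\mathcal E=\mathrm{Sh}(C,J)$. All statements below are made in the internal (intuitionistic) language of $\mathcal E$, interpreted by Kripke–Joyal semantics: a type in context $U\in C$ is a sheaf on the slice site $C/U$, and "there merely exists" and "or" mean existence and disjunction on a covering sieve. A map is surjective if it is an epimorphism of sheaves, i.e. locally surjective. Write $2$, $\mathbb N$, $\mathbb Q$ for the constant sheaves, $2[\mathbb N]$ for the free Boolean algebra on $\mathbb N$, $\mathrm{Boole}$ for the countably presented Boolean algebras (those merely of the form $2[\mathbb N]/(r_n)_{n:\mathbb N}$), and $Sp(B)=\mathrm{Hom}_{\mathrm{Boole}}(B,2)$. Assume that the four axioms of synthetic Stone duality hold in $\mathcal E$: (i) *Stone duality*: for every $B:\mathrm{Boole}$ the evaluation map $B\to 2^{Sp(B)}$ is an isomorphism. (ii) *Surjections are formal surjections*: a map $g:B\to C$ in $\mathrm{Boole}$ is injective if and only if $(-)\circ g:Sp(C)\to Sp(B)$ is surjective. (iii) *Local choice*: if $B:\mathrm{Boole}$ and $P$ is a family of types over $Sp(B)$ with $\prod_{s:Sp(B)}\|P(s)\|$, then there merely exist $C:\mathrm{Boole}$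 and a surjection $q:Sp(C)\to Sp(B)$ with $\prod_{t:Sp(C)}P(q(t))$. (iv) *Dependent choice*: for types $(E_n)_{n:\mathbb N}$ with surjections $E_{n+1}\to E_n$, the projection $\lim_k E_k\to E_0$ is surjective. A proposition $P$ is *open* (resp. *closed*) if there merely is $\alpha:2^{\mathbb N}$ with $P\leftrightarrow\exists_n\,\alpha_n=0$ (resp. $P\leftrightarrow\forall_n\,\alpha_n=0$). A subtype $A\subseteq X$ is open if $A(x)$ is open for all $x:X$. A type is *compact Hausdorff* if its identity types are closed propositions and there merely is a surjection onto it from some $Sp(B)$ with $B:\mathrm{Boole}$. Let $\mathbb R$ be the type of Dedekind real numbers and $\mathbb I=\{x:\mathbb R\mid 0\le x\le 1\}$. Then the following hold in $\mathcal E$: 1. $\mathbb I$ is compact Hausdorff. 2. The intrinsic topology of $\mathbb I$ is generated by open intervals: a subtype $A\subseteq\mathbb I$ is open if and only if there merely are sequences $a,b:\mathbb N\to\mathbb R$ such that $A=\bigcup_{n}\{x:\mathbb I\mid a_n<x<b_n\}$. 3. Every function $f:\mathbb I\to\mathbb I$ is $\varepsilon$-$\delta$ continuous: for all $f:\mathbb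 I\to\mathbb I$, all $x:\mathbb I$ and all rational $\varepsilon>0$ there merely is a rational $\delta>0$ such that for all $y:\mathbb I$, $|x-y|<\delta$ implies $|f(x)-f(y)|<\varepsilon$. -/

import Mathlib

open CategoryTheory Opposite

universe u

/-!
Internal language of the topos of sheaves on a small site `(C, J)`, through its
Kripke-Joyal (forcing) semantics: a type in context `U : C` is a sheaf on the slice site
`(Over U, J.over U)`, an element of a type `X` at a stage `U` is a section `x ∈ X(U)`,
`∀` and `→` range over all later stages `V ⟶ U`, and `∃`, `∨`, `‖ - ‖` hold when they hold on a
covering sieve. A type used only through its sections is given by its underlying presheaf.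
-/

noncomputable section

namespace SyntheticStone

variable {C : Type u} [SmallCategory C] (J : GrothendieckTopology C)

/-- `P` holds on some covering sieve of `U`: the forcing clause of `∃`, `∨` and mere existence. -/
def Locally (U : C) (P : ∀ V : C, (V ⟶ U) → Prop) : Prop :=
  ∃ S : Sieve U, S ∈ J U ∧ ∀ (V : C) (f : V ⟶ U), S.arrows f → P V f

/-- Restriction of a section. -/
abbrev res (X : Cᵒᵖ ⥤ Type u) {U V : C} (f : V ⟶ U) (x : X.obj (op U)) : X.obj (op V) :=
  X.map f.op x

/-- Elements of the internal function type `X → Y` at stage `U`. -/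
@[ext]
structure Fn (X Y : Cᵒᵖ ⥤ Type u) (U : C) where
  app : ∀ {V : C} (_ : V ⟶ U), X.obj (op V) → Y.obj (op V)
  nat : ∀ {V W : C} (f : V ⟶ U) (g : W ⟶ V) (x : X.obj (op V)),
    app (g ≫ f) (res X g x) = res Y g (app f x)

/-! ### The discrete types `2`, `ℕ`, `ℚ`, ... -/

/-- The constant sheaf on a set `A`. It is the internal `2`, `ℕ`, `ℚ` for `A = Bool, ℕ, ℚ`.
An element of the internal type `ℕ → A` at stage `U` is a sequence `ℕ → (cst J A)(U)`, and a
quantifier over the internal `ℕ` or `ℚ` reduces to one over the external numbers. -/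
def cst (A : Type) : Cᵒᵖ ⥤ Type u :=
  ((constantSheaf J (Type u)).obj (ULift.{u} A)).obj

/-- The numeral of `a : A` at stage `U`. -/
def num {A : Type} (a : A) (U : C) : (cst J A).obj (op U) :=
  (toSheafify J ((Functor.const Cᵒᵖ).obj (ULift.{u} A))).app (op U) (ULift.up a)

/-- The internal two element type. -/
abbrev two : Cᵒᵖ ⥤ Type u := cst J Bool

/-! ### Truth values, open and closed propositions -/

/-- The object of truth values: closed sieves. -/
abbrev Omega : Cᵒᵖ ⥤ Type u := (Functor.closedSieves J).toFunctor

/-- A proposition `P` at stage `U` is open: there is `α : 2^ℕ` with `P ↔ ∃ n, α n = 0`. -/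
def IsOpenProp {U : C} (P : Sieve U) : Prop :=
  Locally J U fun V f => ∃ α : ℕ → (two J).obj (op V),
    ∀ (W : C) (g : W ⟶ V), P.arrows (g ≫ f) ↔
      Locally J W fun W' h => ∃ n, res (two J) (h ≫ g) (α n) = num J false W'

/-- A proposition `P` at stage `U` is closed: there is `α : 2^ℕ` with `P ↔ ∀ n, α n = 0`. -/
def IsClosedProp {U : C} (P : Sieve U) : Prop :=
  Locally J U fun V f => ∃ α : ℕ → (two J).obj (op V),
    ∀ (W : C) (g : W ⟶ V), P.arrows (g ≫ f) ↔ ∀ n, res (two J) g (α n) = num J false W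

/-- The truth value of `x = y`. -/
def eqSieve (X : Cᵒᵖ ⥤ Type u) {U : C} (x y : X.obj (op U)) : Sieve U where
  arrows V f := res X f x = res X f y
  downward_closed := by
    intro V W f hf g
    simp only [res, op_comp, Functor.map_comp_apply] at hf ⊢
    rw [hf]

/-- A subtype `A ⊆ X` at stage `U` is a map `X → Omega`; it is open if all its values are. -/
def IsOpenSub {X : Cᵒᵖ ⥤ Type u} {U : C} (A : Fn X (Omega J) U) : Prop :=
  ∀ (V : C) (f : V ⟶ U) (x : X.obj (op V)), IsOpenProp J (A.app f x).1

/-! ### Countably presented Boolean algebras and their spectra -/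

/-- Boolean terms in countably many generators. -/
inductive BTerm : Type
  | gen : ℕ → BTerm
  | top : BTerm
  | bot : BTerm
  | inf : BTerm → BTerm → BTerm
  | sup : BTerm → BTerm → BTerm
  | compl : BTerm → BTerm

/-- Value of a Boolean term in a Boolean algebra. Two terms are equal in the free Boolean algebra
`2[ℕ]` exactly when they have the same value in `Bool` for every valuation of the generators. -/
def BTerm.eval {B : Type*} [BooleanAlgebra B] (g : ℕ → B) : BTerm → B
  | gen n => g n
  | top => ⊤
  | bot => ⊥
  | inf s t => s.eval g ⊓ t.eval g
  | sup s t => s.eval g ⊔ t.eval g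
  | compl t => (t.eval g)ᶜ

/-- `g : ℕ → B` induces an isomorphism `2[ℕ]/(r n)_n ≅ B` at stage `U`, for an internal sequence `r`
of Boolean terms: the map `2[ℕ] → B` given by `g` is surjective, and a term `t` is sent to `⊥`
if and only if `t ≤ r 0 ⊔ ⋯ ⊔ r (k - 1)` in `2[ℕ]` for some `k`. -/
def Presents (B : Cᵒᵖ ⥤ BoolAlg.{u}) {U : C} (g : ℕ → B.obj (op U))
    (r : ℕ → (cst J BTerm).obj (op U)) : Prop :=
  (∀ (V : C) (f : V ⟶ U) (b : B.obj (op V)), Locally J V fun _ h =>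
    ∃ t : BTerm, t.eval (fun n => B.map (h ≫ f).op (g n)) = B.map h.op b) ∧
  (∀ (V : C) (f : V ⟶ U) (t : BTerm), t.eval (fun n => B.map f.op (g n)) = ⊥ ↔
    Locally J V fun W h => ∃ (k : ℕ) (s : ℕ → BTerm),
      (∀ i < k, res (cst J BTerm) (h ≫ f) (r i) = num J (s i) W) ∧
      ∀ v : ℕ → Bool, t.eval v = true → ∃ i < k, (s i).eval v = true)

/-- An internal Boolean algebra (a sheaf of Boolean algebras) which is countably presented:
merely of the form `2[ℕ]/(r n)_n`. Countable sets, i.e. decidable subsets of `ℕ`, of generators and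
of relations give nothing more general: a missing generator is killed by a relation, a missing
relation is replaced by `⊥`. -/
structure Boole where
  alg : Cᵒᵖ ⥤ BoolAlg.{u}
  isSheaf : Presheaf.IsSheaf J (alg ⋙ forget BoolAlg.{u})
  countablyPresented : ∀ U : C, Locally J U fun V _ =>
    ∃ (g : ℕ → alg.obj (op V)) (r : ℕ → (cst J BTerm).obj (op V)), Presents J alg g r

/-- Elements of `Sp B` at stage `U`: internal Boolean morphisms `B → 2`. The clauses say
`h ⊤ = 1`, `h (b ⊓ c) = h b ∧ h c` and `h bᶜ = ¬ h b`; elements of `2` are equal when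
they are equal to `1` at the same later stages. -/
@[ext]
structure SpPt (B : Cᵒᵖ ⥤ BoolAlg.{u}) (U : C) where
  hom : Fn (B ⋙ forget BoolAlg.{u}) (two J) U
  map_top : ∀ {V : C} (f : V ⟶ U), hom.app f (⊤ : B.obj (op V)) = num J true V
  map_inf : ∀ {V : C} (f : V ⟶ U) (b c : B.obj (op V)),
    hom.app f (b ⊓ c : B.obj (op V)) = num J true V ↔ hom.app f b = num J true V ∧ hom.app f c = num J true V
  map_compl : ∀ {V : C} (f : V ⟶ U) (b : B.obj (op V)),
    hom.app f (bᶜ : B.obj (op V)) = num J true V ↔ hom.app f b = num J false V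

variable {J}

/-- Restriction of an internal Boolean morphism to a later stage. -/
def SpPt.restrict {B : Cᵒᵖ ⥤ BoolAlg.{u}} {U V : C} (f : V ⟶ U) (x : SpPt J B U) :
    SpPt J B V where
  hom :=
    { app := fun g b => x.hom.app (g ≫ f) b
      nat := fun g h b => by rw [Category.assoc]; exact x.hom.nat (g ≫ f) h b }
  map_top := fun g => x.map_top (g ≫ f)
  map_inf := fun g b c => x.map_inf (g ≫ f) b c
  map_compl := fun g b => x.map_compl (g ≫ f) b

variable (J)

/-- The spectrum of an internal Boolean algebra. -/
def Sp (B : Cᵒᵖ ⥤ BoolAlg.{u}) : Cᵒᵖ ⥤ Type u where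
  obj U := SpPt J B U.unop
  map f := ↾ (SpPt.restrict f.unop)
  map_id U := by
    ext x
    simp [SpPt.restrict]
  map_comp f g := by
    ext x
    simp [SpPt.restrict]

/-- The evaluation map `B → 2^(Sp B)` at stage `U`. -/
def evalMap (B : Cᵒᵖ ⥤ BoolAlg.{u}) (U : C) (b : B.obj (op U)) : Fn (Sp J B) (two J) U where
  app {V} f x := (show SpPt J B V from x).hom.app (𝟙 V) (B.map f.op b)
  nat {V W} f g x := by
    have h := (show SpPt J B V from x).hom.nat (𝟙 V) g (B.map f.op b)
    refine Eq.trans ?_ h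
    change (show SpPt J B V from x).hom.app (𝟙 W ≫ g) (B.map (g ≫ f).op b) =
      (show SpPt J B V from x).hom.app (g ≫ 𝟙 V) (B.map g.op (B.map f.op b))
    simp

/-- Composition of an internal Boolean morphism `B → 2` with `g : A → B`. -/
def SpPt.comp {A B : Cᵒᵖ ⥤ BoolAlg.{u}} (g : A ⟶ B) {U : C} (x : SpPt J B U) : SpPt J A U where
  hom :=
    { app := fun {V} f a => x.hom.app f (g.app (op V) a)
      nat := fun {V W} f k a => by
        refine Eq.trans ?_ (x.hom.nat f k (g.app (op V) a))
        exact congrArg (x.hom.app (k ≫ f)) (NatTrans.naturality_apply g k.op a) }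
  map_top := fun {V} f => by
    have h : g.app (op V) (⊤ : A.obj (op V)) = ⊤ := TopHomClass.map_top (g.app (op V)).hom
    exact (congrArg (x.hom.app f) h).trans (x.map_top f)
  map_inf := fun {V} f b c => by
    have h : g.app (op V) (b ⊓ c) = g.app (op V) b ⊓ g.app (op V) c :=
      InfHomClass.map_inf (g.app (op V)).hom b c
    exact (iff_of_eq (congrArg (fun z => x.hom.app f z = num J true V) h)).trans (x.map_inf f _ _)
  map_compl := fun {V} f b => by
    have h : g.app (op V) bᶜ = (g.app (op V) b)ᶜ := map_compl' (g.app (op V)).hom b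
    exact (iff_of_eq (congrArg (fun z => x.hom.app f z = num J true V) h)).trans (x.map_compl f _)

/-- `Sp` of a morphism `g : A → B`: the map `(-) ∘ g : Sp B → Sp A`. -/
def Sp.map {A B : Cᵒᵖ ⥤ BoolAlg.{u}} (g : A ⟶ B) : Sp J B ⟶ Sp J A where
  app _ := ↾ (SpPt.comp J g)
  naturality _ _ _ := rfl

/-! ### The axioms -/

/-- Stone duality: for all `B : Boole`, the evaluation map `B → 2^(Sp B)` is an isomorphism. -/
def StoneDuality : Prop :=
  ∀ (U : C) (B : Boole (J.over U)) (V : Over U), Function.Bijective (evalMap (J.over U) B.alg V)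

/-- Surjections are formal surjections: for all `g : A → B` in `Boole`, `g` is injective if and only
if `(-) ∘ g : Sp B → Sp A` is surjective. -/
def SurjectionsAreFormalSurjections : Prop :=
  ∀ (U : C) (A B : Boole (J.over U)) (g : A.alg ⟶ B.alg),
    (∀ V : Over U, Function.Injective (g.app (op V))) ↔
      Presheaf.IsLocallySurjective (J.over U) (Sp.map (J.over U) g)

/-- Restriction along `f : V ⟶ U` of a type in context `U`. -/
abbrev pull {U V : C} (f : V ⟶ U) (X : (Over U)ᵒᵖ ⥤ Type u) : (Over V)ᵒᵖ ⥤ Type u :=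
  (Over.map f).op ⋙ X

/-- Local choice: given `B : Boole` and a family of types `P` over `Sp B`, presented by its total
type `p : E → Sp B`, such that `‖P s‖` for all `s : Sp B`, there merely exist `D : Boole`, a
surjection `q : Sp D → Sp B` and a section `e` of `P` over `q`. -/
def LocalChoice : Prop :=
  ∀ (U : C) (B : Boole (J.over U)) (E : Sheaf (J.over U) (Type u)) (p : E.obj ⟶ Sp (J.over U) B.alg),
    Presheaf.IsLocallySurjective (J.over U) p →
    Locally J U fun V f => ∃ (D : Boole (J.over V))
      (q : Sp (J.over V) D.alg ⟶ pull f (Sp (J.over U) B.alg))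
      (e : Sp (J.over V) D.alg ⟶ pull f E.obj),
      Presheaf.IsLocallySurjective (J.over V) q ∧ e ≫ Functor.whiskerLeft (Over.map f).op p = q

/-- Dependent choice: for types `E n` and surjections `E (n + 1) → E n`, the projection from the
sequential limit to `E 0` is surjective. -/
def DependentChoice : Prop :=
  ∀ (U : C) (E : ℕ → Sheaf (J.over U) (Type u)) (p : ∀ n, (E (n + 1)).obj ⟶ (E n).obj),
    (∀ n, Presheaf.IsLocallySurjective (J.over U) (p n)) →
    ∀ (V : Over U) (x₀ : (E 0).obj.obj (op V)), Locally (J.over U) V fun W h =>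
      ∃ x : ∀ n, (E n).obj.obj (op W),
        x 0 = res (E 0).obj h x₀ ∧ ∀ n, (p n).app (op W) (x (n + 1)) = x n

/-! ### Compact Hausdorff types -/

/-- A type is compact Hausdorff if its identity types are closed propositions and there merely
exist a Stone type `Sp B`, with `B : Boole`, and a surjection from it. -/
def IsCHaus (X : Cᵒᵖ ⥤ Type u) : Prop :=
  (∀ (U : C) (x y : X.obj (op U)), IsClosedProp J (eqSieve X x y)) ∧
  ∀ U : C, Locally J U fun V _ => ∃ (B : Boole (J.over V))
    (p : Sp (J.over V) B.alg ⟶ (Over.forget V).op ⋙ X), Presheaf.IsLocallySurjective (J.over V) p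

/-! ### Real numbers and the unit interval -/

/-- A Dedekind real number at stage `U`: `lower q` is the truth value of `q < x`, `upper q` that of
`x < q`. (`⊥ ∈ J V` says that the false proposition holds at stage `V`.) -/
@[ext]
structure DReal (U : C) where
  lower : ℚ → Sieve U
  upper : ℚ → Sieve U
  lower_closed : ∀ q, J.IsClosed (lower q)
  upper_closed : ∀ q, J.IsClosed (upper q)
  lower_inhabited : Locally J U fun _ f => ∃ q, (lower q).arrows f
  upper_inhabited : Locally J U fun _ f => ∃ q, (upper q).arrows f
  lower_rounded : ∀ (q : ℚ) (V : C) (f : V ⟶ U), (lower q).arrows f ↔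
    Locally J V fun _ g => ∃ r, q < r ∧ (lower r).arrows (g ≫ f)
  upper_rounded : ∀ (q : ℚ) (V : C) (f : V ⟶ U), (upper q).arrows f ↔
    Locally J V fun _ g => ∃ r, r < q ∧ (upper r).arrows (g ≫ f)
  disjoint : ∀ (q : ℚ) (V : C) (f : V ⟶ U),
    (lower q).arrows f → (upper q).arrows f → (⊥ : Sieve V) ∈ J V
  located : ∀ q r : ℚ, q < r → Locally J U fun _ f => (lower q).arrows f ∨ (upper r).arrows f

variable {J}

theorem Locally.pullback {U V : C} (f : V ⟶ U) {P : ∀ W : C, (W ⟶ U) → Prop}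
    (h : Locally J U P) : Locally J V fun W g => P W (g ≫ f) := by
  obtain ⟨S, hS, h⟩ := h
  exact ⟨S.pullback f, J.pullback_stable f hS, fun W g hg => h W (g ≫ f) hg⟩

/-- Restriction of a real number to a later stage. -/
def DReal.restrict {U V : C} (f : V ⟶ U) (x : DReal J U) : DReal J V where
  lower q := (x.lower q).pullback f
  upper q := (x.upper q).pullback f
  lower_closed q := J.isClosed_pullback f _ (x.lower_closed q)
  upper_closed q := J.isClosed_pullback f _ (x.upper_closed q)
  lower_inhabited := x.lower_inhabited.pullback f
  upper_inhabited := x.upper_inhabited.pullback f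
  lower_rounded q V g := by simpa using x.lower_rounded q V (g ≫ f)
  upper_rounded q V g := by simpa using x.upper_rounded q V (g ≫ f)
  disjoint q V g := x.disjoint q V (g ≫ f)
  located q r h := (x.located q r h).pullback f

variable (J)

/-- The unit interval: the real numbers `x` with `0 ≤ x` (that is `q < x` for all rational
`q < 0`) and `x ≤ 1` (that is `x < q` for all rational `q > 1`). -/
def UnitInterval : Cᵒᵖ ⥤ Type u where
  obj U := {x : DReal J U.unop // (∀ q < 0, x.lower q = ⊤) ∧ ∀ q > 1, x.upper q = ⊤}
  map f := ↾ fun x => ⟨x.1.restrict f.unop,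
    fun q hq => by simp [DReal.restrict, x.2.1 q hq],
    fun q hq => by simp [DReal.restrict, x.2.2 q hq]⟩
  map_id _ := by
    refine ConcreteCategory.hom_ext _ _ fun x => Subtype.ext ?_
    ext <;> simp [DReal.restrict]
  map_comp f g := by
    refine ConcreteCategory.hom_ext _ _ fun x => Subtype.ext ?_
    ext <;> simp [DReal.restrict]

variable {J}

/-- `x < y` holds at stage `U`: there is a rational number strictly between. -/
def DReal.lt {U : C} (x y : DReal J U) : Prop :=
  Locally J U fun _ f => ∃ q, (x.upper q).arrows f ∧ (y.lower q).arrows f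

/-- `|x - y| < ε` holds at stage `U`, that is, `x < y + ε` and `y < x + ε`. -/
def DReal.near {U : C} (ε : ℚ) (x y : DReal J U) : Prop :=
  (Locally J U fun _ f => ∃ q, (x.upper q).arrows f ∧ (y.lower (q - ε)).arrows f) ∧
  Locally J U fun _ f => ∃ q, (y.upper q).arrows f ∧ (x.lower (q - ε)).arrows f

/-- The real number underlying a point of the unit interval. -/
abbrev toReal {U : C} (x : (UnitInterval J).obj (op U)) : DReal J U := x.1

/-- A subtype of the unit interval at stage `U` is a countable union of open intervals
`{x | a n < x < b n}`: there merely are sequences `a`, `b` of real numbers with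
`A x ↔ ∃ n, a n < x < b n` for all `x`. -/
def IsCountableUnionOfOpenIntervals {U : C} (A : Fn (UnitInterval J) (Omega J) U) : Prop :=
  Locally J U fun V f => ∃ a b : ℕ → DReal J V,
    ∀ (W : C) (g : W ⟶ V) (x : (UnitInterval J).obj (op W)),
      (A.app (g ≫ f) x).1 = (⊤ : Sieve W) ↔
        Locally J W fun _ h => ∃ n,
          ((a n).restrict (h ≫ g)).lt ((toReal x).restrict h) ∧
          ((toReal x).restrict h).lt ((b n).restrict (h ≫ g))

/-- A function `F : I → I` at stage `U` is continuous in the `ε`-`δ` sense: for all `x` and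
`ε > 0` there is `δ > 0` such that for all `y`, `|x - y| < δ` implies `|F x - F y| < ε`. -/
def IsEpsDeltaContinuous {U : C} (F : Fn (UnitInterval J) (UnitInterval J) U) : Prop :=
  ∀ (V : C) (f : V ⟶ U) (x : (UnitInterval J).obj (op V)) (ε : ℚ), 0 < ε →
    Locally J V fun W g => ∃ δ : ℚ, 0 < δ ∧
      ∀ (W' : C) (h : W' ⟶ W) (y : (UnitInterval J).obj (op W')),
        DReal.near δ ((toReal x).restrict (h ≫ g)) (toReal y) →
        DReal.near ε ((toReal (F.app f x)).restrict (h ≫ g)) (toReal (F.app (h ≫ g ≫ f) y))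

end SyntheticStone
end

noncomputable section

namespace SyntheticStone

variable {C : Type u} [SmallCategory C] {J : GrothendieckTopology C}

/-! ### Forcing calculus -/

/-! Internal existence is unfolded into covering sieves throughout. A stage may be covered by the
empty sieve, so an internal contradiction is the statement `⊥ ∈ J V`, and distinct numerals may
agree at such a stage.

Dependent choice gives countable choice, which turns locatedness of a real `x` into a family of bits
deciding, for all rationals `p < q`, between `p < x` and `x < q`. Conversely, a family of bits
obeying countably many Boolean constraints (`Consistent`) defines a point of the interval by
`realOf`. These constraints present the algebra `intervalBoole`; its spectrum is the type of
consistent families and maps onto the interval. Equality is closed because `x = y` says that none of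
countably many decidable certificates for `x < y` or `y < x` holds.

The other two claims rest on `interval_compactness`. Suppose that every point locally has bits `β i
j`, where a 0 proves `R i j` and where `T i` excludes that all of them are 1. Local choice makes the
bits functions on a Stone type covering the interval, Stone duality makes them elements of its
algebra, and countable choice represents these by Boolean terms. If `T i` holds everywhere, the
quotient in which all bits `β i j` are 1 has no points, so it is trivial by Stone duality, and
finitely many terms already join to the top element. That a given initial segment does so is
decidable, which gives the bits `γ i N` simultaneously for all `i`.

Fix an open `A` and a point `x` of `A`. For each `y`, either `A y` is witnessed or `x` and `y` are
separated by a rational gap; compactness leaves finitely many gaps, hence a radius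
(`IsOpenSub.exists_near`). Continuity follows by taking for `A` the preimage of a small rational
interval. Applied to all rational pairs at once, compactness semidecides whether `A` contains a
closed interval `[q, r]` (`IsOpenSub.exists_contains`), and the intervals `(q, r)` so certified
exhaust `A`. -/

theorem Locally.of_forall {U : C} {P : ∀ V : C, (V ⟶ U) → Prop} (h : ∀ V f, P V f) :
    Locally J U P := ⟨⊤, J.top_mem U, fun V f _ => h V f⟩

theorem Locally.mono {U : C} {P Q : ∀ V : C, (V ⟶ U) → Prop} (hP : Locally J U P)
    (h : ∀ V f, P V f → Q V f) : Locally J U Q := by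
  obtain ⟨S, hS, hSP⟩ := hP
  exact ⟨S, hS, fun V f hf => h V f (hSP V f hf)⟩

theorem Locally.and {U : C} {P Q : ∀ V : C, (V ⟶ U) → Prop} (hP : Locally J U P)
    (hQ : Locally J U Q) : Locally J U fun V f => P V f ∧ Q V f := by
  obtain ⟨S, hS, hSP⟩ := hP
  obtain ⟨T, hT, hTQ⟩ := hQ
  exact ⟨S ⊓ T, J.intersection_covering hS hT, fun V f hf => ⟨hSP V f hf.1, hTQ V f hf.2⟩⟩

/-- Transitivity of the topology; in forcing terms, elimination of a local existence statement. -/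
theorem Locally.bind {U : C} {P Q : ∀ V : C, (V ⟶ U) → Prop} (hP : Locally J U P)
    (h : ∀ V f, P V f → Locally J V fun W g => Q W (g ≫ f)) : Locally J U Q := by
  obtain ⟨S, hS, hSP⟩ := hP
  choose R hR hRQ using fun (V : C) (f : V ⟶ U) (hf : S.arrows f) => h V f (hSP V f hf)
  refine ⟨Sieve.bind S.arrows fun V f hf => R V f hf,
    J.bind_covering hS fun V f hf => hR V f hf, ?_⟩
  rintro W _ ⟨V, g, f, hf, hg, rfl⟩
  exact hRQ V f hf W g hg

theorem Locally.of_bot {U : C} {P : ∀ V : C, (V ⟶ U) → Prop} (h : (⊥ : Sieve U) ∈ J U) :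
    Locally J U P := ⟨⊥, h, fun _ _ hf => hf.elim⟩

theorem Locally.bot {U : C} (h : Locally J U fun V _ => (⊥ : Sieve V) ∈ J V) :
    (⊥ : Sieve U) ∈ J U := by
  obtain ⟨S, hS, h⟩ := h
  refine J.transitive hS ⊥ fun V f hf => ?_
  exact h V f hf

theorem Locally.forall_lt {U : C} {P : ℕ → ∀ V : C, (V ⟶ U) → Prop} (k : ℕ)
    (h : ∀ i < k, Locally J U (P i)) : Locally J U fun V f => ∀ i < k, P i V f := by
  induction k with
  | zero => exact .of_forall fun V f i hi => absurd hi (Nat.not_lt_zero i)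
  | succ k ih =>
    refine ((ih fun i hi => h i (by omega)).and (h k (by omega))).mono fun V f hf i hi => ?_
    rcases Nat.lt_succ_iff_lt_or_eq.1 hi with h' | rfl
    exacts [hf.1 i h', hf.2]

theorem closed_of_locally {U V : C} {S : Sieve U} (hS : J.IsClosed S) (f : V ⟶ U)
    (h : Locally J V fun _ g => S.arrows (g ≫ f)) : S.arrows f := by
  obtain ⟨R, hR, h⟩ := h
  refine hS f ?_
  exact J.superset_covering (fun W g hg => h W g hg) hR

theorem isClosed_of_locally {U : C} {S : Sieve U}
    (h : ∀ V (f : V ⟶ U), (Locally J V fun _ g => S.arrows (g ≫ f)) → S.arrows f) :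
    J.IsClosed S := fun V f hf => h V f ⟨S.pullback f, hf, fun _ _ hg => hg⟩

/-- The closed sieve of stages at which a predicate holds locally. -/
def locSieve {U : C} (J : GrothendieckTopology C) (P : ∀ V : C, (V ⟶ U) → Prop) : Sieve U where
  arrows V f := Locally J V fun W g => P W (g ≫ f)
  downward_closed := by
    intro V W f hf g
    simpa using hf.pullback g

theorem locSieve_isClosed {U : C} (P : ∀ V : C, (V ⟶ U) → Prop) :
    J.IsClosed (locSieve J P) := isClosed_of_locally fun V f h =>
  h.bind fun W g hg => by simpa [locSieve] using hg

@[simp] theorem res_res (X : Cᵒᵖ ⥤ Type u) {U V W : C} (f : V ⟶ U) (g : W ⟶ V)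
    (x : X.obj (op U)) : res X g (res X f x) = res X (g ≫ f) x := by
  simp [res]

@[simp] theorem res_id (X : Cᵒᵖ ⥤ Type u) {U : C} (x : X.obj (op U)) : res X (𝟙 U) x = x := by
  simp [res]

/-! ### Gluing -/

theorem sheaf_ext {X : Cᵒᵖ ⥤ Type u} (hX : Presieve.IsSheaf J X) {U : C} {x y : X.obj (op U)}
    (h : Locally J U fun _ f => res X f x = res X f y) : x = y := by
  obtain ⟨S, hS, h⟩ := h
  exact (hX.isSeparated S hS).ext fun V f hf => h V f hf

/-- Unique description: local solutions of a stable property with at most one solution agree on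
overlaps, hence glue. -/
theorem sheaf_glue {X : Cᵒᵖ ⥤ Type u} (hX : Presieve.IsSheaf J X) {U : C}
    (P : ∀ V : C, (V ⟶ U) → X.obj (op V) → Prop)
    (stable : ∀ V W f (g : W ⟶ V) x, P V f x → P W (g ≫ f) (res X g x))
    (unique : ∀ V f x y, P V f x → P V f y → x = y)
    (ex : Locally J U fun V f => ∃ x, P V f x) :
    ∃ z : X.obj (op U), ∀ V f x, P V f x → res X f z = x := by
  obtain ⟨S, hS, h⟩ := ex
  choose x hx using h
  have comp : Presieve.FamilyOfElements.Compatible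
      (fun V f hf => x V f hf : Presieve.FamilyOfElements X S.arrows) := by
    intro V₁ V₂ W g₁ g₂ f₁ f₂ h₁ h₂ e
    have a := stable _ _ _ g₁ _ (hx _ _ h₁)
    have b := stable _ _ _ g₂ _ (hx _ _ h₂)
    rw [e] at a
    exact unique _ _ _ _ a b
  refine ⟨(hX S hS).amalgamate _ comp, fun V f y hy => ?_⟩
  refine sheaf_ext hX ⟨S.pullback f, J.pullback_stable f hS, fun W g hg => ?_⟩
  refine (res_res X f g _).trans (((hX S hS).valid_glue comp (g ≫ f) hg).trans ?_)
  exact unique _ _ _ _ (hx _ _ hg) (stable _ _ _ g _ hy)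

/-! ### Constant sheaves -/

theorem cst_isSheaf (A : Type) : Presieve.IsSheaf J (cst J A) :=
  (isSheaf_iff_isSheaf_of_type _ _).1 ((constantSheaf J (Type u)).obj (ULift.{u} A)).property

@[simp] theorem res_num {A : Type} (a : A) {U V : C} (f : V ⟶ U) :
    res (cst J A) f (num J a U) = num J a V :=
  (NatTrans.naturality_apply (toSheafify J ((Functor.const Cᵒᵖ).obj (ULift.{u} A))) f.op
    (ULift.up a : ULift.{u} A)).symm

theorem exists_num {A : Type} {U : C} (z : (cst J A).obj (op U)) :
    Locally J U fun V f => ∃ a, res (cst J A) f z = num J a V := by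
  refine ⟨_, Presheaf.imageSieve_mem J
    (toSheafify J ((Functor.const Cᵒᵖ).obj (ULift.{u} A))) z, fun V f ⟨a, ha⟩ => ⟨a.down, ha.symm⟩⟩

/-- Equality in the sheafification is local equality in the constant presheaf, where distinct values
never agree. -/
theorem num_inj {A : Type} {U : C} {a b : A} (h : num J a U = num J b U) (hab : a ≠ b) :
    (⊥ : Sieve U) ∈ J U := by
  have := Presheaf.equalizerSieve_mem J
    (toSheafify J ((Functor.const Cᵒᵖ).obj (ULift.{u} A))) (X := op U)
    (ULift.up a : ULift.{u} A) (ULift.up b : ULift.{u} A) h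
  refine J.superset_covering (fun V f hf => ?_) this
  exact (hab (congrArg ULift.down hf)).elim

theorem cst_ext {A : Type} {U : C} {x y : (cst J A).obj (op U)}
    (h : Locally J U fun _ f => res (cst J A) f x = res (cst J A) f y) : x = y :=
  sheaf_ext (cst_isSheaf A) h

theorem cst_ext_num {A : Type} {U : C} {x y : (cst J A).obj (op U)}
    (h : ∀ V (f : V ⟶ U) a, res (cst J A) f x = num J a V → res (cst J A) f y = num J a V) :
    x = y :=
  cst_ext ((exists_num x).mono fun V f ⟨a, ha⟩ => by rw [ha, h V f a ha])

theorem cst_eq_of_bot {A : Type} {U : C} (h : (⊥ : Sieve U) ∈ J U) (x y : (cst J A).obj (op U)) :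
    x = y := cst_ext (.of_bot h)

/-- Unique description for a discrete type. Uniqueness is needed only up to inconsistency of the
stage, since all sections over an inconsistent stage coincide. -/
theorem cst_glue {A : Type} {U : C} (P : ∀ V : C, (V ⟶ U) → A → Prop)
    (stable : ∀ V W f (g : W ⟶ V) a, P V f a → P W (g ≫ f) a)
    (unique : ∀ V f a b, P V f a → P V f b → a ≠ b → (⊥ : Sieve V) ∈ J V)
    (ex : Locally J U fun V f => ∃ a, P V f a) :
    ∃ z : (cst J A).obj (op U), ∀ V f a, res (cst J A) f z = num J a V ↔
      Locally J V fun W g => P W (g ≫ f) a := by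
  obtain ⟨z, hz⟩ := sheaf_glue (cst_isSheaf (J := J) A)
    (fun V f x => ∃ a, P V f a ∧ x = num J a V)
    (by
      rintro V W f g _ ⟨a, ha, rfl⟩
      exact ⟨a, stable _ _ _ _ _ ha, res_num a g⟩)
    (by
      rintro V f _ _ ⟨a, ha, rfl⟩ ⟨b, hb, rfl⟩
      by_cases e : a = b
      · rw [e]
      · exact cst_eq_of_bot (unique _ _ _ _ ha hb e) _ _)
    (ex.mono fun V f ⟨a, ha⟩ => ⟨_, a, ha, rfl⟩)
  refine ⟨z, fun V f a => ⟨fun h => ?_, fun h => ?_⟩⟩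
  · refine (ex.pullback f).bind fun W g ⟨b, hb⟩ => ?_
    by_cases e : a = b
    · subst e
      exact .of_forall fun W' g' => by simpa using stable _ _ _ g' _ hb
    · refine .of_bot (num_inj ?_ e)
      rw [← hz _ _ _ ⟨b, hb, rfl⟩, ← res_num a g, ← h, res_res]
  · refine cst_ext (h.mono fun W g hg => ?_)
    rw [res_res, res_num]
    exact hz _ _ _ ⟨a, hg, rfl⟩

/-! ### Slices -/

/-- Every arrow of the slice has this form once the structure map of its source is generalized, so
statements about slice arrows reduce to arrows of `C`. -/
theorem over_hom_ind {U : C} {X : Over U} {P : ∀ Y : Over U, (Y ⟶ X) → Prop}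
    (h : ∀ V (f : V ⟶ X.left), P (Over.mk (f ≫ X.hom)) (Over.homMk f)) (Y : Over U) (g : Y ⟶ X) :
    P Y g := by
  have key : ∀ (V : C) (y : V ⟶ U) (f : V ⟶ X.left) (e : f ≫ X.hom = y),
      P (Over.mk y) (Over.homMk f e) := by
    rintro V _ f rfl
    exact h V f
  exact key Y.left Y.hom g.left (Over.w g)

theorem locally_over {U : C} {X : Over U} {P : ∀ Y : Over U, (Y ⟶ X) → Prop} :
    Locally (J.over U) X P ↔
      Locally J X.left fun V f => P (Over.mk (f ≫ X.hom)) (Over.homMk f) := by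
  constructor
  · rintro ⟨S, hS, h⟩
    refine ⟨Sieve.overEquiv X S, (J.mem_over_iff S).1 hS, fun V f hf => h _ _ ?_⟩
    exact (Sieve.overEquiv_iff S f).1 hf
  · rintro ⟨S, hS, h⟩
    refine ⟨(Sieve.overEquiv X).symm S, (J.mem_over_iff _).2 (by simpa using hS), ?_⟩
    refine over_hom_ind fun V f hf => h V f ?_
    rw [← Sieve.overEquiv_iff] at hf
    simpa using hf

theorem bot_over {U : C} {X : Over U} :
    (⊥ : Sieve X) ∈ J.over U X ↔ (⊥ : Sieve X.left) ∈ J X.left := by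
  rw [J.mem_over_iff, map_bot]

/-- A section of a constant sheaf is determined by the stages at which it takes each numeral value.
This data is the same over the base and over the slice, and is glued there. -/
theorem exists_toOver {A : Type} {U : C} {X : Over U} (z : (cst J A).obj (op X.left)) :
    ∃ z' : (cst (J.over U) A).obj (op X), ∀ Y (g : Y ⟶ X) a,
      res (cst (J.over U) A) g z' = num (J.over U) a Y ↔
        res (cst J A) g.left z = num J a Y.left := by
  obtain ⟨z', h⟩ := cst_glue (J := J.over U) (U := X)
    (fun Y g a => res (cst J A) g.left z = num J a Y.left)
    (fun Y Y' f g a h => by rw [Over.comp_left, ← res_res, h, res_num])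
    (fun Y f a b ha hb e => bot_over.2 (num_inj (ha.symm.trans hb) e))
    (locally_over.2 (by simpa using exists_num z))
  refine ⟨z', fun Y g a => (h Y g a).trans ⟨fun h => ?_, fun h => ?_⟩⟩
  · refine cst_ext ((locally_over.1 h).mono fun V f hf => ?_)
    simpa using hf
  · exact .of_forall fun W f => by rw [Over.comp_left, ← res_res, h, res_num]

theorem exists_ofOver {A : Type} {U : C} {X : Over U} (z : (cst (J.over U) A).obj (op X)) :
    ∃ z' : (cst J A).obj (op X.left), ∀ Y (g : Y ⟶ X) a,
      res (cst J A) g.left z' = num J a Y.left ↔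
        res (cst (J.over U) A) g z = num (J.over U) a Y := by
  obtain ⟨z', h⟩ := cst_glue (J := J) (U := X.left)
    (fun V f a => res (cst (J.over U) A) (Over.homMk f : Over.mk (f ≫ X.hom) ⟶ X) z =
      num (J.over U) a _)
    (fun V W f g a h => by
      have := congrArg (res (cst (J.over U) A)
        (Over.homMk g : Over.mk ((g ≫ f) ≫ X.hom) ⟶ Over.mk (f ≫ X.hom))) h
      rw [res_res, res_num] at this
      exact this)
    (fun V f a b ha hb e => bot_over.1 (num_inj (ha.symm.trans hb) e))
    (locally_over.1 (exists_num z))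
  refine ⟨z', over_hom_ind fun V f a => (h V f a).trans ⟨fun h => ?_, fun h => ?_⟩⟩
  · refine cst_ext (locally_over.2 (h.mono fun W g hg => ?_))
    rw [res_num, res_res]
    have := congrArg (res (cst (J.over U) A) (Over.homMk (𝟙 W) :
        Over.mk (g ≫ f ≫ X.hom) ⟶ Over.mk ((g ≫ f) ≫ X.hom))) hg
    rw [res_res, res_num] at this
    refine Eq.trans ?_ this
    congr 1
    ext
    simp
  · refine .of_forall fun W g => ?_
    have := congrArg (res (cst (J.over U) A)
        (Over.homMk g : Over.mk ((g ≫ f) ≫ X.hom) ⟶ Over.mk (f ≫ X.hom))) h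
    rw [res_res, res_num] at this
    exact this

/-- A section of a constant sheaf, as a section of the constant sheaf on a slice. -/
def toOver {A : Type} {U : C} {X : Over U} (z : (cst J A).obj (op X.left)) :
    (cst (J.over U) A).obj (op X) := (exists_toOver z).choose

/-- A section of the constant sheaf on a slice, as a section of the constant sheaf. -/
def ofOver {A : Type} {U : C} {X : Over U} (z : (cst (J.over U) A).obj (op X)) :
    (cst J A).obj (op X.left) := (exists_ofOver z).choose

theorem res_toOver_eq_num {A : Type} {U : C} {X Y : Over U} (z : (cst J A).obj (op X.left))
    (g : Y ⟶ X) (a : A) : res (cst (J.over U) A) g (toOver z) = num (J.over U) a Y ↔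
      res (cst J A) g.left z = num J a Y.left := (exists_toOver z).choose_spec Y g a

theorem res_ofOver_eq_num {A : Type} {U : C} {X Y : Over U} (z : (cst (J.over U) A).obj (op X))
    (g : Y ⟶ X) (a : A) : res (cst J A) g.left (ofOver z) = num J a Y.left ↔
      res (cst (J.over U) A) g z = num (J.over U) a Y := (exists_ofOver z).choose_spec Y g a

theorem toOver_eq_num {A : Type} {U : C} {X : Over U} (z : (cst J A).obj (op X.left)) (a : A) :
    toOver z = num (J.over U) a X ↔ z = num J a X.left := by
  simpa using res_toOver_eq_num z (𝟙 X) a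

theorem res_toOver {A : Type} {U : C} {X Y : Over U} (z : (cst J A).obj (op X.left))
    (g : Y ⟶ X) : res (cst (J.over U) A) g (toOver z) = toOver (res (cst J A) g.left z) := by
  refine cst_ext_num fun V f a h => ?_
  rw [res_res, res_toOver_eq_num] at h
  rw [res_toOver_eq_num]
  simpa using h

theorem ofOver_toOver {A : Type} {U : C} {X : Over U} (z : (cst J A).obj (op X.left)) :
    ofOver (toOver z) = z := by
  refine cst_ext_num fun V f a h => ?_
  exact (res_toOver_eq_num z (Over.homMk f : Over.mk (f ≫ X.hom) ⟶ X) a).1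
    ((res_ofOver_eq_num (toOver z) (Over.homMk f : Over.mk (f ≫ X.hom) ⟶ X) a).1 h)

theorem toOver_ofOver {A : Type} {U : C} {X : Over U} (z : (cst (J.over U) A).obj (op X)) :
    toOver (ofOver z) = z := by
  refine cst_ext_num fun Y f a h => ?_
  exact (res_ofOver_eq_num z f a).1 ((res_toOver_eq_num _ f a).1 h)

theorem res_ofOver {A : Type} {U : C} {X Y : Over U} (z : (cst (J.over U) A).obj (op X))
    (g : Y ⟶ X) : res (cst J A) g.left (ofOver z) = ofOver (res (cst (J.over U) A) g z) := by
  conv_rhs => rw [← toOver_ofOver z, res_toOver, ofOver_toOver]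

/-! ### Types of sequences of numerals subject to a local condition -/

/-- The type, in context `U`, of families of elements of a discrete type satisfying a condition. -/
def familyPresheaf {A I : Type} {U : C}
    (P : ∀ V : C, (V ⟶ U) → (I → (cst J A).obj (op V)) → Prop) : (Over U)ᵒᵖ ⥤ Type u where
  obj X := {z : I → (cst J A).obj (op X.unop.left) //
    Locally J X.unop.left fun W g => P W (g ≫ X.unop.hom) fun i => res (cst J A) g (z i)}
  map {X Y} f := ↾ fun z => ⟨fun i => res (cst J A) f.unop.left (z.1 i), by
    simpa using z.2.pullback f.unop.left⟩
  map_id X := ConcreteCategory.hom_ext _ _ fun z => Subtype.ext (by funext i; simp)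
  map_comp f g := ConcreteCategory.hom_ext _ _ fun z => Subtype.ext (by funext i; simp)

theorem familyPresheaf_isSheaf {A I : Type} {U : C}
    (P : ∀ V : C, (V ⟶ U) → (I → (cst J A).obj (op V)) → Prop) :
    Presheaf.IsSheaf (J.over U) (familyPresheaf P) := by
  rw [isSheaf_iff_isSheaf_of_type]
  intro X S hS x hx
  have hF : Presieve.IsSheaf (J.over U) ((Over.forget U).op ⋙ cst J A) :=
    (isSheaf_iff_isSheaf_of_type _ _).1
      (Sheaf.over ((constantSheaf J (Type u)).obj (ULift.{u} A)) U).property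
  have comp : ∀ i : I, Presieve.FamilyOfElements.Compatible
      (P := (Over.forget U).op ⋙ cst J A) (R := S.arrows) (fun Y f hf => (x f hf).1 i) :=
    fun i Y₁ Y₂ Z g₁ g₂ f₁ f₂ h₁ h₂ e => congrFun (congrArg Subtype.val (hx g₁ g₂ h₁ h₂ e)) i
  have glue : ∀ (i : I) (Y : Over U) (f : Y ⟶ X) (hf : S.arrows f),
      res (cst J A) f.left ((hF S hS).amalgamate _ (comp i)) = (x f hf).1 i :=
    fun i Y f hf => (hF S hS).valid_glue (comp i) f hf
  refine ⟨⟨fun i => (hF S hS).amalgamate _ (comp i), ?_⟩, fun Y f hf => ?_, ?_⟩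
  · have h₁ : Locally (J.over U) X fun Y f => S.arrows f := ⟨S, hS, fun _ _ h => h⟩
    refine (locally_over.1 h₁).bind fun V f hf => (x _ hf).2.mono fun W g hg => ?_
    convert hg using 1
    · simp
    · funext i
      exact (res_res (cst J A) f g _).symm.trans (congrArg (res (cst J A) g) (glue i _ _ hf))
  · exact Subtype.ext (funext fun i => glue i Y f hf)
  · intro z hz
    refine Subtype.ext (funext fun i => ?_)
    refine (hF.isSeparated S hS).ext fun Y f hf => ?_
    refine Eq.trans ?_ (glue i Y f hf).symm
    exact congrFun (congrArg Subtype.val (hz f hf)) i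

/-- The sheaf of families of elements of a discrete type satisfying a condition. -/
def familySheaf {A I : Type} {U : C}
    (P : ∀ V : C, (V ⟶ U) → (I → (cst J A).obj (op V)) → Prop) : Sheaf (J.over U) (Type u) :=
  ⟨familyPresheaf P, familyPresheaf_isSheaf P⟩

theorem isLocallySurjective_over {U : C} {F G : (Over U)ᵒᵖ ⥤ Type u} (p : F ⟶ G)
    (h : ∀ (X : Over U) (y : G.obj (op X)), Locally J X.left fun V f =>
      ∃ x : F.obj (op (Over.mk (f ≫ X.hom))), p.app _ x =
        res G (Over.homMk f : Over.mk (f ≫ X.hom) ⟶ X) y) :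
    Presheaf.IsLocallySurjective (J.over U) p where
  imageSieve_mem {X} y := by
    obtain ⟨S, hS, hS'⟩ := (locally_over (P := fun Y f => ∃ x : F.obj (op Y), p.app _ x =
      res G f y)).2 (h X y)
    exact (J.over U).superset_covering (fun Y f hf => hS' Y f hf) hS

theorem locally_exists_preimage {U : C} {F G : (Over U)ᵒᵖ ⥤ Type u} {p : F ⟶ G}
    (h : Presheaf.IsLocallySurjective (J.over U) p) {X : Over U} (y : G.obj (op X)) :
    Locally J X.left fun V f => ∃ x : F.obj (op (Over.mk (f ≫ X.hom))), p.app _ x =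
        res G (Over.homMk f : Over.mk (f ≫ X.hom) ⟶ X) y :=
  (locally_over (P := fun Y f => ∃ x : F.obj (op Y), p.app _ x = res G f y)).1
    ⟨_, h.imageSieve_mem y, fun _ _ hf => hf⟩

/-! ### Countable choice -/

/-- Dependent choice is applied to the types of partial choices of length `k`, with truncation as
projection. -/
theorem countable_choice_nat (dc : DependentChoice J) {A : Type} {U : C}
    (P : ℕ → ∀ V : C, (V ⟶ U) → A → Prop)
    (stable : ∀ n V W f (g : W ⟶ V) a, P n V f a → P n W (g ≫ f) a)
    (ex : ∀ n, Locally J U fun V f => ∃ a, P n V f a) :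
    Locally J U fun V f => ∃ z : ℕ → (cst J A).obj (op V), ∀ n W (g : W ⟶ V) a,
      res (cst J A) g (z n) = num J a W → Locally J W fun W' h => P n W' (h ≫ g ≫ f) a := by
  let Q : ∀ k, ∀ V : C, (V ⟶ U) → (Fin k → (cst J A).obj (op V)) → Prop :=
    fun k V f z => ∀ i, ∃ a, z i = num J a V ∧ P i V f a
  let p : ∀ k, (familySheaf (Q (k + 1))).obj ⟶ (familySheaf (Q k)).obj := fun k =>
    { app := fun X => ↾ fun z => ⟨fun i => z.1 i.castSucc,
        z.2.mono fun V f h i => by simpa using h i.castSucc⟩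
      naturality := fun _ _ _ => rfl }
  have hp : ∀ k, Presheaf.IsLocallySurjective (J.over U) (p k) := by
    intro k
    refine isLocallySurjective_over _ fun X z => ?_
    have hz := z.2
    refine ((ex k).pullback X.hom).mono fun V f ⟨a, ha⟩ => ?_
    -- Appending one locally existing value shows that truncation is surjective.
    refine ⟨⟨Fin.snoc (α := fun _ => (cst J A).obj (op V)) (fun i => res (cst J A) f (z.1 i))
      (num J a V), ?_⟩, ?_⟩
    · refine (hz.pullback f).mono fun W g hg i => ?_
      refine Fin.lastCases ?_ (fun i => ?_) i
      · refine ⟨a, ?_, ?_⟩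
        · simp only [Fin.snoc_last]
          exact res_num a g
        · simpa using stable _ _ _ _ g _ ha
      · obtain ⟨b, hb, hb'⟩ := hg i
        refine ⟨b, ?_, by simpa using hb'⟩
        rw [← hb]
        simp only [Fin.snoc_castSucc]
        exact res_res _ _ _ _
    · refine Subtype.ext (funext fun i => ?_)
      change Fin.snoc (α := fun _ => (cst J A).obj (op V)) (fun i => res (cst J A) f (z.1 i))
        (num J a V) i.castSucc = _
      rw [Fin.snoc_castSucc]
      rfl
  have := dc U (fun k => familySheaf (Q k)) p hp (Over.mk (𝟙 U))
    ⟨Fin.elim0, .of_forall fun _ _ i => i.elim0⟩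
  refine (locally_over.1 this).mono fun V f ⟨x, _, _⟩ => ?_
  -- Only the last entry of each partial choice is read off; coherence of the sequence is not
  -- needed.
  refine ⟨fun n => (x (n + 1)).1 (Fin.last n), fun n W g a h => ?_⟩
  refine (((x (n + 1)).2.pullback g)).bind fun W' k hk => ?_
  obtain ⟨b, hb, hb'⟩ := hk (Fin.last n)
  have e : num J a W' = num J b W' := by
    rw [← hb, ← res_num a k, ← h, res_res]
  by_cases hab : a = b
  · subst hab
    refine .of_forall fun W'' l => ?_
    simpa using stable _ _ _ _ l _ hb'
  · exact .of_bot (num_inj e hab)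

theorem countable_choice (dc : DependentChoice J) {A I : Type} [Countable I] {U : C}
    (P : I → ∀ V : C, (V ⟶ U) → A → Prop)
    (stable : ∀ n V W f (g : W ⟶ V) a, P n V f a → P n W (g ≫ f) a)
    (ex : ∀ n, Locally J U fun V f => ∃ a, P n V f a) :
    Locally J U fun V f => ∃ z : I → (cst J A).obj (op V), ∀ n W (g : W ⟶ V) a,
      res (cst J A) g (z n) = num J a W → Locally J W fun W' h => P n W' (h ≫ g ≫ f) a := by
  rcases isEmpty_or_nonempty I with hI | hI
  · exact .of_forall fun V f => ⟨fun i => hI.elim i, fun i => hI.elim i⟩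
  obtain ⟨e, he⟩ := exists_surjective_nat I
  choose d hd using he
  refine (countable_choice_nat dc (fun n => P (e n)) (fun n => stable (e n))
    fun n => ex (e n)).mono fun V f ⟨z, hz⟩ => ⟨fun i => z (d i), fun i W g a h => ?_⟩
  simpa [hd] using hz (d i) W g a h

/-! ### Dedekind reals -/

theorem DReal.lower_of_lt {U V : C} (x : DReal J U) {q r : ℚ} (h : q < r) {f : V ⟶ U}
    (hr : (x.lower r).arrows f) : (x.lower q).arrows f :=
  (x.lower_rounded q V f).2 (.of_forall fun _ g => ⟨r, h, (x.lower r).downward_closed hr g⟩)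

theorem DReal.upper_of_lt {U V : C} (x : DReal J U) {q r : ℚ} (h : q < r) {f : V ⟶ U}
    (hq : (x.upper q).arrows f) : (x.upper r).arrows f :=
  (x.upper_rounded r V f).2 (.of_forall fun _ g => ⟨q, h, (x.upper q).downward_closed hq g⟩)

theorem DReal.bot_of_le {U V : C} (x : DReal J U) {q r : ℚ} (h : r ≤ q) {f : V ⟶ U}
    (hq : (x.lower q).arrows f) (hr : (x.upper r).arrows f) : (⊥ : Sieve V) ∈ J V := by
  rcases h.lt_or_eq with h | rfl
  · exact x.disjoint r V f (x.lower_of_lt h hq) hr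
  · exact x.disjoint r V f hq hr

/-- From `q < x` pass to some `r` with `q < r < x` and locate `y` against `q < r`; the alternative
`y < r` would give the excluded `y < x`. -/
theorem DReal.lower_of_not_lt {U V : C} {x y : DReal J U} (f : V ⟶ U)
    (h : ∀ W (g : W ⟶ V) q, (y.upper q).arrows (g ≫ f) → (x.lower q).arrows (g ≫ f) →
      (⊥ : Sieve W) ∈ J W) {q : ℚ} (hq : (x.lower q).arrows f) : (y.lower q).arrows f := by
  refine closed_of_locally (y.lower_closed q) f ?_
  refine ((x.lower_rounded q V f).1 hq).bind fun W g ⟨r, hr, hxr⟩ => ?_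
  refine ((y.located q r hr).pullback (g ≫ f)).bind fun W' k hk => ?_
  rcases hk with hk | hk
  · exact .of_forall fun W'' l => by
      simpa using (y.lower q).downward_closed hk l
  · refine .of_bot (h W' (k ≫ g) r (by simpa using hk) ?_)
    simpa using (x.lower r).downward_closed hxr k

theorem DReal.upper_of_not_lt {U V : C} {x y : DReal J U} (f : V ⟶ U)
    (h : ∀ W (g : W ⟶ V) q, (y.upper q).arrows (g ≫ f) → (x.lower q).arrows (g ≫ f) →
      (⊥ : Sieve W) ∈ J W) {q : ℚ} (hq : (y.upper q).arrows f) : (x.upper q).arrows f := by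
  refine closed_of_locally (x.upper_closed q) f ?_
  refine ((y.upper_rounded q V f).1 hq).bind fun W g ⟨r, hr, hyr⟩ => ?_
  refine ((x.located r q hr).pullback (g ≫ f)).bind fun W' k hk => ?_
  rcases hk with hk | hk
  · refine .of_bot (h W' (k ≫ g) r ?_ (by simpa using hk))
    simpa using (y.upper r).downward_closed hyr k
  · exact .of_forall fun W'' l => by
      simpa using (x.upper q).downward_closed hk l

/-- Tightness of the strict order: comparing cuts in both directions identifies the reals. -/
theorem DReal.eq_of_not_lt {U : C} {x y : DReal J U}
    (h : ∀ V (f : V ⟶ U) q, (y.upper q).arrows f → (x.lower q).arrows f → (⊥ : Sieve V) ∈ J V)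
    (h' : ∀ V (f : V ⟶ U) q, (x.upper q).arrows f → (y.lower q).arrows f → (⊥ : Sieve V) ∈ J V) :
    x = y := by
  ext q V f
  · exact ⟨DReal.lower_of_not_lt f fun W g q => h W (g ≫ f) q,
      DReal.lower_of_not_lt f fun W g q => h' W (g ≫ f) q⟩
  · exact ⟨DReal.upper_of_not_lt f fun W g q => h' W (g ≫ f) q,
      DReal.upper_of_not_lt f fun W g q => h W (g ≫ f) q⟩

/-- `d p q`, for `p < q`, decides between `p < x` (the value `0`) and `x < q` (the value `1`). -/
def IsDecision {U : C} (x : DReal J U) (d : ℚ → ℚ → (two J).obj (op U)) : Prop :=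
  ∀ p q, p < q → ∀ V (f : V ⟶ U),
    (res (two J) f (d p q) = num J false V → (x.lower p).arrows f) ∧
    (res (two J) f (d p q) = num J true V → (x.upper q).arrows f)

theorem IsDecision.restrict {U V : C} {x : DReal J U} {d : ℚ → ℚ → (two J).obj (op U)}
    (h : IsDecision x d) (f : V ⟶ U) :
    IsDecision (x.restrict f) fun p q => res (two J) f (d p q) := by
  intro p q hpq W g
  simpa [DReal.restrict] using h p q hpq W (g ≫ f)

/-- Locatedness is one disjunction for each pair of rationals, so countable choice selects all the
bits at once. -/
theorem exists_decision (dc : DependentChoice J) {I : Type} [Countable I] {U : C}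
    (x : I → DReal J U) :
    Locally J U fun V f => ∃ d : I → ℚ → ℚ → (two J).obj (op V),
      ∀ i, IsDecision ((x i).restrict f) (d i) := by
  refine (countable_choice dc (A := Bool) (I := I × ℚ × ℚ) (fun i V f b => i.2.1 < i.2.2 →
    (b = false → ((x i.1).lower i.2.1).arrows f) ∧ (b = true → ((x i.1).upper i.2.2).arrows f))
    ?_ ?_).mono ?_
  · intro i V W f g b h hi
    exact ⟨fun e => Sieve.downward_closed _ ((h hi).1 e) g,
      fun e => Sieve.downward_closed _ ((h hi).2 e) g⟩
  · rintro ⟨i, p, q⟩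
    by_cases hpq : p < q
    · refine ((x i).located p q hpq).mono fun V f h => ?_
      rcases h with h | h
      · exact ⟨false, fun _ => ⟨fun _ => h, by simp⟩⟩
      · exact ⟨true, fun _ => ⟨by simp, fun _ => h⟩⟩
    -- Pairs with `q ≤ p` carry an arbitrary bit.
    · exact .of_forall fun V f => ⟨true, fun h => (hpq h).elim⟩
  · rintro V f ⟨z, hz⟩
    refine ⟨fun i p q => z (i, p, q), fun i p q hpq W g => ⟨fun e => ?_, fun e => ?_⟩⟩
    · refine closed_of_locally ((x i).lower_closed p) (g ≫ f) ?_
      exact (hz (i, p, q) W g _ e).mono fun W' k h => (h hpq).1 rfl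
    · refine closed_of_locally ((x i).upper_closed q) (g ≫ f) ?_
      exact (hz (i, p, q) W g _ e).mono fun W' k h => (h hpq).2 rfl

theorem exists_decision_one (dc : DependentChoice J) {U : C} (x : DReal J U) :
    Locally J U fun V f => ∃ d : ℚ → ℚ → (two J).obj (op V), IsDecision (x.restrict f) d :=
  (exists_decision dc fun _ : Unit => x).mono fun _ _ ⟨d, hd⟩ => ⟨d (), hd ()⟩

/-- The bits are not canonical, so room is needed: from `x < p < q < r < y`, the bit at `(p, (p + q)
/ 2)` cannot be 0 and the bit at `(q, r)` cannot be 1. -/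
theorem locally_lt_iff {U : C} {x y : DReal J U} {d d' : ℚ → ℚ → (two J).obj (op U)}
    (hx : IsDecision x d) (hy : IsDecision y d') : x.lt y ↔ Locally J U fun V f =>
      ∃ p q q' r, p < q ∧ q < q' ∧ q' < r ∧ res (two J) f (d p q) = num J true V ∧
        res (two J) f (d' q' r) = num J false V := by
  constructor
  · intro h
    refine h.bind fun V f ⟨q, hxq, hyq⟩ => ?_
    refine (((x.upper_rounded q V f).1 hxq).and ((y.lower_rounded q V f).1 hyq)).bind ?_
    rintro W g ⟨⟨p, hpq, hp⟩, r, hqr, hr⟩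
    refine ((exists_num (res _ (g ≫ f) (d p ((p + q) / 2)))).and
      (exists_num (res _ (g ≫ f) (d' q r)))).bind ?_
    rintro W' k ⟨⟨a, ha⟩, b, hb⟩
    simp only [res_res] at ha hb
    have hpq' : p < (p + q) / 2 := by linarith
    cases a
    · refine .of_bot (x.bot_of_le le_rfl ((hx p _ hpq' _ _).1 ha) ?_)
      exact Sieve.downward_closed _ hp k
    cases b
    · refine .of_forall fun W'' l => ⟨p, _, q, r, hpq', by linarith, hqr, ?_, ?_⟩
      · simpa using congrArg (res _ l) ha
      · simpa using congrArg (res _ l) hb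
    · refine .of_bot (y.bot_of_le le_rfl ?_ ((hy q r hqr _ _).2 hb))
      exact Sieve.downward_closed _ hr k
  · intro h
    exact h.mono fun V f ⟨p, q, q', r, hpq, hq, hqr, h₁, h₂⟩ =>
      ⟨q, (hx p q hpq V f).2 h₁, y.lower_of_lt hq ((hy q' r hqr V f).1 h₂)⟩

/-! ### Points of the unit interval from decisions -/

/-- The conditions under which decisions describe a point of the unit interval. -/
structure Consistent {U : C} (d : ℚ → ℚ → (two J).obj (op U)) : Prop where
  disjoint : ∀ p q p' q', p < q → p' < q' → q' ≤ p → ∀ V (f : V ⟶ U),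
    res (two J) f (d p q) = num J false V → res (two J) f (d p' q') = num J true V →
      (⊥ : Sieve V) ∈ J V
  zero : ∀ p q, p < q → q ≤ 0 → d p q = num J false U
  one : ∀ p q, p < q → 1 ≤ p → d p q = num J true U

theorem Consistent.restrict {U V : C} {d : ℚ → ℚ → (two J).obj (op U)} (h : Consistent d)
    (f : V ⟶ U) : Consistent fun p q => res (two J) f (d p q) where
  disjoint p q p' q' h₁ h₂ h₃ W g := by
    simpa using h.disjoint p q p' q' h₁ h₂ h₃ W (g ≫ f)
  zero p q h₁ h₂ := by rw [h.zero p q h₁ h₂, res_num]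
  one p q h₁ h₂ := by rw [h.one p q h₁ h₂, res_num]

theorem IsDecision.consistent {U : C} {x : (UnitInterval J).obj (op U)}
    {d : ℚ → ℚ → (two J).obj (op U)} (h : IsDecision (toReal x) d) : Consistent d where
  disjoint p q p' q' h₁ h₂ h₃ V f e e' :=
    x.1.bot_of_le h₃ ((h p q h₁ V f).1 e) ((h p' q' h₂ V f).2 e')
  zero p q hpq hq := by
    refine cst_ext ((exists_num (d p q)).bind fun V f ⟨b, hb⟩ => ?_)
    cases b
    · exact .of_forall fun W g => by simpa using congrArg (res _ g) hb
    -- Roundedness gives a rational `r < q ≤ 0` above `x`; membership in the interval only speaks of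
    -- strictly negative rationals.
    · refine .of_bot (Locally.bot (((x.1.upper_rounded q V f).1 ((h p q hpq V f).2 hb)).mono ?_))
      rintro W g ⟨r, hr, h'⟩
      exact x.1.bot_of_le le_rfl (by rw [x.2.1 r (by linarith)]; trivial) h'
  one p q hpq hp := by
    refine cst_ext ((exists_num (d p q)).bind fun V f ⟨b, hb⟩ => ?_)
    cases b
    · refine .of_bot (Locally.bot (((x.1.lower_rounded p V f).1 ((h p q hpq V f).1 hb)).mono ?_))
      rintro W g ⟨r, hr, h'⟩
      exact x.1.bot_of_le le_rfl h' (by rw [x.2.2 r (by linarith)]; trivial)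
    · exact .of_forall fun W g => by simpa using congrArg (res _ g) hb

/-- The point of the unit interval described by decisions. -/
def realOf {U : C} (d : ℚ → ℚ → (two J).obj (op U)) (hd : Consistent d) :
    (UnitInterval J).obj (op U) where
  val :=
    -- The strict inequality `p < p'` makes the cut rounded whatever the bits are; likewise for the
    -- upper cut.
    { lower p := locSieve J fun V f => ∃ p' q', p < p' ∧ p' < q' ∧
        res (two J) f (d p' q') = num J false V
      upper q := locSieve J fun V f => ∃ p' q', p' < q' ∧ q' < q ∧
        res (two J) f (d p' q') = num J true V
      lower_closed _ := locSieve_isClosed _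
      upper_closed _ := locSieve_isClosed _
      -- Bits at pairs below 0 are forced by `zero`; those above 1 are forced by `one`.
      lower_inhabited := .of_forall fun V f => ⟨-3, .of_forall fun W g =>
        ⟨-2, -1, by norm_num, by norm_num, by
          rw [hd.zero _ _ (by norm_num) (by norm_num), res_num]⟩⟩
      upper_inhabited := .of_forall fun V f => ⟨4, .of_forall fun W g =>
        ⟨2, 3, by norm_num, by norm_num, by
          rw [hd.one _ _ (by norm_num) (by norm_num), res_num]⟩⟩
      lower_rounded q V f := by
        constructor
        · intro h
          refine Locally.mono h fun W g ⟨p', q', h₁, h₂, h₃⟩ => ⟨(q + p') / 2, by linarith, ?_⟩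
          refine .of_forall fun W' k => ⟨p', q', by linarith, h₂, ?_⟩
          rw [← res_res, h₃, res_num]
        · intro h
          refine Locally.bind h fun W g ⟨r, hr, h⟩ => ?_
          refine Locally.mono h fun W' k ⟨p', q', h₁, h₂, h₃⟩ => ⟨p', q', by linarith, h₂, ?_⟩
          simpa using h₃
      upper_rounded q V f := by
        constructor
        · intro h
          refine Locally.mono h fun W g ⟨p', q', h₁, h₂, h₃⟩ => ⟨(q + q') / 2, by linarith, ?_⟩
          refine .of_forall fun W' k => ⟨p', q', h₁, by linarith, ?_⟩
          rw [← res_res, h₃, res_num]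
        · intro h
          refine Locally.bind h fun W g ⟨r, hr, h⟩ => ?_
          refine Locally.mono h fun W' k ⟨p', q', h₁, h₂, h₃⟩ => ⟨p', q', h₁, by linarith, ?_⟩
          simpa using h₃
      disjoint q V f h h' := by
        refine Locally.bot ((Locally.and h h').mono ?_)
        rintro W g ⟨⟨p₁, q₁, h₁, h₂, h₃⟩, p₂, q₂, h₄, h₅, h₆⟩
        exact hd.disjoint p₁ q₁ p₂ q₂ h₂ h₄ (by linarith) _ _ h₃ h₆
      located q r h := by
        -- The middle third of `(q, r)` leaves strict room on both sides.
        refine (exists_num (d (q + (r - q) / 3) (q + 2 * (r - q) / 3))).mono fun V f ⟨b, hb⟩ => ?_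
        cases b
        · refine .inl (.of_forall fun W g => ⟨_, _, ?_, ?_, by rw [← res_res, hb, res_num]⟩) <;>
            linarith
        · refine .inr (.of_forall fun W g => ⟨_, _, ?_, ?_, by rw [← res_res, hb, res_num]⟩) <;>
            linarith }
  property := by
    refine ⟨fun q hq => ?_, fun q hq => ?_⟩
    · ext V f
      refine iff_of_true (.of_forall fun W g => ⟨2 * q / 3, q / 3, by linarith, by linarith, ?_⟩)
        trivial
      rw [hd.zero _ _ (by linarith) (by linarith), res_num]
    · ext V f
      refine iff_of_true (.of_forall fun W g =>
        ⟨1, (1 + q) / 2, by linarith, by linarith, ?_⟩) trivial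
      rw [hd.one _ _ (by linarith) le_rfl, res_num]

theorem unitInterval_ext {U : C} {x y : (UnitInterval J).obj (op U)}
    (h : ∀ q, x.1.lower q = y.1.lower q) (h' : ∀ q, x.1.upper q = y.1.upper q) : x = y :=
  Subtype.ext (DReal.ext (funext h) (funext h'))

theorem res_realOf {U V : C} (f : V ⟶ U) (d : ℚ → ℚ → (two J).obj (op U)) (hd : Consistent d) :
    res (UnitInterval J) f (realOf d hd) = realOf _ (hd.restrict f) := by
  refine unitInterval_ext (fun q => ?_) fun q => ?_
  · ext W g
    change (Locally J W fun W' k => ∃ p' q', q < p' ∧ p' < q' ∧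
        res (two J) (k ≫ g ≫ f) (d p' q') = num J false W') ↔
      Locally J W fun W' k => ∃ p' q', q < p' ∧ p' < q' ∧
        res (two J) (k ≫ g) (res (two J) f (d p' q')) = num J false W'
    simp
  · ext W g
    change (Locally J W fun W' k => ∃ p' q', p' < q' ∧ q' < q ∧
        res (two J) (k ≫ g ≫ f) (d p' q') = num J true W') ↔
      Locally J W fun W' k => ∃ p' q', p' < q' ∧ q' < q ∧
        res (two J) (k ≫ g) (res (two J) f (d p' q')) = num J true W'
    simp

/-- A bit witnessing a strict inequality between the two reals would contradict the cut of `x` that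
the same bit certifies, so tightness applies. -/
theorem IsDecision.realOf_eq {U : C} {x : (UnitInterval J).obj (op U)}
    {d : ℚ → ℚ → (two J).obj (op U)} (h : IsDecision (toReal x) d) (hd : Consistent d) :
    realOf d hd = x := by
  refine Subtype.ext (DReal.eq_of_not_lt (fun V f q h₁ h₂ => ?_) fun V f q h₁ h₂ => ?_)
  · refine Locally.bot (Locally.mono h₂ ?_)
    rintro W g ⟨p', q', hp, hq, e⟩
    exact x.1.bot_of_le hp.le ((h p' q' hq _ _).1 e) (Sieve.downward_closed _ h₁ g)
  · refine Locally.bot (Locally.mono h₁ ?_)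
    rintro W g ⟨p', q', hp, hq, e⟩
    exact x.1.bot_of_le hq.le (Sieve.downward_closed _ h₂ g) ((h p' q' hp _ _).2 e)

/-! ### Presented Boolean algebras -/

instance : Nonempty BTerm := ⟨.top⟩

/-- The indicator function of a Boolean term. -/
def BTerm.indicator (t : BTerm) : (ℕ → Bool) → ULift.{u} (ZMod 2) :=
  fun v => if t.eval v = true then 1 else 0

theorem ulift_zmod_two_add_self (x : ULift.{u} (ZMod 2)) : x + x = 0 :=
  ULift.ext _ _ (CharTwo.add_self_eq_zero x.down)

/-- The free Boolean ring on countably many generators. -/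
def termSubring : Subring ((ℕ → Bool) → ULift.{u} (ZMod 2)) where
  carrier := {f | ∃ t : BTerm, t.indicator = f}
  mul_mem' := by
    rintro _ _ ⟨s, rfl⟩ ⟨t, rfl⟩
    refine ⟨s.inf t, funext fun v => ?_⟩
    by_cases hs : s.eval v = true <;> by_cases ht : t.eval v = true <;>
      simp [BTerm.indicator, BTerm.eval, hs, ht]
  add_mem' := by
    rintro _ _ ⟨s, rfl⟩ ⟨t, rfl⟩
    refine ⟨(s.inf t.compl).sup (s.compl.inf t), funext fun v => ?_⟩
    by_cases hs : s.eval v = true <;> by_cases ht : t.eval v = true <;>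
      simp [BTerm.indicator, BTerm.eval, hs, ht, ulift_zmod_two_add_self]
  one_mem' := ⟨.top, funext fun v => by simp [BTerm.indicator, BTerm.eval]⟩
  zero_mem' := ⟨.bot, funext fun v => by simp [BTerm.indicator, BTerm.eval]⟩
  neg_mem' := by
    rintro _ ⟨s, rfl⟩
    exact ⟨s, funext fun v => eq_neg_of_add_eq_zero_left (ulift_zmod_two_add_self _)⟩

/-- A Boolean term as an element of the free Boolean ring. -/
def BTerm.toRing (t : BTerm) : termSubring.{u} := ⟨t.indicator, t, rfl⟩

theorem BTerm.toRing_apply_ne_zero (t : BTerm) (v : ℕ → Bool) :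
    t.toRing.{u}.1 v ≠ 0 ↔ t.eval v = true := by
  by_cases h : t.eval v = true <;> simp [toRing, indicator, h]

theorem termSubring_mul_self (x : termSubring.{u}) : x * x = x := by
  obtain ⟨_, t, rfl⟩ := x
  refine Subtype.ext (funext fun v => ?_)
  by_cases h : t.eval v = true <;> simp [BTerm.indicator, h]

/-- The ideal generated by the terms which are known to be relations at stage `W`. -/
def relIdeal {W : C} (r : ℕ → (cst J BTerm).obj (op W)) : Ideal termSubring.{u} where
  carrier := {f | ∃ L : List BTerm, (∀ s ∈ L, ∃ i, r i = num J s W) ∧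
    ∀ v, f.1 v ≠ 0 → ∃ s ∈ L, s.eval v = true}
  zero_mem' := ⟨[], by simp, fun v h => (h rfl).elim⟩
  add_mem' := by
    rintro f g ⟨L, hL, hf⟩ ⟨M, hM, hg⟩
    refine ⟨L ++ M, fun s hs => ?_, fun v hv => ?_⟩
    · rcases List.mem_append.1 hs with h | h
      exacts [hL s h, hM s h]
    · by_cases h : f.1 v = 0
      · have h' : g.1 v ≠ 0 := fun e => hv (by
          change f.1 v + g.1 v = 0
          rw [h, e, add_zero])
        obtain ⟨s, hs, e⟩ := hg v h'
        exact ⟨s, List.mem_append.2 (.inr hs), e⟩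
      · obtain ⟨s, hs, e⟩ := hf v h
        exact ⟨s, List.mem_append.2 (.inl hs), e⟩
  smul_mem' := by
    rintro c f ⟨L, hL, hf⟩
    refine ⟨L, hL, fun v hv => hf v fun e => hv ?_⟩
    change c.1 v * f.1 v = 0
    rw [e, mul_zero]

theorem toRing_mem_relIdeal {W : C} (r : ℕ → (cst J BTerm).obj (op W)) (t : BTerm) :
    t.toRing ∈ relIdeal r ↔ ∃ L : List BTerm, (∀ s ∈ L, ∃ i, r i = num J s W) ∧
      ∀ v, t.eval v = true → ∃ s ∈ L, s.eval v = true := by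
  refine exists_congr fun L => and_congr_right fun _ => forall_congr' fun v => ?_
  rw [t.toRing_apply_ne_zero]

theorem relIdeal_mono {V W : C} (r : ℕ → (cst J BTerm).obj (op W)) (f : V ⟶ W) :
    relIdeal r ≤ relIdeal fun i => res (cst J BTerm) f (r i) := by
  rintro x ⟨L, hL, hx⟩
  refine ⟨L, fun s hs => ?_, hx⟩
  obtain ⟨i, hi⟩ := hL s hs
  exact ⟨i, (congrArg _ hi).trans (res_num s f)⟩

/-! ### Sheaves of Boolean rings presented by relations -/

/-- A sequence of Boolean terms in the empty context. -/
structure Relations (J : GrothendieckTopology C) where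
  rel : ∀ W : C, ℕ → (cst J BTerm).obj (op W)
  res_rel : ∀ {V W : C} (f : V ⟶ W) i, res (cst J BTerm) f (rel W i) = rel V i

theorem Relations.relIdeal_le (r : Relations J) {V W : C} (f : V ⟶ W) :
    relIdeal (r.rel W) ≤ relIdeal (r.rel V) := by
  have := relIdeal_mono (r.rel W) f
  simpa only [r.res_rel] using this

/-- The presheaf of Boolean rings presented by the given relations. -/
def Relations.ringPresheaf (r : Relations J) : Cᵒᵖ ⥤ CommRingCat.{u} where
  obj W := CommRingCat.of (termSubring.{u} ⧸ relIdeal (r.rel W.unop))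
  map f := CommRingCat.ofHom (Ideal.Quotient.factor (r.relIdeal_le f.unop))
  map_id W := by
    refine CommRingCat.hom_ext (Ideal.Quotient.ringHom_ext (RingHom.ext fun x => ?_))
    rfl
  map_comp f g := by
    refine CommRingCat.hom_ext (Ideal.Quotient.ringHom_ext (RingHom.ext fun x => ?_))
    rfl

/-- The sheaf of Boolean rings presented by the given relations. -/
def Relations.ringSheaf (r : Relations J) : Sheaf J CommRingCat.{u} :=
  (presheafToSheaf J CommRingCat.{u}).obj r.ringPresheaf

theorem Relations.ringSheaf_isSheaf (r : Relations J) :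
    Presheaf.IsSheaf J (r.ringSheaf.obj ⋙ forget CommRingCat.{u}) :=
  (Presheaf.isSheaf_iff_isSheaf_forget J _ (forget CommRingCat.{u})).1 r.ringSheaf.property

theorem Relations.ringSheaf_ext (r : Relations J) {U : C} {x y : r.ringSheaf.obj.obj (op U)}
    (h : Locally J U fun _ f => r.ringSheaf.obj.map f.op x = r.ringSheaf.obj.map f.op y) : x = y :=
  sheaf_ext ((isSheaf_iff_isSheaf_of_type _ _).1 r.ringSheaf_isSheaf) h

/-- The class of a term, in the sheaf of Boolean rings presented by the given relations. -/
def Relations.cls (r : Relations J) (W : C) : termSubring.{u} →+* r.ringSheaf.obj.obj (op W) :=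
  ((toSheafify J r.ringPresheaf).app (op W)).hom.comp (Ideal.Quotient.mk (relIdeal (r.rel W)))

theorem Relations.map_cls (r : Relations J) {V W : C} (f : V ⟶ W) (x : termSubring.{u}) :
    r.ringSheaf.obj.map f.op (r.cls W x) = r.cls V x :=
  (NatTrans.naturality_apply (toSheafify J r.ringPresheaf) f.op
    (Ideal.Quotient.mk (relIdeal (r.rel W)) x)).symm

theorem Relations.exists_cls (r : Relations J) {U : C} (x : r.ringSheaf.obj.obj (op U)) :
    Locally J U fun V f => ∃ t : BTerm, r.cls V t.toRing = r.ringSheaf.obj.map f.op x := by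
  refine ⟨_, Presheaf.imageSieve_mem J (toSheafify J r.ringPresheaf) x, ?_⟩
  rintro V f ⟨y, hy⟩
  obtain ⟨⟨_, t, rfl⟩, rfl⟩ := Ideal.Quotient.mk_surjective y
  exact ⟨t, hy⟩

/-- Sheafification identifies exactly what is locally identified; this is the source of the covering
in the second clause of `Presents`. -/
theorem Relations.cls_eq_zero (r : Relations J) {U : C} (t : BTerm) :
    r.cls U t.toRing = 0 ↔ Locally J U fun V _ => t.toRing ∈ relIdeal (r.rel V) := by
  constructor
  · intro h
    refine ⟨_, Presheaf.equalizerSieve_mem J (toSheafify J r.ringPresheaf) (X := op U)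
      (Ideal.Quotient.mk (relIdeal (r.rel U)) t.toRing) 0 (h.trans (map_zero _).symm), ?_⟩
    intro V f hf
    exact Ideal.Quotient.eq_zero_iff_mem.1 (hf.trans (map_zero _))
  · intro h
    refine r.ringSheaf_ext (h.mono fun V f hf => ?_)
    rw [r.map_cls, map_zero]
    change ((toSheafify J r.ringPresheaf).app (op V)).hom (Ideal.Quotient.mk _ _) = 0
    rw [Ideal.Quotient.eq_zero_iff_mem.2 hf]
    exact map_zero ((toSheafify J r.ringPresheaf).app (op V)).hom

theorem Relations.mul_self (r : Relations J) {U : C} (x : r.ringSheaf.obj.obj (op U)) :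
    x * x = x := by
  refine r.ringSheaf_ext ((r.exists_cls x).mono fun V f ⟨t, ht⟩ => ?_)
  rw [map_mul, ← ht, ← map_mul, termSubring_mul_self]

/-! ### From Boolean rings to Boolean algebras -/

/-- The sections of the presented sheaf of Boolean rings form a Boolean ring. -/
abbrev Relations.booleanRing (r : Relations J) (U : Cᵒᵖ) : BooleanRing (r.ringSheaf.obj.obj U) where
  __ := (inferInstance : Ring (r.ringSheaf.obj.obj U))
  isIdempotentElem := r.mul_self (U := U.unop)

/-- The sheaf of Boolean algebras presented by the given relations. -/
def Relations.alg (r : Relations J) : Cᵒᵖ ⥤ BoolAlg.{u} where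
  obj U := letI := r.booleanRing U; BoolAlg.of (AsBoolAlg (r.ringSheaf.obj.obj U))
  map {U V} f := letI := r.booleanRing U; letI := r.booleanRing V
    BoolAlg.ofHom (RingHom.asBoolAlg (r.ringSheaf.obj.map f).hom)
  map_id U := by
    refine ConcreteCategory.hom_ext _ _ fun x => ?_
    exact ConcreteCategory.congr_hom (r.ringSheaf.obj.map_id U) x
  map_comp f g := by
    refine ConcreteCategory.hom_ext _ _ fun x => ?_
    exact ConcreteCategory.congr_hom (r.ringSheaf.obj.map_comp f g) x

theorem Relations.alg_isSheaf (r : Relations J) :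
    Presheaf.IsSheaf J (r.alg ⋙ forget BoolAlg.{u}) := r.ringSheaf_isSheaf

/-- The class of a term in the presented Boolean algebra. -/
def Relations.term (r : Relations J) (W : C) (t : BTerm) : r.alg.obj (op W) :=
  letI := r.booleanRing (op W)
  toBoolAlg (r.cls W t.toRing)

theorem Relations.term_eq_bot (r : Relations J) (W : C) (t : BTerm) :
    r.term W t = ⊥ ↔ r.cls W t.toRing = 0 := Iff.rfl

theorem Relations.map_term (r : Relations J) {V W : C} (f : V ⟶ W) (t : BTerm) :
    r.alg.map f.op (r.term W t) = r.term V t := r.map_cls f t.toRing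

theorem BTerm.toRing_top : BTerm.top.toRing.{u} = 1 :=
  Subtype.ext (funext fun v => by simp [toRing, indicator, eval])

theorem BTerm.toRing_bot : BTerm.bot.toRing.{u} = 0 :=
  Subtype.ext (funext fun v => by simp [toRing, indicator, eval])

theorem BTerm.toRing_inf (s t : BTerm) : (s.inf t).toRing.{u} = s.toRing * t.toRing := by
  refine Subtype.ext (funext fun v => ?_)
  by_cases hs : s.eval v = true <;> by_cases ht : t.eval v = true <;>
    simp [toRing, indicator, eval, hs, ht]

theorem BTerm.toRing_sup (s t : BTerm) :
    (s.sup t).toRing.{u} = s.toRing + t.toRing + s.toRing * t.toRing := by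
  refine Subtype.ext (funext fun v => ?_)
  by_cases hs : s.eval v = true <;> by_cases ht : t.eval v = true <;>
    simp [toRing, indicator, eval, hs, ht, ulift_zmod_two_add_self]

theorem BTerm.toRing_compl (t : BTerm) : t.compl.toRing.{u} = 1 + t.toRing := by
  refine Subtype.ext (funext fun v => ?_)
  by_cases ht : t.eval v = true <;>
    simp [toRing, indicator, eval, ht, ulift_zmod_two_add_self]

theorem Relations.eval_term (r : Relations J) (W : C) (t : BTerm) :
    t.eval (fun n => r.term W (.gen n)) = r.term W t := by
  let _ := r.booleanRing (op W)
  induction t with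
  | gen n => rfl
  | top =>
    change (1 : r.ringSheaf.obj.obj (op W)) = r.cls W _
    rw [BTerm.toRing_top, map_one]
  | bot =>
    change (0 : r.ringSheaf.obj.obj (op W)) = r.cls W _
    rw [BTerm.toRing_bot, map_zero]
  | inf s t hs ht =>
    rw [BTerm.eval, hs, ht]
    change r.cls W _ * r.cls W _ = r.cls W _
    rw [BTerm.toRing_inf, map_mul]
  | sup s t hs ht =>
    rw [BTerm.eval, hs, ht]
    change r.cls W _ + r.cls W _ + r.cls W _ * r.cls W _ = r.cls W _
    rw [BTerm.toRing_sup, map_add, map_add, map_mul]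
  | compl t ht =>
    rw [BTerm.eval, ht]
    change 1 + r.cls W _ = r.cls W _
    rw [BTerm.toRing_compl, map_add, map_one]

theorem Relations.presents (r : Relations J) (U : C) :
    Presents J r.alg (fun n => r.term U (.gen n)) (r.rel U) := by
  refine ⟨fun V f b => ?_, fun V f t => ?_⟩
  · refine (r.exists_cls b).mono fun W h ⟨t, ht⟩ => ⟨t, ?_⟩
    simp only [r.map_term, r.eval_term]
    exact ht
  · simp only [r.map_term, r.eval_term, r.res_rel]
    rw [r.term_eq_bot, r.cls_eq_zero]
    simp only [toRing_mem_relIdeal]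
    constructor
    · refine fun h => h.bind fun W _ ⟨L, hL, hv⟩ => ?_
      choose! i hi using hL
      -- Ideal membership uses a finite list of relations, `Presents` an initial segment; the sum of
      -- the indices bounds each of them.
      let k := (L.map i).sum + 1
      have hik : ∀ s ∈ L, i s < k := fun s hs =>
        Nat.lt_succ_of_le (List.le_sum_of_mem (List.mem_map_of_mem hs))
      refine (Locally.forall_lt k fun n _ => exists_num (r.rel W n)).bind fun W' g hg => ?_
      -- Only at a consistent stage must the terms chosen for the initial segment agree with those
      -- in the list.
      by_cases hbot : (⊥ : Sieve W') ∈ J W'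
      · exact .of_bot hbot
      choose! s hs using hg
      refine .of_forall fun W'' l => ⟨k, s, fun n hn => ?_, fun v ht => ?_⟩
      · rw [← r.res_rel l, ← r.res_rel g, hs n hn, res_num]
      · obtain ⟨s', hs', e⟩ := hv v ht
        refine ⟨i s', hik s' hs', ?_⟩
        have := hs _ (hik s' hs')
        rw [hi s' hs', res_num] at this
        by_contra hne
        refine hbot (num_inj this ?_)
        exact fun h' => hne (by rw [← h']; exact e)
    · refine fun h => h.mono fun W _ ⟨k, s, hs, hv⟩ => ⟨(List.range k).map s, ?_, fun v ht => ?_⟩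
      · simp only [List.mem_map, List.mem_range]
        rintro _ ⟨n, hn, rfl⟩
        exact ⟨n, hs n hn⟩
      · obtain ⟨n, hn, e⟩ := hv v ht
        exact ⟨s n, List.mem_map.2 ⟨n, List.mem_range.2 hn, rfl⟩, e⟩

/-- The countably presented Boolean algebra with the given relations. -/
def Relations.boole (r : Relations J) : Boole J where
  alg := r.alg
  isSheaf := r.alg_isSheaf
  countablyPresented _ := .of_forall fun V _ => ⟨_, _, r.presents V⟩

/-! ### Points of presented Boolean algebras -/

/-- A bound for the generators occurring in a term. -/
def BTerm.bound : BTerm → ℕ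
  | gen n => n + 1
  | top => 0
  | bot => 0
  | inf s t => max s.bound t.bound
  | sup s t => max s.bound t.bound
  | compl t => t.bound

theorem BTerm.eval_congr (t : BTerm) {v w : ℕ → Bool} (h : ∀ i < t.bound, v i = w i) :
    t.eval v = t.eval w := by
  induction t with
  | gen n => exact h n (Nat.lt_succ_self n)
  | top => rfl
  | bot => rfl
  | inf s t hs ht =>
    simp only [eval]
    rw [hs fun i hi => h i (lt_max_of_lt_left hi), ht fun i hi => h i (lt_max_of_lt_right hi)]
  | sup s t hs ht =>
    simp only [eval]
    rw [hs fun i hi => h i (lt_max_of_lt_left hi), ht fun i hi => h i (lt_max_of_lt_right hi)]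
  | compl t ht =>
    simp only [eval]
    rw [ht h]

theorem map_eval (B : Cᵒᵖ ⥤ BoolAlg.{u}) {U V : C} (f : V ⟶ U) (t : BTerm)
    (g : ℕ → B.obj (op U)) : B.map f.op (t.eval g) = t.eval fun n => B.map f.op (g n) := by
  induction t with
  | gen n => rfl
  | top => exact TopHomClass.map_top (B.map f.op).hom
  | bot => exact BotHomClass.map_bot (B.map f.op).hom
  | inf s t hs ht =>
    simp only [BTerm.eval]
    rw [← hs, ← ht]
    exact InfHomClass.map_inf (B.map f.op).hom _ _
  | sup s t hs ht =>
    simp only [BTerm.eval]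
    rw [← hs, ← ht]
    exact SupHomClass.map_sup (B.map f.op).hom _ _
  | compl t ht =>
    simp only [BTerm.eval]
    rw [← ht]
    exact map_compl' (B.map f.op).hom _

@[simp] theorem map_map_alg (B : Cᵒᵖ ⥤ BoolAlg.{u}) {U V W : C} (f : V ⟶ U) (g : W ⟶ V)
    (b : B.obj (op U)) : B.map g.op (B.map f.op b) = B.map (g ≫ f).op b := by
  simp

/-- Finitely many bits become numerals on a common cover, while infinitely many need not; this is
why terms carry a `bound`. -/
theorem locally_valuation {U : C} (α : ℕ → (two J).obj (op U)) (k : ℕ) :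
    Locally J U fun V f => ∃ v : ℕ → Bool, ∀ i < k, res (two J) f (α i) = num J (v i) V :=
  (Locally.forall_lt k fun i _ => exists_num (α i)).mono fun V f h => by
    choose! v hv using h
    exact ⟨v, hv⟩

theorem eq_num_of_locally {A : Type} {U : C} {z : (cst J A).obj (op U)} {a : A}
    (h : Locally J U fun V f => res (cst J A) f z = num J a V) : z = num J a U :=
  cst_ext (h.mono fun V f h => by rw [h, res_num])

theorem num_eq_num_iff {A : Type} {U : C} {a b : A} :
    num J a U = num J b U ↔ a = b ∨ (⊥ : Sieve U) ∈ J U := by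
  constructor
  · intro h
    by_cases e : a = b
    exacts [.inl e, .inr (num_inj h e)]
  · rintro (rfl | h)
    exacts [rfl, cst_eq_of_bot h _ _]

/-- A sequence in `2` at which all the relations take the value `0`. -/
def Satisfies {U : C} (α : ℕ → (two J).obj (op U)) (r : ℕ → (cst J BTerm).obj (op U)) : Prop :=
  ∀ V (f : V ⟶ U) n (s : BTerm) (v : ℕ → Bool), res (cst J BTerm) f (r n) = num J s V →
    (∀ i < s.bound, res (two J) f (α i) = num J (v i) V) → s.eval v = true →
    (⊥ : Sieve V) ∈ J V

theorem Presents.restrict {B : Cᵒᵖ ⥤ BoolAlg.{u}} {U V : C} {g : ℕ → B.obj (op U)}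
    {r : ℕ → (cst J BTerm).obj (op U)} (h : Presents J B g r) (f : V ⟶ U) :
    Presents J B (fun n => B.map f.op (g n)) fun n => res (cst J BTerm) f (r n) := by
  refine ⟨fun W k b => ?_, fun W k t => ?_⟩
  · simpa only [map_map_alg, Category.assoc] using h.1 W (k ≫ f) b
  · simpa only [map_map_alg, res_res, Category.assoc] using h.2 W (k ≫ f) t

section Points

variable {B : Cᵒᵖ ⥤ BoolAlg.{u}} {U : C}

theorem SpPt.res_app (s : SpPt J B U) {V W : C} (f : V ⟶ U) (g : W ⟶ V) (b : B.obj (op V)) :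
    res (two J) g (s.hom.app f b) = s.hom.app (g ≫ f) (B.map g.op b) := (s.hom.nat f g b).symm

theorem SpPt.app_compl (s : SpPt J B U) {V : C} (f : V ⟶ U) {b : B.obj (op V)} {β : Bool}
    (h : s.hom.app f b = num J β V) : s.hom.app f (bᶜ : B.obj (op V)) = num J (!β) V := by
  cases β
  · exact (s.map_compl f b).2 h
  · refine cst_ext ((exists_num (s.hom.app f (bᶜ : B.obj (op V)))).bind fun W g ⟨γ, hγ⟩ => ?_)
    cases γ
    · exact .of_forall fun W' k => by simpa using congrArg (res _ k) hγ
    · refine .of_bot (num_inj (a := true) (b := false) ?_ (by decide))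
      have e : B.map g.op bᶜ = (B.map g.op b)ᶜ := map_compl' (B.map g.op).hom b
      rw [s.res_app, e] at hγ
      rw [← (s.map_compl _ _).1 hγ, ← s.res_app, h, res_num]

theorem SpPt.app_inf (s : SpPt J B U) {V : C} (f : V ⟶ U) {b c : B.obj (op V)} {β γ : Bool}
    (hb : s.hom.app f b = num J β V) (hc : s.hom.app f c = num J γ V) :
    s.hom.app f (b ⊓ c : B.obj (op V)) = num J (β && γ) V := by
  refine eq_num_of_locally
    ((exists_num (s.hom.app f (b ⊓ c : B.obj (op V)))).bind fun W g ⟨δ, hδ⟩ => ?_)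
  have e : B.map g.op (b ⊓ c) = B.map g.op b ⊓ B.map g.op c :=
    InfHomClass.map_inf (B.map g.op).hom b c
  have h := s.map_inf (g ≫ f) (B.map g.op b) (B.map g.op c)
  rw [← e, ← s.res_app, ← s.res_app, ← s.res_app, hδ, hb, hc, res_num, res_num] at h
  simp only [num_eq_num_iff] at h
  by_cases hbot : (⊥ : Sieve W) ∈ J W
  · exact .of_bot hbot
  have : δ = (β && γ) := by
    simp only [hbot, or_false] at h
    cases β <;> cases γ <;> cases δ <;> simp_all
  subst this
  exact .of_forall fun W' k => by simpa using congrArg (res _ k) hδ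

theorem SpPt.app_eval (s : SpPt J B U) {V : C} (f : V ⟶ U) (t : BTerm) (g : ℕ → B.obj (op V))
    (v : ℕ → Bool) (h : ∀ i < t.bound, s.hom.app f (g i) = num J (v i) V) :
    s.hom.app f (t.eval g : B.obj (op V)) = num J (t.eval v) V := by
  induction t with
  | gen n => exact h n (Nat.lt_succ_self n)
  | top => exact s.map_top f
  | bot =>
    have := s.app_compl f (s.map_top f)
    rw [compl_top] at this
    exact this
  | inf a b ha hb =>
    exact s.app_inf f (ha fun i hi => h i (lt_max_of_lt_left hi))
      (hb fun i hi => h i (lt_max_of_lt_right hi))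
  | sup a b ha hb =>
    have := s.app_compl f (s.app_inf f (s.app_compl f (ha fun i hi => h i (lt_max_of_lt_left hi)))
      (s.app_compl f (hb fun i hi => h i (lt_max_of_lt_right hi))))
    rw [compl_inf, compl_compl, compl_compl] at this
    refine Eq.trans this ?_
    simp [BTerm.eval]
  | compl a ha => exact s.app_compl f (ha h)

variable {g : ℕ → B.obj (op U)} {r : ℕ → (cst J BTerm).obj (op U)}

/-- Locally every element is a term in the generators, and its value depends on finitely many of
their bits. -/
theorem SpPt.ext_of_presents (hP : Presents J B g r) {s s' : SpPt J B U}
    (h : ∀ n, s.hom.app (𝟙 U) (g n) = s'.hom.app (𝟙 U) (g n)) : s = s' := by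
  refine SpPt.ext (Fn.ext ?_)
  funext V f b
  refine cst_ext ((hP.1 V f b).bind fun W k ⟨t, ht⟩ => ?_)
  refine (locally_valuation (fun n => res _ (k ≫ f) (s.hom.app (𝟙 U) (g n))) t.bound).mono ?_
  rintro W' l ⟨v, hv⟩
  simp only [res_res] at hv
  have e : B.map (l ≫ k).op b = t.eval fun n => B.map (l ≫ k ≫ f).op (g n) := by
    rw [← map_map_alg, ← ht, map_eval]
    simp only [map_map_alg]
  rw [s.res_app, s'.res_app, e, s.app_eval _ t _ v, s'.app_eval _ t _ v]
  · intro i hi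
    rw [← hv i hi, h i, s'.res_app]
    simp only [Category.comp_id, Category.assoc]
  · intro i hi
    rw [← hv i hi, s.res_app]
    simp only [Category.comp_id, Category.assoc]

/-- The value at `b` is found by writing `b` as a term and evaluating the term on `α`. Satisfaction
of the relations makes it independent of the term. -/
theorem exists_spPt_aux (hP : Presents J B g r) {α : ℕ → (two J).obj (op U)}
    (hα : Satisfies α r) {V : C} (f : V ⟶ U) (b : B.obj (op V)) :
    ∃ z : (two J).obj (op V), ∀ W (k : W ⟶ V) (a : Bool), res (two J) k z = num J a W ↔
      Locally J W fun W' l => ∃ (t : BTerm) (v : ℕ → Bool),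
        B.map (l ≫ k).op b = t.eval (fun n => B.map (l ≫ k ≫ f).op (g n)) ∧
        (∀ i < t.bound, res (two J) (l ≫ k ≫ f) (α i) = num J (v i) W') ∧ t.eval v = a := by
  have := cst_glue (J := J) (U := V) (fun W' k a => ∃ (t : BTerm) (v : ℕ → Bool),
        B.map k.op b = t.eval (fun n => B.map (k ≫ f).op (g n)) ∧
        (∀ i < t.bound, res (two J) (k ≫ f) (α i) = num J (v i) W') ∧ t.eval v = a) ?_ ?_ ?_
  · simpa only [Category.assoc] using this
  · rintro W W' k l a ⟨t, v, h₁, h₂, h₃⟩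
    refine ⟨t, v, ?_, fun i hi => ?_, h₃⟩
    · rw [← map_map_alg, h₁, map_eval]
      simp only [map_map_alg, Category.assoc]
    · simpa using congrArg (res _ l) (h₂ i hi)
  · rintro W k _ _ ⟨t, v, h₁, h₂, rfl⟩ ⟨t', v', h₁', h₂', rfl⟩ hne
    -- The symmetric difference of two terms for the same element vanishes in the algebra, hence
    -- lies below finitely many relations. If the two values differed, `α` would make one of these
    -- true.
    let d : BTerm := (t.inf t'.compl).sup (t.compl.inf t')
    have hd : d.eval (fun n => B.map (k ≫ f).op (g n)) = ⊥ := by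
      simp only [d, BTerm.eval]
      rw [← h₁, ← h₁']
      simp
    refine Locally.bot (((hP.2 W (k ≫ f) d).1 hd).bind ?_)
    rintro W' l ⟨n, s, hs, hd'⟩
    -- Large enough for the generators of both terms and of all the relations involved.
    let N := max (max t.bound t'.bound) (∑ i ∈ Finset.range n, (s i).bound)
    refine (locally_valuation (fun i => res _ (l ≫ k ≫ f) (α i)) N).mono fun W'' m ⟨w, hw⟩ => ?_
    simp only [res_res] at hw
    by_contra hbot
    have ht : t.eval w = t.eval v := t.eval_congr fun i hi => by
      have := (hw i (by simp only [N]; omega)).symm.trans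
        (show res (two J) (m ≫ l ≫ k ≫ f) (α i) = num J (v i) W'' by
          simpa using congrArg (res _ (m ≫ l)) (h₂ i hi))
      exact (num_eq_num_iff.1 this).resolve_right hbot
    have ht' : t'.eval w = t'.eval v' := t'.eval_congr fun i hi => by
      have := (hw i (by simp only [N]; omega)).symm.trans
        (show res (two J) (m ≫ l ≫ k ≫ f) (α i) = num J (v' i) W'' by
          simpa using congrArg (res _ (m ≫ l)) (h₂' i hi))
      exact (num_eq_num_iff.1 this).resolve_right hbot
    obtain ⟨i, hi, hsi⟩ := hd' w (by
      simp only [d, BTerm.eval, ht, ht']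
      revert hne
      cases t.eval v <;> cases t'.eval v' <;> simp)
    refine hbot (hα W'' (m ≫ l ≫ k ≫ f) i (s i) w ?_ (fun j hj => hw j ?_) hsi)
    · simpa using congrArg (res _ m) (hs i hi)
    · refine lt_of_lt_of_le hj (le_max_of_le_right ?_)
      exact Finset.single_le_sum (f := fun i => (s i).bound) (fun _ _ => Nat.zero_le _)
        (Finset.mem_range.2 hi)
  · refine (hP.1 V f b).bind fun W k ⟨t, ht⟩ => ?_
    refine (locally_valuation (fun n => res _ (k ≫ f) (α n)) t.bound).mono fun W' l ⟨v, hv⟩ => ?_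
    refine ⟨_, t, v, ?_, fun i hi => ?_, rfl⟩
    · rw [← map_map_alg, ← ht, map_eval]
      simp only [map_map_alg, Category.assoc]
    · simpa using hv i hi

/-- The universal property of the presented algebra, for maps into `2`. -/
theorem exists_spPt (hP : Presents J B g r) {α : ℕ → (two J).obj (op U)} (hα : Satisfies α r) :
    ∃ s : SpPt J B U, ∀ n, s.hom.app (𝟙 U) (g n) = α n := by
  choose z hz using fun (V : C) (f : V ⟶ U) (b : B.obj (op V)) => exists_spPt_aux hP hα f b
  have val : ∀ (V : C) (f : V ⟶ U) (b : B.obj (op V)) (t : BTerm) (v : ℕ → Bool),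
      b = t.eval (fun n => B.map f.op (g n)) →
      (∀ i < t.bound, res (two J) f (α i) = num J (v i) V) → z V f b = num J (t.eval v) V := by
    intro V f b t v hb hv
    have := (hz V f b V (𝟙 V) (t.eval v)).2 (.of_forall fun W l => ⟨t, v, ?_, fun i hi => ?_, rfl⟩)
    · simpa using this
    · simp only [Category.comp_id, Category.id_comp]
      rw [hb, map_eval]
      simp only [map_map_alg]
    · simpa using congrArg (res _ l) (hv i hi)
  have nat : ∀ {V W : C} (f : V ⟶ U) (k : W ⟶ V) (b : B.obj (op V)),
      z W (k ≫ f) (B.map k.op b) = res (two J) k (z V f b) := by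
    intro V W f k b
    refine cst_ext_num fun W' l a h => ?_
    rw [hz] at h
    rw [res_res, hz]
    simpa only [map_map_alg, Category.assoc] using h
  -- On a common cover both elements are terms evaluated at one valuation, so the homomorphism laws
  -- reduce to those of `Bool`.
  have loc : ∀ {V : C} (f : V ⟶ U) (b c : B.obj (op V)), Locally J V fun W k => ∃ β γ : Bool,
      res (two J) k (z V f b) = num J β W ∧ res (two J) k (z V f c) = num J γ W ∧
      res (two J) k (z V f (b ⊓ c : B.obj (op V))) = num J (β && γ) W ∧
      res (two J) k (z V f (bᶜ : B.obj (op V))) = num J (!β) W := by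
    intro V f b c
    refine (hP.1 V f b).bind fun W k ⟨t, ht⟩ => ?_
    refine (hP.1 W (k ≫ f) (B.map k.op c)).bind fun W' l ⟨t', ht'⟩ => ?_
    refine (locally_valuation (fun n => res _ (l ≫ k ≫ f) (α n)) (max t.bound t'.bound)).mono ?_
    rintro W'' m ⟨v, hv⟩
    simp only [res_res] at hv
    have hb : B.map (m ≫ l ≫ k).op b = t.eval fun n => B.map (m ≫ l ≫ k ≫ f).op (g n) := by
      have := congrArg (B.map (m ≫ l).op) ht
      rw [map_eval] at this
      simpa only [map_map_alg, Category.assoc] using this.symm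
    have hc : B.map (m ≫ l ≫ k).op c = t'.eval fun n => B.map (m ≫ l ≫ k ≫ f).op (g n) := by
      have := congrArg (B.map m.op) ht'
      rw [map_eval] at this
      simpa only [map_map_alg, Category.assoc] using this.symm
    refine ⟨t.eval v, t'.eval v, ?_, ?_, ?_, ?_⟩
    all_goals rw [← nat]; simp only [Category.assoc]
    · exact val _ _ _ t v hb fun i hi => hv i (lt_max_of_lt_left hi)
    · exact val _ _ _ t' v hc fun i hi => hv i (lt_max_of_lt_right hi)
    · refine val _ _ _ (t.inf t') v ?_ fun i hi => hv i hi
      rw [BTerm.eval, ← hb, ← hc]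
      exact InfHomClass.map_inf (B.map (m ≫ l ≫ k).op).hom b c
    · refine val _ _ _ t.compl v ?_ fun i hi => hv i (lt_max_of_lt_left hi)
      rw [BTerm.eval, ← hb]
      exact map_compl' (B.map (m ≫ l ≫ k).op).hom b
  refine ⟨⟨⟨fun f b => z _ f b, fun f k b => nat f k b⟩, fun {V} f => ?_, fun {V} f b c => ?_,
    fun {V} f b => ?_⟩, fun n => ?_⟩
  · exact val V f ⊤ .top (fun _ => true) rfl fun i hi => absurd hi (Nat.not_lt_zero i)
  · refine ⟨fun h => ⟨?_, ?_⟩, fun h => ?_⟩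
    all_goals refine eq_num_of_locally ((loc f b c).mono fun W k ⟨β, γ, h₁, h₂, h₃, h₄⟩ => ?_)
    · change z V f _ = _ at h
      change res _ _ (z V f _) = _
      rw [h, res_num, num_eq_num_iff] at h₃
      rw [h₁, num_eq_num_iff]
      exact h₃.imp_left fun e => by revert e; cases β <;> simp
    · change z V f _ = _ at h
      change res _ _ (z V f _) = _
      rw [h, res_num, num_eq_num_iff] at h₃
      rw [h₂, num_eq_num_iff]
      exact h₃.imp_left fun e => by revert e; cases γ <;> simp
    · change z V f _ = _ ∧ z V f _ = _ at h
      change res _ _ (z V f _) = _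
      rw [h.1, res_num, num_eq_num_iff] at h₁
      rw [h.2, res_num, num_eq_num_iff] at h₂
      rw [h₃, num_eq_num_iff]
      rcases h₁ with rfl | h₁
      · exact h₂.imp_left fun e => by simp [← e]
      · exact .inr h₁
  · refine ⟨fun h => ?_, fun h => ?_⟩
    all_goals refine eq_num_of_locally ((loc f b b).mono fun W k ⟨β, γ, h₁, h₂, h₃, h₄⟩ => ?_)
    · change z V f _ = _ at h
      change res _ _ (z V f _) = _
      rw [h, res_num, num_eq_num_iff] at h₄
      rw [h₁, num_eq_num_iff]
      exact h₄.imp_left fun e => by revert e; cases β <;> simp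
    · change z V f _ = _ at h
      change res _ _ (z V f _) = _
      rw [h, res_num, num_eq_num_iff] at h₁
      rw [h₄, num_eq_num_iff]
      exact h₁.imp_left fun e => by simp [← e]
  · change z U (𝟙 U) (g n) = α n
    refine cst_ext ((locally_valuation α (n + 1)).mono fun V f ⟨v, hv⟩ => ?_)
    rw [← nat, hv n (Nat.lt_succ_self n)]
    refine val _ _ _ (.gen n) v ?_ fun i hi => by rw [Category.comp_id]; exact hv i hi
    simp [BTerm.eval]

end Points

/-! ### The Stone type covering the unit interval -/

/-- A sequence of numerals, as relations. -/
def constRelations (J : GrothendieckTopology C) (ρ : ℕ → BTerm) : Relations J where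
  rel W n := num J (ρ n) W
  res_rel f n := res_num (ρ n) f

/-- Each relation lies below itself, so it vanishes in the algebra and no homomorphism sends it to
1. This is the converse of `exists_spPt`. -/
theorem SpPt.satisfies {B : Cᵒᵖ ⥤ BoolAlg.{u}} {U : C} {g : ℕ → B.obj (op U)}
    {r : ℕ → (cst J BTerm).obj (op U)} (hP : Presents J B g r) (s : SpPt J B U) :
    Satisfies (fun n => s.hom.app (𝟙 U) (g n)) r := by
  intro V f n t v ht hv htv
  have hbot : t.eval (fun n => B.map f.op (g n)) = ⊥ := by
    refine (hP.2 V f t).2 ?_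
    refine (Locally.forall_lt (n + 1) fun i _ => exists_num (res _ f (r i))).mono fun W k h => ?_
    choose! σ hσ using h
    -- Terms are required for the whole initial segment; position `n` must be the given term `t`,
    -- the others are arbitrary local values.
    refine ⟨n + 1, fun i => if i = n then t else σ i, fun i hi => ?_, fun w hw =>
      ⟨n, Nat.lt_succ_self n, by simpa using hw⟩⟩
    by_cases e : i = n
    · subst e
      simpa using congrArg (res _ k) ht
    · simpa [e] using hσ i hi
  have h₁ := s.app_eval f t (fun n => B.map f.op (g n)) v fun i hi => by
    rw [← hv i hi, s.res_app, Category.comp_id]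
  rw [hbot] at h₁
  have h₂ := s.app_eval f .bot (fun n => B.map f.op (g n)) v fun i hi =>
    absurd hi (Nat.not_lt_zero i)
  exact num_inj (a := true) (b := false) ((htv ▸ h₁).symm.trans h₂) (by decide)

/-- The generator for the decision between `p < x` and `x < q`. -/
def decisionCode (p q : ℚ) : ℕ := Denumerable.eqv (ℚ × ℚ) (p, q)

open Classical in
/-- The relations expressing that decisions are consistent. -/
def intervalRelation : ℕ → BTerm := fun n =>
  match (Encodable.decode n : Option ((ℚ × ℚ) × (ℚ × ℚ) ⊕ (ℚ × ℚ) ⊕ (ℚ × ℚ))) with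
  | some (.inl ((p, q), (p', q'))) => if p < q ∧ p' < q' ∧ q' ≤ p then
      (BTerm.gen (decisionCode p q)).compl.inf (.gen (decisionCode p' q')) else .bot
  | some (.inr (.inl (p, q))) => if p < q ∧ q ≤ 0 then .gen (decisionCode p q) else .bot
  | some (.inr (.inr (p, q))) => if p < q ∧ 1 ≤ p then (BTerm.gen (decisionCode p q)).compl
      else .bot
  | none => .bot

/-- Together with `satisfies_of_consistent`, this identifies points of the spectrum with consistent
families of bits. -/
theorem consistent_of_satisfies {U : C} {α : ℕ → (two J).obj (op U)}
    (h : Satisfies α ((constRelations J intervalRelation).rel U)) :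
    Consistent fun p q => α (decisionCode p q) := by
  have key : ∀ i τ, intervalRelation i = τ → ∀ V (f : V ⟶ U),
      (Locally J V fun W k => ∃ v : ℕ → Bool,
        (∀ j < τ.bound, res (two J) (k ≫ f) (α j) = num J (v j) W) ∧ τ.eval v = true) →
      (⊥ : Sieve V) ∈ J V := by
    rintro i _ rfl V f hl
    exact Locally.bot (hl.mono fun W k ⟨v, hv, hv'⟩ => h W (k ≫ f) i _ v (res_num _ _) hv hv')
  constructor
  · intro p q p' q' h₁ h₂ h₃ V f e e'
    have hr : intervalRelation (Encodable.encode
        (Sum.inl ((p, q), (p', q')) : (ℚ × ℚ) × (ℚ × ℚ) ⊕ (ℚ × ℚ) ⊕ (ℚ × ℚ))) =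
        (BTerm.gen (decisionCode p q)).compl.inf (.gen (decisionCode p' q')) := by
      simp only [intervalRelation, Encodable.encodek]
      exact if_pos ⟨h₁, h₂, h₃⟩
    refine key _ _ hr V f ?_
    refine (locally_valuation (fun n => res _ f (α n))
      ((BTerm.gen (decisionCode p q)).compl.inf (.gen (decisionCode p' q'))).bound).mono
        fun W k ⟨v, hv⟩ => ?_
    simp only [res_res] at hv
    by_cases hbot : (⊥ : Sieve W) ∈ J W
    -- At an inconsistent stage every valuation is admissible, so one making the relation true is
    -- supplied. The two codes differ, since `q' ≤ p < q`.
    · exact ⟨fun i => if i = decisionCode p q then false else true,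
        fun _ _ => cst_eq_of_bot hbot _ _, by
          have : decisionCode p' q' ≠ decisionCode p q := fun e => by
            have := Prod.ext_iff.1 ((Denumerable.eqv (ℚ × ℚ)).injective e)
            simp only at this
            linarith [this.1, this.2]
          simp [BTerm.eval, this]⟩
    refine ⟨v, hv, ?_⟩
    have a := hv (decisionCode p q) (by simp [BTerm.bound])
    have b := hv (decisionCode p' q') (by simp [BTerm.bound])
    rw [← res_res, e, res_num, num_eq_num_iff] at a
    rw [← res_res, e', res_num, num_eq_num_iff] at b
    simp [BTerm.eval, ← a.resolve_right hbot, ← b.resolve_right hbot]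
  · intro p q hpq hq
    have hr : intervalRelation (Encodable.encode
        (Sum.inr (Sum.inl (p, q)) : (ℚ × ℚ) × (ℚ × ℚ) ⊕ (ℚ × ℚ) ⊕ (ℚ × ℚ))) =
        .gen (decisionCode p q) := by
      simp only [intervalRelation, Encodable.encodek]
      exact if_pos ⟨hpq, hq⟩
    refine eq_num_of_locally
      ((locally_valuation α (decisionCode p q + 1)).mono fun V f ⟨v, hv⟩ => ?_)
    rw [hv _ (Nat.lt_succ_self _), num_eq_num_iff]
    by_cases e : v (decisionCode p q) = false
    · exact .inl e
    · refine .inr (key _ _ hr V f ?_)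
      refine .of_forall fun W k => ⟨v, fun j hj => ?_, by simpa [BTerm.eval] using e⟩
      rw [← res_res, hv j hj, res_num]
  · intro p q hpq hp
    have hr : intervalRelation (Encodable.encode
        (Sum.inr (Sum.inr (p, q)) : (ℚ × ℚ) × (ℚ × ℚ) ⊕ (ℚ × ℚ) ⊕ (ℚ × ℚ))) =
        (BTerm.gen (decisionCode p q)).compl := by
      simp only [intervalRelation, Encodable.encodek]
      exact if_pos ⟨hpq, hp⟩
    refine eq_num_of_locally
      ((locally_valuation α (decisionCode p q + 1)).mono fun V f ⟨v, hv⟩ => ?_)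
    rw [hv _ (Nat.lt_succ_self _), num_eq_num_iff]
    by_cases e : v (decisionCode p q) = true
    · exact .inl e
    · refine .inr (key _ _ hr V f ?_)
      refine .of_forall fun W k => ⟨v, fun j hj => ?_, by simpa [BTerm.eval] using e⟩
      rw [← res_res, hv j hj, res_num]

theorem satisfies_of_consistent {U : C} {α : ℕ → (two J).obj (op U)}
    (h : Consistent fun p q => α (decisionCode p q)) :
    Satisfies α ((constRelations J intervalRelation).rel U) := by
  intro V f n s v hs hv hsv
  change res _ f (num J _ U) = _ at hs
  rw [res_num, num_eq_num_iff] at hs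
  rcases hs with rfl | hs
  swap
  · exact hs
  revert hv hsv
  unfold intervalRelation
  split
  · split_ifs with hc
    · intro hv hsv
      simp only [BTerm.eval, BTerm.bound] at hv hsv
      have hsv := inf_eq_top_iff.1 hsv
      refine h.disjoint _ _ _ _ hc.1 hc.2.1 hc.2.2 V f ?_ ?_
      · rw [hv _ (by simp)]
        rw [show v _ = false by simpa using hsv.1]
      · rw [hv _ (by simp), show v _ = true from hsv.2]
    · intro _ hsv
      simp [BTerm.eval] at hsv
  · split_ifs with hc
    · intro hv hsv
      simp only [BTerm.eval, BTerm.bound] at hv hsv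
      have := hv _ (Nat.lt_succ_self _)
      rw [hsv, h.zero _ _ hc.1 hc.2, res_num] at this
      exact num_inj this (by decide)
    · intro _ hsv
      simp [BTerm.eval] at hsv
  · split_ifs with hc
    · intro hv hsv
      simp only [BTerm.eval, BTerm.bound] at hv hsv
      have := hv _ (Nat.lt_succ_self _)
      rw [h.one _ _ hc.1 hc.2, res_num] at this
      refine num_inj this ?_
      intro e
      simp [← e] at hsv
    · intro _ hsv
      simp [BTerm.eval] at hsv
  · intro _ hsv
    simp [BTerm.eval] at hsv

/-- The Boolean algebra of decisions for points of the unit interval. -/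
def intervalBoole (J : GrothendieckTopology C) : Boole J :=
  (constRelations J intervalRelation).boole

theorem consistent_toOver {U : C} {X : Over U} {d : ℚ → ℚ → (two J).obj (op X.left)} :
    Consistent (fun p q => (toOver (d p q) : (two (J.over U)).obj (op X))) ↔ Consistent d := by
  constructor
  · intro h
    refine ⟨fun p q p' q' h₁ h₂ h₃ V f e e' => ?_, fun p q h₁ h₂ => ?_, fun p q h₁ h₂ => ?_⟩
    · refine bot_over.1 (h.disjoint p q p' q' h₁ h₂ h₃ (Over.mk (f ≫ X.hom)) (Over.homMk f) ?_ ?_)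
      · exact (res_toOver_eq_num _ _ _).2 e
      · exact (res_toOver_eq_num _ _ _).2 e'
    · exact (toOver_eq_num _ _).1 (h.zero p q h₁ h₂)
    · exact (toOver_eq_num _ _).1 (h.one p q h₁ h₂)
  · intro h
    refine ⟨fun p q p' q' h₁ h₂ h₃ Y f e e' => ?_, fun p q h₁ h₂ => ?_, fun p q h₁ h₂ => ?_⟩
    · refine bot_over.2 (h.disjoint p q p' q' h₁ h₂ h₃ Y.left f.left ?_ ?_)
      · exact (res_toOver_eq_num _ _ _).1 e
      · exact (res_toOver_eq_num _ _ _).1 e'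
    · exact (toOver_eq_num _ _).2 (h.zero p q h₁ h₂)
    · exact (toOver_eq_num _ _).2 (h.one p q h₁ h₂)

/-- The generator of `intervalBoole` deciding between `p < x` and `x < q`. -/
def intervalGen (J : GrothendieckTopology C) (X : C) (n : ℕ) : (intervalBoole J).alg.obj (op X) :=
  (constRelations J intervalRelation).term X (.gen n)

theorem map_intervalGen {X Y : C} (f : Y ⟶ X) (n : ℕ) :
    (intervalBoole J).alg.map f.op (intervalGen J X n) = intervalGen J Y n :=
  Relations.map_term _ _ _

theorem intervalBoole_presents (X : C) : Presents J (intervalBoole J).alg (intervalGen J X)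
    ((constRelations J intervalRelation).rel X) := Relations.presents _ X

section Decisions

variable {U : C}

/-- The decisions described by a point of the spectrum of `intervalBoole`. -/
def decOf {X : Over U} (s : SpPt (J.over U) (intervalBoole (J.over U)).alg X) (p q : ℚ) :
    (two J).obj (op X.left) :=
  ofOver (s.hom.app (𝟙 X) (intervalGen (J.over U) X (decisionCode p q)))

theorem decOf_consistent {X : Over U} (s : SpPt (J.over U) (intervalBoole (J.over U)).alg X) :
    Consistent (decOf s) := by
  rw [← consistent_toOver]
  simp only [decOf, toOver_ofOver]
  exact consistent_of_satisfies (s.satisfies (intervalBoole_presents X))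

theorem decOf_restrict {X Y : Over U} (f : Y ⟶ X)
    (s : SpPt (J.over U) (intervalBoole (J.over U)).alg X) (p q : ℚ) :
    decOf (s.restrict f) p q = res (two J) f.left (decOf s p q) := by
  refine Eq.trans ?_ (res_ofOver _ f).symm
  refine congrArg ofOver ?_
  rw [s.res_app, map_intervalGen]
  change s.hom.app (𝟙 Y ≫ f) _ = _
  rw [Category.id_comp, Category.comp_id]

theorem exists_decOf {X : Over U} {d : ℚ → ℚ → (two J).obj (op X.left)} (hd : Consistent d) :
    ∃ s : SpPt (J.over U) (intervalBoole (J.over U)).alg X, decOf s = d := by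
  let α : ℕ → (two (J.over U)).obj (op X) := fun n =>
    toOver (d ((Denumerable.eqv (ℚ × ℚ)).symm n).1 ((Denumerable.eqv (ℚ × ℚ)).symm n).2)
  have hα : ∀ p q, α (decisionCode p q) = toOver (d p q) := fun p q => by
    simp only [α, decisionCode, Equiv.symm_apply_apply]
  obtain ⟨s, hs⟩ := exists_spPt (intervalBoole_presents (J := J.over U) X)
    (α := α) (satisfies_of_consistent (by simpa only [hα] using consistent_toOver.2 hd))
  refine ⟨s, funext fun p => funext fun q => ?_⟩
  refine (congrArg ofOver (hs (decisionCode p q))).trans ?_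
  rw [hα, ofOver_toOver]

end Decisions

theorem realOf_congr {U : C} {d d' : ℚ → ℚ → (two J).obj (op U)} (h : d = d') (hd : Consistent d)
    (hd' : Consistent d') : realOf d hd = realOf d' hd' := by
  subst h
  rfl

/-- Every natural number codes a pair of rationals, so the decisions exhaust the generators. -/
theorem decOf_injective {U : C} {X : Over U}
    {s s' : SpPt (J.over U) (intervalBoole (J.over U)).alg X} (h : decOf s = decOf s') :
    s = s' := by
  have key : ∀ p q, s.hom.app (𝟙 X) (intervalGen (J.over U) X (decisionCode p q)) =
      s'.hom.app (𝟙 X) (intervalGen (J.over U) X (decisionCode p q)) := by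
    intro p q
    have := congrArg toOver (congrFun (congrFun h p) q)
    simpa only [decOf, toOver_ofOver] using this
  refine SpPt.ext_of_presents (intervalBoole_presents X) fun n => ?_
  obtain ⟨⟨p, q⟩, rfl⟩ := (Denumerable.eqv (ℚ × ℚ)).surjective n
  exact key p q

/-- The surjection from a Stone type onto the unit interval. -/
def intervalMap (J : GrothendieckTopology C) (U : C) :
    Sp (J.over U) (intervalBoole (J.over U)).alg ⟶ (Over.forget U).op ⋙ UnitInterval J where
  app X := ↾ fun s => realOf (decOf s) (decOf_consistent s)
  naturality X Y f := by
    refine ConcreteCategory.hom_ext _ _ fun s => ?_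
    have h : decOf (SpPt.restrict f.unop s) = _ :=
      funext fun p => funext fun q => decOf_restrict f.unop s p q
    exact (realOf_congr h (decOf_consistent (SpPt.restrict f.unop s)) _).trans
      (res_realOf f.unop.left (decOf s) (decOf_consistent s)).symm

theorem exists_consistent (dc : DependentChoice J) {U : C} (x : (UnitInterval J).obj (op U)) :
    Locally J U fun V f => ∃ (d : ℚ → ℚ → (two J).obj (op V)) (hd : Consistent d),
      realOf d hd = res (UnitInterval J) f x := by
  refine (exists_decision_one dc x.1).mono fun V f ⟨d, hd⟩ => ?_
  have hd' : IsDecision (toReal (res (UnitInterval J) f x)) d := hd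
  exact ⟨d, hd'.consistent, hd'.realOf_eq _⟩

theorem intervalMap_surjective (dc : DependentChoice J) (U : C) :
    Presheaf.IsLocallySurjective (J.over U) (intervalMap J U) := by
  refine isLocallySurjective_over _ fun X y => ?_
  refine (exists_consistent dc y).mono fun V f ⟨d, hd, e⟩ => ?_
  obtain ⟨s, hs⟩ := exists_decOf (X := Over.mk (f ≫ X.hom)) hd
  exact ⟨s, (realOf_congr hs (decOf_consistent s) hd).trans e⟩

/-! ### Local choice over the unit interval -/

theorem Consistent.of_locally {U : C} {d : ℚ → ℚ → (two J).obj (op U)}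
    (h : Locally J U fun V f => Consistent fun p q => res (two J) f (d p q)) : Consistent d := by
  refine ⟨fun p q p' q' h₁ h₂ h₃ V f e e' => ?_, fun p q h₁ h₂ => ?_, fun p q h₁ h₂ => ?_⟩
  · refine Locally.bot ((h.pullback f).mono fun W g hc => ?_)
    refine hc.disjoint p q p' q' h₁ h₂ h₃ W (𝟙 W) ?_ ?_
    · simpa using congrArg (res _ g) e
    · simpa using congrArg (res _ g) e'
  · exact eq_num_of_locally (h.mono fun V f hc => hc.zero p q h₁ h₂)
  · exact eq_num_of_locally (h.mono fun V f hc => hc.one p q h₁ h₂)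

/-- A Stone type covering the unit interval, and on it a witness of a family of properties. -/
structure StoneWitness {U : C} (I : Type)
    (P : ∀ V : C, (V ⟶ U) → (UnitInterval J).obj (op V) → (I → (two J).obj (op V)) → Prop) where
  alg : Boole (J.over U)
  pt : ∀ X : Over U, SpPt (J.over U) alg.alg X → (UnitInterval J).obj (op X.left)
  wit : ∀ X : Over U, SpPt (J.over U) alg.alg X → I → (two J).obj (op X.left)
  res_wit : ∀ {X Y : Over U} (f : Y ⟶ X) s i,
    res (two J) f.left (wit X s i) = wit Y (s.restrict f) i
  spec : ∀ (X : Over U) s, Locally J X.left fun V f =>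
    P V (f ≫ X.hom) (res (UnitInterval J) f (pt X s)) fun i => res (two J) f (wit X s i)
  surj : ∀ (X : Over U) (y : (UnitInterval J).obj (op X.left)), Locally J X.left fun V f =>
    ∃ s, pt (Over.mk (f ≫ X.hom)) s = res (UnitInterval J) f y

/-- Local choice applies to families over a spectrum, so the property is pulled back to the spectrum
of `intervalBoole`. The total type stores the decisions together with the witness, so that a section
on the new cover yields both the point and its witness. -/
theorem interval_local_choice (lc : LocalChoice J) (dc : DependentChoice J) {U : C} {I : Type}
    (P : ∀ V : C, (V ⟶ U) → (UnitInterval J).obj (op V) → (I → (two J).obj (op V)) → Prop)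
    (stable : ∀ V W f (g : W ⟶ V) x β, P V f x β →
      P W (g ≫ f) (res (UnitInterval J) g x) fun i => res (two J) g (β i))
    (ex : ∀ V (f : V ⟶ U) x, Locally J V fun W g =>
      ∃ β, P W (g ≫ f) (res (UnitInterval J) g x) β) :
    Locally J U fun V f => Nonempty (StoneWitness I fun W g => P W (g ≫ f)) := by
  let Q : ∀ V : C, (V ⟶ U) → ((ℚ × ℚ) ⊕ I → (two J).obj (op V)) → Prop := fun V f z =>
    ∃ hd : Consistent (fun p q => z (.inl (p, q))), P V f (realOf _ hd) fun i => z (.inr i)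
  have cons : ∀ {X : Over U} (z : (familySheaf Q).obj.obj (op X)),
      Consistent fun p q => z.1 (.inl (p, q)) := fun z =>
    Consistent.of_locally (z.2.mono fun _ _ h => h.choose)
  choose pt hpt using fun (X : Over U) (z : (familySheaf Q).obj.obj (op X)) =>
    exists_decOf (cons z)
  let p : (familySheaf Q).obj ⟶ Sp (J.over U) (intervalBoole (J.over U)).alg :=
    { app := fun X => ↾ fun z => pt X.unop z
      naturality := fun X Y f => by
        refine ConcreteCategory.hom_ext _ _ fun z => ?_
        refine decOf_injective ((hpt _ _).trans ?_)
        funext a b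
        refine Eq.trans ?_ (decOf_restrict f.unop (pt X.unop z) a b).symm
        rw [hpt]
        rfl }
  have hp : Presheaf.IsLocallySurjective (J.over U) p := by
    refine isLocallySurjective_over _ fun X s => ?_
    refine (ex X.left X.hom (realOf (decOf s) (decOf_consistent s))).mono fun V f ⟨β, hβ⟩ => ?_
    rw [res_realOf] at hβ
    refine ⟨⟨Sum.elim (fun a => res (two J) f (decOf s a.1 a.2)) β, ?_⟩, ?_⟩
    · refine .of_forall fun W g => ⟨((decOf_consistent s).restrict f).restrict g, ?_⟩
      have := stable _ _ _ g _ _ hβ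
      rw [res_realOf] at this
      simpa using this
    · refine decOf_injective ((hpt _ _).trans ?_)
      funext a b
      exact (decOf_restrict (Over.homMk f : Over.mk (f ≫ X.hom) ⟶ X) s a b).symm
  refine (lc U (intervalBoole (J.over U)) (familySheaf Q) p hp).mono fun V f ⟨D, q, e, hq, he⟩ => ?_
  let z : ∀ X : Over V, SpPt (J.over V) D.alg X →
      (familySheaf Q).obj.obj (op ((Over.map f).obj X)) := fun X s => e.app (op X) s
  have hz : ∀ {X Y : Over V} (g : Y ⟶ X) s i,
      res (two J) g.left ((z X s).1 i) = (z Y (s.restrict g)).1 i := by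
    intro X Y g s i
    have := NatTrans.naturality_apply e g.op s
    exact (congrFun (congrArg Subtype.val this) i).symm
  refine ⟨⟨D, fun X s => realOf _ (cons (z X s)), fun X s i => (z X s).1 (.inr i),
    fun {X Y} g s i => hz g s _, fun X s => ?_, fun X y => ?_⟩⟩
  · refine (z X s).2.mono fun W g ⟨hd, h⟩ => ?_
    rw [res_realOf]
    convert h using 1
    simp
  -- A point is lifted first to its decisions, then along the surjection supplied by local choice.
  · refine (exists_consistent dc y).bind fun W g ⟨d, hd, hy⟩ => ?_
    obtain ⟨s₀, hs₀⟩ := exists_decOf (X := (Over.map f).obj (Over.mk (g ≫ X.hom))) hd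
    refine (locally_exists_preimage hq (X := Over.mk (g ≫ X.hom)) s₀).mono fun W' k ⟨s, hs⟩ => ?_
    rw [Category.assoc]
    refine ⟨s, ?_⟩
    rw [← res_res, ← hy, res_realOf]
    refine realOf_congr ?_ _ _
    rw [← hpt]
    have : p.app _ (e.app _ s) = res _ _ s₀ :=
      (ConcreteCategory.congr_hom (NatTrans.congr_app he _) s).trans hs
    refine (congrArg decOf this).trans ?_
    funext a b
    rw [← hs₀]
    exact decOf_restrict ((Over.map f).map
      (Over.homMk k : Over.mk (k ≫ g ≫ X.hom) ⟶ Over.mk (g ≫ X.hom))) s₀ a b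

/-! ### Decidable, open and closed propositions -/

/-- A decidable proposition. -/
def DecSieve (J : GrothendieckTopology C) {U : C} (S : Sieve U) : Prop :=
  J.IsClosed S ∧ Locally J U fun V f =>
    S.arrows f ∨ ∀ W (g : W ⟶ V), S.arrows (g ≫ f) → (⊥ : Sieve W) ∈ J W

/-- The truth value of `z = a`, for a numeral `a`. -/
abbrev valSieve {A : Type} {U : C} (z : (cst J A).obj (op U)) (a : A) : Sieve U where
  arrows V f := res (cst J A) f z = num J a V
  downward_closed := by
    intro V W f hf g
    rw [← res_res, hf, res_num]

theorem decSieve_val {A : Type} {U : C} (z : (cst J A).obj (op U)) (a : A) :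
    DecSieve J (valSieve z a) := by
  refine ⟨isClosed_of_locally fun V f h => eq_num_of_locally (h.mono fun W g h => by
    rw [res_res]; exact h), (exists_num z).mono fun V f ⟨b, hb⟩ => ?_⟩
  by_cases e : b = a
  · exact .inl (e ▸ hb)
  · refine .inr fun W g h => num_inj (a := b) (b := a) ?_ e
    rw [← res_num b g, ← hb, res_res]
    exact h

theorem DecSieve.inf {U : C} {S T : Sieve U} (hS : DecSieve J S) (hT : DecSieve J T) :
    DecSieve J (S ⊓ T) := by
  refine ⟨isClosed_of_locally fun V f h => ⟨closed_of_locally hS.1 f (h.mono fun _ _ h => h.1),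
    closed_of_locally hT.1 f (h.mono fun _ _ h => h.2)⟩, (hS.2.and hT.2).mono ?_⟩
  rintro V f ⟨h₁ | h₁, h₂⟩
  · rcases h₂ with h₂ | h₂
    · exact .inl ⟨h₁, h₂⟩
    · exact .inr fun W g h => h₂ W g h.2
  · exact .inr fun W g h => h₁ W g h.1

/-- Decidable propositions are classified by `2`, with 0 coding truth as in the definitions of open
and closed propositions. -/
theorem DecSieve.exists_two {U : C} {S : Sieve U} (hS : DecSieve J S) :
    ∃ z : (two J).obj (op U), ∀ V (f : V ⟶ U), (res (two J) f z = num J false V ↔ S.arrows f) ∧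
      (res (two J) f z = num J true V ↔
        ∀ W (g : W ⟶ V), S.arrows (g ≫ f) → (⊥ : Sieve W) ∈ J W) := by
  have := cst_glue (J := J) (U := U) (A := Bool) (fun V f b => (b = false ∧ S.arrows f) ∨
      (b = true ∧ ∀ W (g : W ⟶ V), S.arrows (g ≫ f) → (⊥ : Sieve W) ∈ J W)) ?_ ?_ ?_
  · obtain ⟨z, hz⟩ := this
    refine ⟨z, fun V f => ⟨(hz V f false).trans ⟨fun h => ?_, fun h => ?_⟩,
      (hz V f true).trans ⟨fun h W g hg => ?_, fun h => ?_⟩⟩⟩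
    · exact closed_of_locally hS.1 f (h.mono fun W g h => by simpa using h)
    · exact .of_forall fun W g => .inl ⟨rfl, S.downward_closed h g⟩
    · refine Locally.bot ((h.pullback g).mono fun W' k h => ?_)
      have := (h.resolve_left (by simp)).2 W' (𝟙 W')
      simp only [Category.id_comp, Category.assoc] at this
      exact this (S.downward_closed hg k)
    · refine .of_forall fun W g => .inr ⟨rfl, fun W' k hk => h W' (k ≫ g) (by simpa using hk)⟩
  · rintro V W f g b (⟨rfl, h⟩ | ⟨rfl, h⟩)
    · exact .inl ⟨rfl, S.downward_closed h g⟩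
    · exact .inr ⟨rfl, fun W' k hk => h W' (k ≫ g) (by simpa using hk)⟩
  · rintro V f a b (⟨rfl, h⟩ | ⟨rfl, h⟩) (⟨rfl, h'⟩ | ⟨rfl, h'⟩) hab
    · exact (hab rfl).elim
    · simpa using h' V (𝟙 V) (by simpa using h)
    · simpa using h V (𝟙 V) (by simpa using h')
    · exact (hab rfl).elim
  · refine hS.2.mono fun V f h => ?_
    rcases h with h | h
    · exact ⟨false, .inl ⟨rfl, h⟩⟩
    · exact ⟨true, .inr ⟨rfl, h⟩⟩

theorem isClosedProp_of_dec {U : C} {P : Sieve U} {I : Type} [Countable I] [Nonempty I]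
    (h : Locally J U fun V f => ∃ S : I → Sieve V, (∀ i, DecSieve J (S i)) ∧
      ∀ W (g : W ⟶ V), P.arrows (g ≫ f) ↔
        ∀ i W' (k : W' ⟶ W), (S i).arrows (k ≫ g) → (⊥ : Sieve W') ∈ J W') :
    IsClosedProp J P := by
  refine h.mono fun V f ⟨S, hS, hP⟩ => ?_
  obtain ⟨e, he⟩ := exists_surjective_nat I
  have hneg : ∀ i, ∃ z : (two J).obj (op V), ∀ W (g : W ⟶ V), res (two J) g z = num J false W ↔
      ∀ W' (k : W' ⟶ W), (S i).arrows (k ≫ g) → (⊥ : Sieve W') ∈ J W' := by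
    intro i
    obtain ⟨z, hz⟩ := (hS i).exists_two
    -- Classifying a second time exchanges the two bits, so that 0 codes the negation of `S i`.
    obtain ⟨z', hz'⟩ := (decSieve_val z true).exists_two
    exact ⟨z', fun W g => (hz' W g).1.trans (hz W g).2⟩
  choose z hz using hneg
  refine ⟨fun n => z (e n), fun W g => (hP W g).trans ⟨fun h n => ?_, fun h i => ?_⟩⟩
  · exact (hz _ W g).2 (h _)
  · obtain ⟨n, rfl⟩ := he i
    exact (hz _ W g).1 (h n)

theorem isOpenProp_of_dec {U : C} {P : Sieve U} {I : Type} [Countable I] [Nonempty I]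
    (h : Locally J U fun V f => ∃ S : I → Sieve V, (∀ i, DecSieve J (S i)) ∧
      ∀ W (g : W ⟶ V), P.arrows (g ≫ f) ↔
        Locally J W fun _ k => ∃ i, (S i).arrows (k ≫ g)) :
    IsOpenProp J P := by
  refine h.mono fun V f ⟨S, hS, hP⟩ => ?_
  obtain ⟨e, he⟩ := exists_surjective_nat I
  choose z hz using fun i => (hS i).exists_two
  refine ⟨fun n => z (e n), fun W g => (hP W g).trans ⟨fun h => ?_, fun h => ?_⟩⟩
  · refine h.mono fun W' k ⟨i, hi⟩ => ?_
    obtain ⟨n, rfl⟩ := he i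
    exact ⟨n, ((hz _ _ _).1).2 hi⟩
  · exact h.mono fun W' k ⟨n, hn⟩ => ⟨e n, ((hz _ _ _).1).1 hn⟩

/-! ### Order and equality through decidable certificates -/

/-- Quadruples of rational numbers `p < q < q' < r`. -/
abbrev RatQuad : Type :=
  {t : (ℚ × ℚ) × (ℚ × ℚ) // t.1.1 < t.1.2 ∧ t.1.2 < t.2.1 ∧ t.2.1 < t.2.2}

instance : Nonempty RatQuad := ⟨⟨((0, 1), (2, 3)), by norm_num⟩⟩

/-- The certificate, in terms of decisions for `x` and `y`, that `x < q < q' < y`, for a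
quadruple `(p, q, q', r)`. -/
def ltSieve {U : C} (d d' : ℚ → ℚ → (two J).obj (op U)) (t : RatQuad) : Sieve U :=
  valSieve (d t.1.1.1 t.1.1.2) true ⊓ valSieve (d' t.1.2.1 t.1.2.2) false

theorem ltSieve_dec {U : C} (d d' : ℚ → ℚ → (two J).obj (op U)) (t : RatQuad) :
    DecSieve J (ltSieve d d' t) := (decSieve_val _ _).inf (decSieve_val _ _)

theorem ltSieve_spec {U : C} {x y : DReal J U} {d d' : ℚ → ℚ → (two J).obj (op U)}
    (hx : IsDecision x d) (hy : IsDecision y d') {t : RatQuad} {V : C} {f : V ⟶ U}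
    (h : (ltSieve d d' t).arrows f) : (x.upper t.1.1.2).arrows f ∧ (y.lower t.1.2.1).arrows f :=
  ⟨(hx _ _ t.2.1 V f).2 h.1, (hy _ _ t.2.2.2 V f).1 h.2⟩

theorem restrict_lt_iff {U : C} {x y : DReal J U} {d d' : ℚ → ℚ → (two J).obj (op U)}
    (hx : IsDecision x d) (hy : IsDecision y d') {V : C} (f : V ⟶ U) :
    (x.restrict f).lt (y.restrict f) ↔
      Locally J V fun _ g => ∃ t, (ltSieve d d' t).arrows (g ≫ f) := by
  rw [locally_lt_iff (hx.restrict f) (hy.restrict f)]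
  constructor
  · intro h
    refine h.mono fun W g ⟨p, q, q', r, h₁, h₂, h₃, h₄, h₅⟩ =>
      ⟨⟨((p, q), (q', r)), h₁, h₂, h₃⟩, ?_, ?_⟩
    · simpa using h₄
    · simpa using h₅
  · intro h
    refine h.mono fun W g ⟨⟨⟨⟨p, q⟩, q', r⟩, h₁, h₂, h₃⟩, h₄, h₅⟩ =>
      ⟨p, q, q', r, h₁, h₂, h₃, ?_, ?_⟩
    · simpa using h₄
    · simpa using h₅

theorem bot_of_not_ltSieve {U : C} {x y : DReal J U} {d d' : ℚ → ℚ → (two J).obj (op U)}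
    (hx : IsDecision x d) (hy : IsDecision y d') {V : C} (f : V ⟶ U)
    (h : ∀ t W (g : W ⟶ V), (ltSieve d d' t).arrows (g ≫ f) → (⊥ : Sieve W) ∈ J W)
    {q : ℚ} (hxq : (x.upper q).arrows f) (hyq : (y.lower q).arrows f) : (⊥ : Sieve V) ∈ J V := by
  have hlt : (x.restrict f).lt (y.restrict f) := .of_forall fun W g =>
    ⟨q, Sieve.downward_closed _ hxq g, Sieve.downward_closed _ hyq g⟩
  exact Locally.bot (((restrict_lt_iff hx hy f).1 hlt).mono fun W g ⟨t, ht⟩ => h t W g ht)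

theorem eq_of_not_ltSieve {U : C} {x y : DReal J U} {d d' : ℚ → ℚ → (two J).obj (op U)}
    (hx : IsDecision x d) (hy : IsDecision y d') {V : C} (f : V ⟶ U)
    (h : ∀ t W (g : W ⟶ V), (ltSieve d d' t).arrows (g ≫ f) → (⊥ : Sieve W) ∈ J W)
    (h' : ∀ t W (g : W ⟶ V), (ltSieve d' d t).arrows (g ≫ f) → (⊥ : Sieve W) ∈ J W) :
    x.restrict f = y.restrict f := by
  refine DReal.eq_of_not_lt (fun W g q h₁ h₂ => ?_) fun W g q h₁ h₂ => ?_
  · exact bot_of_not_ltSieve hy hx (g ≫ f)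
      (fun t W' k hk => h' t W' (k ≫ g) (by simpa using hk)) h₁ h₂
  · exact bot_of_not_ltSieve hx hy (g ≫ f)
      (fun t W' k hk => h t W' (k ≫ g) (by simpa using hk)) h₁ h₂

/-- Equality is the failure of all certificates for either strict inequality; they form a countable
decidable family once decisions are chosen for both points. -/
theorem unitInterval_isCHaus (dc : DependentChoice J) : IsCHaus J (UnitInterval J) := by
  refine ⟨fun U x y => ?_, fun U => .of_forall fun V _ =>
    ⟨intervalBoole (J.over V), intervalMap J V, intervalMap_surjective dc V⟩⟩
  refine isClosedProp_of_dec (I := RatQuad ⊕ RatQuad) ?_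
  refine ((exists_decision_one dc x.1).and (exists_decision_one dc y.1)).mono ?_
  rintro V f ⟨⟨d, hd⟩, d', hd'⟩
  refine ⟨Sum.elim (ltSieve d d') (ltSieve d' d), ?_, fun W g => ⟨?_, fun h => ?_⟩⟩
  · rintro (t | t)
    exacts [ltSieve_dec _ _ _, ltSieve_dec _ _ _]
  · intro h
    have e : x.1.restrict (g ≫ f) = y.1.restrict (g ≫ f) := congrArg Subtype.val h
    have aux : ∀ {a b : DReal J U}, a.restrict (g ≫ f) = b.restrict (g ≫ f) →
        ∀ q q' W' (k : W' ⟶ W), q ≤ q' → (a.upper q).arrows ((k ≫ g) ≫ f) →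
        (b.lower q').arrows ((k ≫ g) ≫ f) → (⊥ : Sieve W') ∈ J W' := by
      intro a b hab q q' W' k hq h₁ h₂
      refine (b.restrict (g ≫ f)).bot_of_le hq (f := k) ?_ ?_
      · simpa [DReal.restrict] using h₂
      · rw [← hab]
        simpa [DReal.restrict] using h₁
    rintro (t | t) W' k hk
    · have := ltSieve_spec hd hd' hk
      exact aux e _ _ W' k t.2.2.1.le this.1 this.2
    · have := ltSieve_spec hd' hd hk
      exact aux e.symm _ _ W' k t.2.2.1.le this.1 this.2
  · have := eq_of_not_ltSieve hd hd' g (fun t => h (.inl t)) fun t => h (.inr t)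
    refine Subtype.ext ?_
    have e : ∀ z : DReal J U, (z.restrict f).restrict g = z.restrict (g ≫ f) := fun z => by
      ext <;> simp [DReal.restrict]
    rw [e, e] at this
    exact this

/-! ### Compactness of the unit interval -/

theorem num_bot_of_ne {A : Type} {U V : C} {z : (cst J A).obj (op U)} {f : V ⟶ U} {a b : A}
    (h : res (cst J A) f z = num J a V) (h' : res (cst J A) f z = num J b V) (hab : a ≠ b) :
    (⊥ : Sieve V) ∈ J V := num_inj (h.symm.trans h') hab

/-- The decidable proposition that the join of the first `N` terms is the top element. -/
theorem exists_two_join_eq_top {U : C} (c : ℕ → (cst J BTerm).obj (op U)) (N : ℕ) :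
    ∃ z : (two J).obj (op U), ∀ V (f : V ⟶ U), res (two J) f z = num J false V ↔
      Locally J V fun W g => ∃ σ : ℕ → BTerm,
        (∀ k < N, res (cst J BTerm) (g ≫ f) (c k) = num J (σ k) W) ∧
        ∀ v : ℕ → Bool, ∃ k < N, (σ k).eval v = true := by
  have := cst_glue (J := J) (U := U) (A := Bool) (fun V f b => ∃ σ : ℕ → BTerm,
        (∀ k < N, res (cst J BTerm) f (c k) = num J (σ k) V) ∧
        (b = false ↔ ∀ v : ℕ → Bool, ∃ k < N, (σ k).eval v = true)) ?_ ?_ ?_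
  · obtain ⟨z, hz⟩ := this
    exact ⟨z, fun V f => by simpa using hz V f false⟩
  · rintro V W f g b ⟨σ, hσ, hb⟩
    exact ⟨σ, fun k hk => by rw [← res_res, hσ k hk, res_num], hb⟩
  · rintro V f a b ⟨σ, hσ, ha⟩ ⟨τ, hτ, hb⟩ hab
    by_contra hbot
    have e : ∀ k < N, σ k = τ k := fun k hk => by
      by_contra h
      exact hbot (num_bot_of_ne (hσ k hk) (hτ k hk) h)
    have : a = false ↔ b = false := by
      rw [ha, hb]
      refine forall_congr' fun v => exists_congr fun k => and_congr_right fun hk => ?_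
      rw [e k hk]
    revert hab this
    cases a <;> cases b <;> simp
  · refine (Locally.forall_lt N fun k _ => exists_num (c k)).mono fun V f h => ?_
    choose! σ hσ using h
    -- For numeral terms this is an external statement about valuations, so it may be decided
    -- classically.
    by_cases hv : ∀ v : ℕ → Bool, ∃ k < N, (σ k).eval v = true
    · exact ⟨false, σ, hσ, by simpa using hv⟩
    · exact ⟨true, σ, hσ, by simpa using hv⟩

theorem satisfies_toOver {U : C} {X : Over U} {α : ℕ → (two J).obj (op X.left)}
    {r : ℕ → (cst J BTerm).obj (op X.left)} :
    Satisfies (J := J.over U) (U := X) (fun n => toOver (α n)) (fun n => toOver (r n)) ↔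
      Satisfies α r := by
  constructor
  · intro h V f n s v hs hv hsv
    exact bot_over.1 (h (Over.mk (f ≫ X.hom)) (Over.homMk f) n s v
      ((res_toOver_eq_num _ _ _).2 hs) (fun i hi => (res_toOver_eq_num _ _ _).2 (hv i hi)) hsv)
  · intro h Y f n s v hs hv hsv
    exact bot_over.2 (h Y.left f.left n s v ((res_toOver_eq_num _ _ _).1 hs)
      (fun i hi => (res_toOver_eq_num _ _ _).1 (hv i hi)) hsv)

/-- A relation sequence on a stage, as relations over the slice. -/
def overRelations {U : C} (c : ℕ → (cst J BTerm).obj (op U)) : Relations (J.over U) where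
  rel X n := toOver (res (cst J BTerm) X.hom (c n))
  res_rel {X Y} f n := by
    rw [res_toOver, res_res, Over.w]

/-- A presented algebra without points is trivial. -/
theorem exists_join_eq_top (sd : StoneDuality J) {U : C} (c : ℕ → (cst J BTerm).obj (op U))
    (h : ∀ V (f : V ⟶ U) (α : ℕ → (two J).obj (op V)),
      Satisfies α (fun n => res (cst J BTerm) f (c n)) → (⊥ : Sieve V) ∈ J V) :
    Locally J U fun V f => ∃ (N : ℕ) (σ : ℕ → BTerm),
      (∀ k < N, res (cst J BTerm) f (c k) = num J (σ k) V) ∧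
      ∀ v : ℕ → Bool, ∃ k < N, (σ k).eval v = true := by
  let r := overRelations c
  have empty : ∀ X : Over U, SpPt (J.over U) r.boole.alg X → (⊥ : Sieve X.left) ∈ J X.left := by
    intro X s
    refine h X.left X.hom (fun n => ofOver (s.hom.app (𝟙 X) (r.term X (.gen n)))) ?_
    refine satisfies_toOver.1 ?_
    simp only [toOver_ofOver]
    exact s.satisfies (r.presents X)
  -- Without points any two elements have the same evaluation, and Stone duality makes evaluation
  -- injective. The presentation then puts the top element below finitely many relations.
  have e : (⊤ : r.alg.obj (op (Over.mk (𝟙 U)))) = ⊥ := by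
    refine (sd U r.boole (Over.mk (𝟙 U))).1 (Fn.ext ?_)
    funext X f s
    exact cst_eq_of_bot (bot_over.2 (empty X s)) _ _
  have := ((r.presents (Over.mk (𝟙 U))).2 _ (𝟙 _) .top).1 (by
    rw [← e]
    rfl)
  refine (locally_over.1 this).mono fun V f ⟨k, s, hs, hv⟩ =>
    ⟨k, s, fun i hi => ?_, fun v => hv v rfl⟩
  have := hs i hi
  change res _ _ (toOver (X := Over.mk (𝟙 U)) (res (cst J BTerm) (𝟙 U) (c i))) = _ at this
  rw [res_toOver_eq_num, res_id] at this
  simpa using this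

theorem alg_ext_of_locally {D : Boole J} {U : C} {x y : D.alg.obj (op U)}
    (h : Locally J U fun _ f => D.alg.map f.op x = D.alg.map f.op y) : x = y :=
  sheaf_ext ((isSheaf_iff_isSheaf_of_type _ _).1 D.isSheaf) h

/-- A decidable subset of the spectrum is given by an element of the algebra. -/
theorem StoneWitness.exists_elem (sd : StoneDuality J) {U : C} {I : Type}
    {P : ∀ V : C, (V ⟶ U) → (UnitInterval J).obj (op V) → (I → (two J).obj (op V)) → Prop}
    (w : StoneWitness I P) (X : Over U) (i : I) :
    ∃ b : w.alg.alg.obj (op X), ∀ (Y : Over U) (h : Y ⟶ X) (s : SpPt (J.over U) w.alg.alg Y),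
      s.hom.app (𝟙 Y) (w.alg.alg.map h.op b) = toOver (w.wit Y s i) := by
  obtain ⟨b, hb⟩ := (sd U w.alg X).2
    { app := fun {Y} _ s => toOver (w.wit Y s i)
      nat := fun {Y Z} _ g s => by
        refine Eq.trans ?_ (res_toOver _ g).symm
        exact congrArg toOver (w.res_wit g s i).symm }
  exact ⟨b, fun Y h s => congrFun (congrArg (fun F => F.app h) hb) s⟩

/-- Terms representing the complements of the witnesses on a Stone type covering the interval. -/
theorem StoneWitness.exists_terms (sd : StoneDuality J) (dc : DependentChoice J) {U : C} {I : Type}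
    [Countable I]
    {P : ∀ V : C, (V ⟶ U) → (UnitInterval J).obj (op V) → (I → (two J).obj (op V)) → Prop}
    (w : StoneWitness I P) : Locally J U fun V f => ∃ (g : ℕ → w.alg.alg.obj (op (Over.mk f)))
      (r : ℕ → (cst (J.over U) BTerm).obj (op (Over.mk f))) (t : I → (cst J BTerm).obj (op V)),
      Presents (J.over U) w.alg.alg g r ∧
      ∀ (i : I) (Y : Over U) (h : Y ⟶ Over.mk f) (s : SpPt (J.over U) w.alg.alg Y) (τ : BTerm)
        (v : ℕ → Bool), res (cst J BTerm) h.left (t i) = num J τ Y.left →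
        (∀ n < τ.bound, s.hom.app (𝟙 Y) (w.alg.alg.map h.op (g n)) = num (J.over U) (v n) Y) →
        w.wit Y s i = num J (!τ.eval v) Y.left := by
  refine (locally_over.1 (w.alg.countablyPresented (Over.mk (𝟙 U)))).bind ?_
  rintro V f ⟨g, r, hP⟩
  let X : Over U := Over.mk (f ≫ 𝟙 U)
  choose b hb using fun i => w.exists_elem sd X i
  -- The terms represent complements, so truth of a term means that the bit is 0. Quantifying over
  -- slice objects that factor through `k` states the condition over the base and makes it stable.
  have := countable_choice dc (A := BTerm) (I := I) (U := X.left) (fun i W k τ =>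
    ∀ (Y : Over U) (h : Y ⟶ X) (l : Y.left ⟶ W), l ≫ k = h.left →
      τ.eval (fun n => w.alg.alg.map h.op (g n)) = w.alg.alg.map h.op (b i)ᶜ) ?_ ?_
  · refine this.mono fun W k ⟨t, ht⟩ => ?_
    rw [show k ≫ f = k ≫ X.hom by simp [X]]
    refine ⟨fun n => w.alg.alg.map (Over.homMk k : Over.mk (k ≫ X.hom) ⟶ X).op (g n), _, t,
      hP.restrict (Over.homMk k : Over.mk (k ≫ X.hom) ⟶ X), fun i Y h s τ v hτ hv => ?_⟩
    have e : τ.eval (fun n => w.alg.alg.map h.op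
        (w.alg.alg.map (Over.homMk k : Over.mk (k ≫ X.hom) ⟶ X).op (g n))) =
        (w.alg.alg.map (h ≫ (Over.homMk k : Over.mk (k ≫ X.hom) ⟶ X)).op (b i))ᶜ := by
      refine alg_ext_of_locally (locally_over.2 ((ht i _ _ _ hτ).mono fun W' l hl => ?_))
      have := hl (Over.mk (l ≫ Y.hom)) ((Over.homMk l : Over.mk (l ≫ Y.hom) ⟶ Y) ≫ h ≫
        (Over.homMk k : Over.mk (k ≫ X.hom) ⟶ X)) (𝟙 _) (by simp)
      simp only [map_eval, map_map_alg]
      refine this.trans ?_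
      have aux : ∀ {Z Z' : Over U} (m : Z' ⟶ Z) (x : w.alg.alg.obj (op Z)),
          w.alg.alg.map m.op xᶜ = (w.alg.alg.map m.op x)ᶜ :=
        fun m _ => map_compl' (w.alg.alg.map m.op).hom _
      rw [aux, aux, map_map_alg]
    have h₁ := s.app_eval (𝟙 Y) τ _ v hv
    rw [e] at h₁
    have h₂ := s.app_compl (𝟙 Y) h₁
    rw [compl_compl, hb] at h₂
    exact (toOver_eq_num _ _).1 h₂
  · intro i W W' k l τ h Y m l' e
    exact h Y m (l' ≫ l) (by simpa using e)
  · intro i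
    refine (locally_over.1 (hP.1 X (𝟙 X) (b i)ᶜ)).mono fun W k ⟨t, ht⟩ => ⟨t, fun Y h l e => ?_⟩
    have := congrArg (w.alg.alg.map (Over.homMk l (by
      rw [← Over.w h, ← e, Category.assoc]; rfl) : Y ⟶ Over.mk (k ≫ X.hom)).op) ht
    rw [map_eval] at this
    simp only [map_map_alg, Category.comp_id] at this
    have hh : (Over.homMk l (by rw [← Over.w h, ← e, Category.assoc]; rfl) :
        Y ⟶ Over.mk (k ≫ X.hom)) ≫ Over.homMk k = h := by
      ext
      exact e
    rw [hh] at this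
    exact this

theorem SpPt.app_restrict {U V : C} {B : Cᵒᵖ ⥤ BoolAlg.{u}} (s : SpPt J B U) (f : V ⟶ U)
    (b : B.obj (op U)) : (s.restrict f).hom.app (𝟙 V) (B.map f.op b) =
      res (two J) f (s.hom.app (𝟙 U) b) := by
  rw [s.res_app]
  change s.hom.app (𝟙 V ≫ f) _ = _
  rw [Category.id_comp, Category.comp_id]

/-- Compactness of the unit interval, for families of properties with `2^ℕ`-valued witnesses. -/
theorem interval_compactness (sd : StoneDuality J) (lc : LocalChoice J) (dc : DependentChoice J)
    {U : C} {I : Type} [Countable I]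
    (T : I → ∀ V : C, (V ⟶ U) → (UnitInterval J).obj (op V) → Prop)
    (R : I → ℕ → ∀ V : C, (V ⟶ U) → (UnitInterval J).obj (op V) → Prop)
    (ex : ∀ V (f : V ⟶ U) x, Locally J V fun W g => ∃ β : I → ℕ → (two J).obj (op W), ∀ i,
      (∀ j W' (h : W' ⟶ W), res (two J) h (β i j) = num J false W' →
        R i j W' (h ≫ g ≫ f) (res (UnitInterval J) (h ≫ g) x)) ∧
      ∀ W' (h : W' ⟶ W), T i W' (h ≫ g ≫ f) (res (UnitInterval J) (h ≫ g) x) →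
        (∀ j, res (two J) h (β i j) = num J true W') → (⊥ : Sieve W') ∈ J W') :
    Locally J U fun V f => ∃ γ : I → ℕ → (two J).obj (op V), ∀ i,
      (∀ N W (g : W ⟶ V), res (two J) g (γ i N) = num J false W → ∀ W' (h : W' ⟶ W) x,
        Locally J W' fun W'' k => ∃ j < N,
          R i j W'' (k ≫ h ≫ g ≫ f) (res (UnitInterval J) k x)) ∧
      ∀ W (g : W ⟶ V), (∀ W' (h : W' ⟶ W) x, T i W' (h ≫ g ≫ f) x) →
        Locally J W fun W' h => ∃ N, res (two J) (h ≫ g) (γ i N) = num J false W' := by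
  refine (interval_local_choice lc dc (I := I × ℕ) (fun V f x β => ∀ i,
      (∀ j W' (h : W' ⟶ V), res (two J) h (β (i, j)) = num J false W' →
        R i j W' (h ≫ f) (res (UnitInterval J) h x)) ∧
      ∀ W' (h : W' ⟶ V), T i W' (h ≫ f) (res (UnitInterval J) h x) →
        (∀ j, res (two J) h (β (i, j)) = num J true W') → (⊥ : Sieve W') ∈ J W') ?_ ?_).bind ?_
  · intro V W f g x β h i
    refine ⟨fun j W' k hk => ?_, fun W' k hk hk' => ?_⟩
    · have := (h i).1 j W' (k ≫ g) (by simpa using hk)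
      simpa using this
    · refine (h i).2 W' (k ≫ g) (by simpa using hk) fun j => by simpa using hk' j
  · intro V f x
    refine (ex V f x).mono fun W g ⟨β, hβ⟩ => ⟨fun a => β a.1 a.2, fun i => ?_⟩
    simpa only [res_res] using hβ i
  rintro V f ⟨w⟩
  refine (w.exists_terms sd dc).mono ?_
  rintro V₁ f₁ ⟨g, r, t, hP, ht⟩
  -- Relations of the covering Stone type at even places, terms for "bit `(i, j)` is 0" at odd
  -- places. A common zero is a point of the cover at which all bits for `i` are 1.
  let c : I → ℕ → (cst J BTerm).obj (op V₁) := fun i n =>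
    if n % 2 = 0 then ofOver (X := Over.mk f₁) (r (n / 2)) else t (i, n / 2)
  have c_even : ∀ i n, c i (2 * n) = ofOver (X := Over.mk f₁) (r n) := fun i n => by
    simp only [c]
    rw [if_pos (by omega), show 2 * n / 2 = n by omega]
  have c_odd : ∀ i n, c i (2 * n + 1) = t (i, n) := fun i n => by
    simp only [c]
    rw [if_neg (by omega), show (2 * n + 1) / 2 = n by omega]
  -- A relation is never true at a point of a consistent stage, so a true entry at an even place
  -- makes the claim vacuous.
  have wit_eq_false : ∀ i k (Y : Over V) (h : Y ⟶ Over.mk f₁) (s : SpPt (J.over V) w.alg.alg Y)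
      (σ : BTerm) (v : ℕ → Bool), res (cst J BTerm) h.left (c i k) = num J σ Y.left →
      (∀ n < σ.bound, s.hom.app (𝟙 Y) (w.alg.alg.map h.op (g n)) = num (J.over V) (v n) Y) →
      σ.eval v = true → w.wit Y s (i, k / 2) = num J false Y.left := by
    intro i k Y h s σ v hσ hv hσv
    rcases Nat.even_or_odd' k with ⟨n, rfl | rfl⟩
    · rw [c_even, res_ofOver_eq_num] at hσ
      refine cst_eq_of_bot (bot_over.1 ?_) _ _
      refine s.satisfies (hP.restrict h) Y (𝟙 Y) n σ v ?_ (fun i hi => ?_) hσv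
      · rw [res_id, hσ]
      · rw [res_id]
        exact hv i hi
    · rw [c_odd] at hσ
      rw [show (2 * n + 1) / 2 = n by omega, ht (i, n) Y h s σ v hσ hv, hσv]
      rfl
  -- The bit is 0 when the first `N` entries join to the top of the free algebra.
  choose γ hγ using fun i N => exists_two_join_eq_top (c i) N
  refine ⟨γ, fun i => ⟨fun N W gg hN W' h x => ?_, fun W gg hT => ?_⟩⟩
  -- Lift `x` to the cover and evaluate the `N` terms there: some entry `k₀ < N` is true, so the bit
  -- with index `k₀ / 2 < N` is 0.
  · refine (((hγ i N W gg).1 hN).pullback h).bind fun W₁ k ⟨σ, hσ, hσ'⟩ => ?_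
    refine (w.surj (Over.mk (k ≫ h ≫ gg ≫ f₁)) (res (UnitInterval J) k x)).bind ?_
    rintro W₂ l ⟨s, hs⟩
    let Y : Over V := Over.mk (l ≫ k ≫ h ≫ gg ≫ f₁)
    let hY : Y ⟶ Over.mk f₁ := Over.homMk (l ≫ k ≫ h ≫ gg)
    refine ((locally_over.1 (locally_valuation
      (fun n => s.hom.app (𝟙 Y) (w.alg.alg.map hY.op (g n)))
      (∑ k ∈ Finset.range N, (σ k).bound))).and (w.spec Y s)).mono ?_
    rintro W₃ m ⟨⟨v, hv⟩, hspec⟩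
    obtain ⟨k₀, hk₀, hk₀'⟩ := hσ' v
    refine ⟨k₀ / 2, lt_of_le_of_lt (Nat.div_le_self _ _) hk₀, ?_⟩
    have h₁ := wit_eq_false i k₀ (Over.mk (m ≫ Y.hom)) (Over.homMk m ≫ hY)
      (s.restrict (Over.homMk m)) (σ k₀) v ?_ ?_ hk₀'
    · have h₂ := (hspec i).1 (k₀ / 2) W₃ (𝟙 W₃) ?_
      · have hs' : w.pt Y s = _ := hs
        rw [hs'] at h₂
        simpa [Y] using h₂
      · rw [res_id]
        exact (w.res_wit (Over.homMk m : Over.mk (m ≫ Y.hom) ⟶ Y) s _).trans h₁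
    · have := congrArg (res _ (m ≫ l)) (hσ k₀ hk₀)
      simpa [hY] using this
    · intro n hn
      have := (SpPt.app_restrict (U := Y) s (Over.homMk m : Over.mk (m ≫ Y.hom) ⟶ Y)
        (w.alg.alg.map hY.op (g n))).trans (hv n (lt_of_lt_of_le hn (Finset.single_le_sum
          (f := fun i => (σ i).bound) (fun _ _ => Nat.zero_le _) (Finset.mem_range.2 hk₀))))
      rw [map_map_alg] at this
      exact this
  -- A common zero of the entries would be a point whose bits are all 1, which `T i` forbids at its
  -- image in the interval.
  · refine (exists_join_eq_top sd (fun n => res (cst J BTerm) gg (c i n)) ?_).mono ?_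
    · intro V₂ f₂ α hα
      let Y : Over V := Over.mk ((f₂ ≫ gg) ≫ f₁)
      let h : Y ⟶ Over.mk f₁ := Over.homMk (f₂ ≫ gg)
      have sat : Satisfies (J := J.over V) (U := Y) (fun n => toOver (X := Y) (α n))
          fun n => res (cst (J.over V) BTerm) h (r n) := by
        have := (satisfies_toOver (X := Y) (α := α)
          (r := fun n => ofOver (res (cst (J.over V) BTerm) h (r n)))).2 ?_
        · simpa only [toOver_ofOver] using this
        · intro V₃ k n σ v hσ hv hσv
          refine hα V₃ k (2 * n) σ v ?_ hv hσv
          change res _ k (res _ f₂ (res _ gg (c i (2 * n)))) = _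
          rw [c_even, res_res]
          have e : res (cst J BTerm) (f₂ ≫ gg) (ofOver (X := Over.mk f₁) (r n)) =
            ofOver (res (cst (J.over V) BTerm) h (r n)) := res_ofOver (r n) h
          rw [← res_res, res_res _ gg f₂, e]
          exact hσ
      obtain ⟨s, hs⟩ := exists_spPt (hP.restrict h) sat
      have wit_true : ∀ j, w.wit Y s (i, j) = num J true V₂ := by
        intro j
        refine eq_num_of_locally ((exists_num (res _ (f₂ ≫ gg) (t (i, j)))).bind ?_)
        rintro V₃ k ⟨τ, hτ⟩
        refine (locally_valuation (fun n => res _ k (α n)) τ.bound).mono fun V₄ l ⟨v, hv⟩ => ?_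
        rw [res_res] at hτ
        have hτ' := congrArg (res _ l) hτ
        rw [res_res, res_num] at hτ'
        by_cases e : τ.eval v = true
        · refine cst_eq_of_bot (hα V₄ (l ≫ k) (2 * j + 1) τ v ?_ (fun n hn => ?_) e) _ _
          · change res _ (l ≫ k) (res _ f₂ (res _ gg (c i (2 * j + 1)))) = _
            rw [c_odd]
            simpa using hτ'
          · simpa using hv n hn
        · let m : Over.mk ((l ≫ k) ≫ Y.hom) ⟶ Y := Over.homMk (l ≫ k)
          have := ht (i, j) _ (m ≫ h) (s.restrict m) τ v (by simpa [m, h] using hτ') ?_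
          · have e' : τ.eval v = false := by simpa using e
            rw [e'] at this
            exact (w.res_wit m s (i, j)).trans this
          · intro n hn
            rw [← map_map_alg, s.app_restrict, hs, res_toOver_eq_num]
            simpa [m] using hv n hn
      refine Locally.bot ((w.spec Y s).mono fun V₃ k hk => ?_)
      refine (hk i).2 V₃ (𝟙 V₃) ?_ fun j => ?_
      · have := hT V₃ (k ≫ f₂) (res _ (𝟙 V₃) (res _ k (w.pt Y s)))
        simpa [Y] using this
      · change res _ _ (res _ k (w.wit Y s (i, j))) = _
        rw [wit_true j]
        exact (congrArg _ (res_num true k)).trans (res_num true _)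
    · rintro W' h ⟨N, σ, hσ, hσ'⟩
      refine ⟨N, (hγ i N W' (h ≫ gg)).2 (.of_forall fun W'' k => ⟨σ, fun n hn => ?_, hσ'⟩)⟩
      have := congrArg (res _ k) (hσ n hn)
      simpa using this

/-! ### Neighbourhoods -/

theorem Fn.app_res_eq_top {X : Cᵒᵖ ⥤ Type u} {U V W : C} (A : Fn X (Omega J) U) (f : V ⟶ U)
    (g : W ⟶ V) (x : X.obj (op V)) :
    (A.app (g ≫ f) (res X g x)).1 = (⊤ : Sieve W) ↔ (A.app f x).1.arrows g := by
  have h : (A.app (g ≫ f) (res X g x)).1 = (A.app f x).1.pullback g :=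
    congrArg Subtype.val (A.nat f g x)
  exact (iff_of_eq (congrArg (fun S : Sieve W => S = ⊤) h)).trans
    (Sieve.mem_iff_pullback_eq_top g).symm

theorem Fn.app_res_eq_top_of_eq_top {X : Cᵒᵖ ⥤ Type u} {U V W : C} {A : Fn X (Omega J) U}
    {f : V ⟶ U} {x : X.obj (op V)} (h : (A.app f x).1 = (⊤ : Sieve V)) (g : W ⟶ V) :
    (A.app (g ≫ f) (res X g x)).1 = (⊤ : Sieve W) := by
  rw [A.app_res_eq_top, h]
  trivial

theorem Fn.app_eq_top_of_locally {X : Cᵒᵖ ⥤ Type u} {U V : C} {A : Fn X (Omega J) U}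
    {f : V ⟶ U} {x : X.obj (op V)}
    (h : Locally J V fun W g => (A.app (g ≫ f) (res X g x)).1 = (⊤ : Sieve W)) :
    (A.app f x).1 = (⊤ : Sieve V) := by
  refine Sieve.id_mem_iff_eq_top.1 (closed_of_locally (A.app f x).2 (𝟙 V) (h.mono fun W g hg => ?_))
  rw [Category.comp_id]
  exact (A.app_res_eq_top f g x).1 hg

theorem DReal.restrict_restrict {U V W : C} (x : DReal J U) (f : V ⟶ U) (g : W ⟶ V) :
    (x.restrict f).restrict g = x.restrict (g ≫ f) := by
  ext <;> simp [DReal.restrict]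

theorem toReal_res {U V : C} (f : V ⟶ U) (x : (UnitInterval J).obj (op U)) :
    toReal (res (UnitInterval J) f x) = (toReal x).restrict f := rfl

theorem DReal.near.symm {U : C} {ε : ℚ} {x y : DReal J U} (h : DReal.near ε x y) :
    DReal.near ε y x := ⟨h.2, h.1⟩

theorem DReal.near.mono {U : C} {ε ε' : ℚ} {x y : DReal J U} (h : DReal.near ε x y)
    (hε : ε ≤ ε') : DReal.near ε' x y := by
  rcases hε.lt_or_eq with hε | rfl
  · exact ⟨h.1.mono fun V f ⟨q, h₁, h₂⟩ => ⟨q, h₁, y.lower_of_lt (by linarith) h₂⟩,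
      h.2.mono fun V f ⟨q, h₁, h₂⟩ => ⟨q, h₁, x.lower_of_lt (by linarith) h₂⟩⟩
  · exact h

theorem DReal.near.restrict {U V : C} {ε : ℚ} {x y : DReal J U} (h : DReal.near ε x y)
    (f : V ⟶ U) : DReal.near ε (x.restrict f) (y.restrict f) :=
  ⟨h.1.pullback f, h.2.pullback f⟩

/-- Two reals separated by a rational gap of length at least `ε` are not within `ε` of each other.
-/
theorem DReal.near.bot {U : C} {ε : ℚ} {x y : DReal J U} (h : DReal.near ε x y) {q r : ℚ}
    (hqr : q + ε ≤ r) (hx : (x.upper q).arrows (𝟙 U)) (hy : (y.lower r).arrows (𝟙 U)) :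
    (⊥ : Sieve U) ∈ J U := by
  refine Locally.bot (h.2.mono fun V f ⟨a, h₁, h₂⟩ => ?_)
  rcases le_total a r with ha | ha
  · refine y.bot_of_le ha (f := f) ?_ h₁
    simpa using (y.lower r).downward_closed hy f
  · refine x.bot_of_le (r := q) (by linarith) h₂ ?_
    simpa using (x.upper q).downward_closed hx f

/-- Locating `x` between `a + δ / 3` and `a + 2 * (δ / 3)` either raises the lower bound by `δ / 3`
or finishes with length `2 * (δ / 3)`. The archimedean property bounds the number of rounds. -/
theorem DReal.exists_mem_Ioo {U : C} (x : DReal J U) {δ : ℚ} (hδ : 0 < δ) :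
    Locally J U fun _ f => ∃ a b, (x.lower a).arrows f ∧ (x.upper b).arrows f ∧ b - a < δ := by
  have step : ∀ n : ℕ, ∀ V (f : V ⟶ U) a b, (x.lower a).arrows f → (x.upper b).arrows f →
      b - a ≤ n * (δ / 3) → Locally J V fun _ g =>
        ∃ a b, (x.lower a).arrows (g ≫ f) ∧ (x.upper b).arrows (g ≫ f) ∧ b - a < δ := by
    intro n
    induction n with
    | zero =>
      intro V f a b ha hb hab
      refine .of_forall fun W g => ⟨a, b, Sieve.downward_closed _ ha g,
        Sieve.downward_closed _ hb g, ?_⟩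
      simp at hab
      linarith
    | succ n ih =>
      intro V f a b ha hb hab
      push_cast at hab
      refine ((x.located (a + δ / 3) (a + 2 * (δ / 3)) (by linarith)).pullback f).bind ?_
      rintro W g (h | h)
      · refine (ih W (g ≫ f) _ b h (Sieve.downward_closed _ hb g) (by linarith)).mono ?_
        simp
      · refine .of_forall fun W' k => ⟨a, a + 2 * (δ / 3), ?_, ?_, by linarith⟩
        · exact Sieve.downward_closed _ ha _
        · simpa using Sieve.downward_closed _ h k
  refine (x.lower_inhabited.and x.upper_inhabited).bind fun V f ⟨⟨a, ha⟩, b, hb⟩ => ?_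
  obtain ⟨n, hn⟩ := exists_nat_gt ((b - a) / (δ / 3))
  exact step n V f a b ha hb ((div_lt_iff₀ (by linarith)).1 hn).le

/-- An open subtype of the interval contains a neighbourhood of each of its points. -/
theorem IsOpenSub.exists_near (sd : StoneDuality J) (lc : LocalChoice J) (dc : DependentChoice J)
    {U : C} {A : Fn (UnitInterval J) (Omega J) U} (hA : IsOpenSub J A) {V : C} (f : V ⟶ U)
    (x : (UnitInterval J).obj (op V)) (hx : (A.app f x).1 = (⊤ : Sieve V)) :
    Locally J V fun W g => ∃ δ : ℚ, 0 < δ ∧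
      ∀ W' (h : W' ⟶ W) (y : (UnitInterval J).obj (op W')),
        DReal.near δ ((toReal x).restrict (h ≫ g)) (toReal y) →
        (A.app (h ≫ g ≫ f) y).1 = (⊤ : Sieve W') := by
  -- The tests at `y`: a bit of the open proposition `A y`, a certificate for `x < y`, or one for `y
  -- < x`.
  let K := ℕ ⊕ RatQuad ⊕ RatQuad
  obtain ⟨e, he⟩ := exists_surjective_nat K
  -- A certificate `q < q'` excludes points closer than its gap. Bits of `A y` impose no
  -- restriction, hence the default 1.
  let δ : K → ℚ := Sum.elim (fun _ => 1) (Sum.elim (fun t => t.1.2.1 - t.1.1.2)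
    fun t => t.1.2.1 - t.1.1.2)
  have δ_pos : ∀ k, 0 < δ k := by
    rintro (n | t | t)
    · exact one_pos
    · exact sub_pos.2 t.2.2.1
    · exact sub_pos.2 t.2.2.1
  refine (interval_compactness sd lc dc (I := Unit) (U := V) (fun _ _ _ _ => True)
    (fun _ j W g y => DReal.near (δ (e j)) ((toReal x).restrict g) (toReal y) →
      (A.app (g ≫ f) y).1 = (⊤ : Sieve W)) ?_).bind ?_
  · intro W g y
    refine (hA W (g ≫ f) y).bind fun W₁ g₁ ⟨α, hα⟩ => ?_
    refine ((exists_decision_one dc ((toReal x).restrict (g₁ ≫ g))).and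
      (exists_decision_one dc ((toReal y).restrict g₁))).mono ?_
    rintro W₂ g₂ ⟨⟨d, hd⟩, d', hd'⟩
    rw [DReal.restrict_restrict] at hd hd'
    choose z hz using fun t => (ltSieve_dec (J := J) d d' t).exists_two
    choose z' hz' using fun t => (ltSieve_dec (J := J) d' d t).exists_two
    let ζ : K → (two J).obj (op W₂) := Sum.elim (fun n => res (two J) g₂ (α n)) (Sum.elim z z')
    refine ⟨fun _ j => ζ (e j), fun _ => ⟨fun j W' h hj hnear => ?_, fun W' h _ hj => ?_⟩⟩
    · have e₁ : ((toReal x).restrict (h ≫ (g₂ ≫ g₁) ≫ g)) =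
          ((toReal x).restrict (g₂ ≫ g₁ ≫ g)).restrict h := by
        rw [DReal.restrict_restrict]; simp
      have e₂ : toReal (res (UnitInterval J) (h ≫ g₂ ≫ g₁) y) =
          ((toReal y).restrict (g₂ ≫ g₁)).restrict h := by
        rw [DReal.restrict_restrict]; rfl
      rw [e₁, e₂] at hnear
      change res (two J) h (ζ (e j)) = _ at hj
      revert hnear hj
      generalize e j = κ
      rcases κ with n | t | t
      · intro _ hj
        have := (hα W' (h ≫ g₂)).2 (.of_forall fun W'' k => ⟨n, ?_⟩)
        · have := (A.app_res_eq_top (g ≫ f) _ y).2 this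
          simpa using this
        · have := congrArg (res _ k) hj
          simpa [ζ] using this
      · intro hnear hj
        obtain ⟨h₁, h₂⟩ := ltSieve_spec hd hd' ((hz t W' h).1.1 hj)
        have : (⊥ : Sieve W') ∈ J W' := hnear.bot (q := t.1.1.2) (r := t.1.2.1)
          (by simp [δ]) (by simpa [DReal.restrict] using h₁) (by simpa [DReal.restrict] using h₂)
        exact Fn.app_eq_top_of_locally (.of_bot this)
      · intro hnear hj
        obtain ⟨h₁, h₂⟩ := ltSieve_spec hd' hd ((hz' t W' h).1.1 hj)
        have : (⊥ : Sieve W') ∈ J W' := hnear.symm.bot (q := t.1.1.2) (r := t.1.2.1)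
          (by simp [δ]) (by simpa [DReal.restrict] using h₁) (by simpa [DReal.restrict] using h₂)
        exact Fn.app_eq_top_of_locally (.of_bot this)
    · replace hj : ∀ κ, res (two J) h (ζ κ) = num J true W' := fun κ => by
        obtain ⟨j, rfl⟩ := he κ
        exact hj j
      -- If all tests fail, neither inequality is certified, so `x = y`; then `A y` holds and some
      -- bit of `α` is 0.
      have h₁ : ∀ t W'' (k : W'' ⟶ W'), (ltSieve d d' t).arrows (k ≫ h) →
          (⊥ : Sieve W'') ∈ J W'' := fun t =>
        (hz t W' h).2.1 (hj (.inr (.inl t)))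
      have h₂ : ∀ t W'' (k : W'' ⟶ W'), (ltSieve d' d t).arrows (k ≫ h) →
          (⊥ : Sieve W'') ∈ J W'' := fun t =>
        (hz' t W' h).2.1 (hj (.inr (.inr t)))
      have exy := eq_of_not_ltSieve hd hd' h h₁ h₂
      rw [DReal.restrict_restrict, DReal.restrict_restrict] at exy
      have exy' : res (UnitInterval J) (h ≫ g₂ ≫ g₁ ≫ g) x =
        res (UnitInterval J) (h ≫ g₂ ≫ g₁) y := Subtype.ext exy
      have hy : (A.app (g ≫ f) y).1.arrows ((h ≫ g₂) ≫ g₁) := by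
        refine (A.app_res_eq_top _ _ y).1 ?_
        have := Fn.app_res_eq_top_of_eq_top hx (h ≫ g₂ ≫ g₁ ≫ g)
        rw [exy'] at this
        simpa using this
      refine Locally.bot (((hα W' (h ≫ g₂)).1 hy).mono fun W'' k ⟨n, hn⟩ => ?_)
      have := congrArg (res _ k) (hj (.inl n))
      simp only [ζ, Sum.elim_inl, res_res, res_num] at this
      exact num_bot_of_ne (by simpa using hn) this (by simp)
  · rintro W g ⟨γ, hγ⟩
    refine ((hγ ()).2 W (𝟙 W) fun _ _ _ => trivial).mono fun W₁ g₁ ⟨N, hN⟩ => ?_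
    -- Compactness leaves finitely many gaps, so their minimum is a positive radius.
    obtain ⟨m, hm, hm'⟩ : ∃ m : ℚ, 0 < m ∧ ∀ j < N, m ≤ δ (e j) := by
      clear hN
      induction N with
      | zero => exact ⟨1, one_pos, by simp⟩
      | succ N ih =>
        obtain ⟨m, hm, h⟩ := ih
        refine ⟨min m (δ (e N)), lt_min hm (δ_pos _), fun j hj => ?_⟩
        rcases Nat.lt_succ_iff_lt_or_eq.1 hj with hj | rfl
        · exact (min_le_left _ _).trans (h j hj)
        · exact min_le_right _ _
    refine ⟨m, hm, fun W' h y hy => Fn.app_eq_top_of_locally ?_⟩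
    refine ((hγ ()).1 N W₁ g₁ (by simpa using hN) W' h y).mono fun W'' k ⟨j, hj, hR⟩ => ?_
    have := hR ?_
    · simpa using this
    · have := (hy.mono (hm' j hj)).restrict k
      rw [DReal.restrict_restrict] at this
      exact this

/-! ### Rational intervals and continuity -/

/-- The truth value of `a < x < b`, for rational numbers `a` and `b`. -/
def DReal.ioo {U : C} (x : DReal J U) (a b : ℚ) : (Omega J).obj (op U) :=
  ⟨(x.lower a ⊓ x.upper b : Sieve U), isClosed_of_locally fun _ f h =>
    ⟨closed_of_locally (x.lower_closed a) f (h.mono fun _ _ h => h.1),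
      closed_of_locally (x.upper_closed b) f (h.mono fun _ _ h => h.2)⟩⟩

/-- If `a < s < x`, the bit at `(a, s)` must be 0, and dually for `b`; membership is thus a
countable disjunction of tests on bits. -/
theorem isOpenProp_ioo (dc : DependentChoice J) {U : C} (x : DReal J U) (a b : ℚ) :
    IsOpenProp J (x.lower a ⊓ x.upper b) := by
  have : Nonempty {s : ℚ // a < s} := ⟨⟨a + 1, by linarith⟩⟩
  have : Nonempty {p : ℚ // p < b} := ⟨⟨b - 1, by linarith⟩⟩
  refine isOpenProp_of_dec (I := {s : ℚ // a < s} × {p : ℚ // p < b}) ?_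
  refine (exists_decision_one dc x).mono fun V f ⟨d, hd⟩ => ?_
  refine ⟨fun i => valSieve (d a i.1) false ⊓ valSieve (d i.2 b) true,
    fun i => (decSieve_val _ _).inf (decSieve_val _ _), fun W g => ⟨fun h => ?_, fun h => ?_⟩⟩
  · refine (((x.lower_rounded a W _).1 h.1).and ((x.upper_rounded b W _).1 h.2)).bind ?_
    rintro W₁ k ⟨⟨s, hs, hs'⟩, p, hp, hp'⟩
    refine ((exists_num (res _ (k ≫ g) (d a s))).and (exists_num (res _ (k ≫ g) (d p b)))).mono ?_
    rintro W₂ l ⟨⟨u, hu⟩, v, hv⟩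
    simp only [res_res] at hu hv
    refine ⟨(⟨s, hs⟩, ⟨p, hp⟩), ?_, ?_⟩
    · change res _ ((l ≫ k) ≫ g) (d a s) = _
      cases u
      · simpa using hu
      · refine cst_eq_of_bot (x.bot_of_le le_rfl (Sieve.downward_closed _ hs' l) ?_) _ _
        simpa [DReal.restrict] using (hd a s hs _ _).2 hu
    · change res _ ((l ≫ k) ≫ g) (d p b) = _
      cases v
      · refine cst_eq_of_bot (x.bot_of_le le_rfl ?_ (Sieve.downward_closed _ hp' l)) _ _
        simpa [DReal.restrict] using (hd p b hp _ _).1 hv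
      · simpa using hv
  · refine closed_of_locally (x.ioo a b).2 (g ≫ f) (h.mono fun W₁ k ⟨i, h₁, h₂⟩ => ?_)
    have h₃ := (hd a i.1 i.1.2 _ _).1 h₁
    have h₄ := (hd i.2 b i.2.2 _ _).2 h₂
    exact ⟨by simpa [DReal.restrict] using h₃, by simpa [DReal.restrict] using h₄⟩

/-- Enclose `F x` in a rational interval of length less than `ε`. Its preimage is open, so it
contains a neighbourhood of `x`, and two reals in that interval are within `ε`. -/
theorem isEpsDeltaContinuous (sd : StoneDuality J) (lc : LocalChoice J) (dc : DependentChoice J)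
    {U : C} (F : Fn (UnitInterval J) (UnitInterval J) U) : IsEpsDeltaContinuous F := by
  intro V f x ε hε
  refine ((toReal (F.app f x)).exists_mem_Ioo hε).bind fun W g ⟨a, b, ha, hb, hab⟩ => ?_
  let A : Fn (UnitInterval J) (Omega J) W :=
    { app := fun {_} h y => (toReal (F.app (h ≫ g ≫ f) y)).ioo a b
      nat := fun {_ _} h k y => by
        rw [Category.assoc, F.nat]
        rfl }
  have eF : F.app (g ≫ f) (res (UnitInterval J) g x) = res (UnitInterval J) g (F.app f x) :=
    F.nat f g x
  have hA : (A.app (𝟙 W) (res (UnitInterval J) g x)).1 = (⊤ : Sieve W) := by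
    refine Sieve.id_mem_iff_eq_top.1 ?_
    change ((toReal (F.app (𝟙 W ≫ g ≫ f) (res (UnitInterval J) g x))).lower a).arrows (𝟙 W) ∧
      ((toReal (F.app (𝟙 W ≫ g ≫ f) (res (UnitInterval J) g x))).upper b).arrows (𝟙 W)
    rw [Category.id_comp, eF, toReal_res]
    exact ⟨by simpa [DReal.restrict] using ha, by simpa [DReal.restrict] using hb⟩
  refine (IsOpenSub.exists_near sd lc dc (A := A) (fun _ _ y => isOpenProp_ioo dc _ a b) (𝟙 W)
    (res (UnitInterval J) g x) hA).mono fun W₁ g₁ ⟨δ, hδ, h⟩ => ⟨δ, hδ, fun W' k y hy => ?_⟩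
  have hy' := h W' k y (by rw [toReal_res, DReal.restrict_restrict]; simpa using hy)
  replace hy' : (A.app (k ≫ g₁) y).1.arrows (𝟙 W') := by
    rw [show A.app (k ≫ g₁) y = A.app (k ≫ g₁ ≫ 𝟙 W) y by rw [Category.comp_id], hy']
    trivial
  obtain ⟨h₁, h₂⟩ : ((toReal (F.app ((k ≫ g₁) ≫ g ≫ f) y)).lower a).arrows (𝟙 W') ∧
    ((toReal (F.app ((k ≫ g₁) ≫ g ≫ f) y)).upper b).arrows (𝟙 W') := hy'
  rw [show (k ≫ g₁) ≫ g ≫ f = k ≫ (g₁ ≫ g) ≫ f by simp] at h₁ h₂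
  have key : ∀ W₂ (l : W₂ ⟶ W'),
      (((toReal (F.app f x)).restrict (k ≫ g₁ ≫ g)).lower a).arrows l ∧
      (((toReal (F.app f x)).restrict (k ≫ g₁ ≫ g)).upper b).arrows l := fun W₂ l =>
    ⟨by simpa [DReal.restrict] using Sieve.downward_closed _ ha (l ≫ k ≫ g₁),
      by simpa [DReal.restrict] using Sieve.downward_closed _ hb (l ≫ k ≫ g₁)⟩
  refine ⟨.of_forall fun W₂ l => ⟨b, (key W₂ l).2, DReal.lower_of_lt _ (r := a) (by linarith) ?_⟩,
    .of_forall fun W₂ l => ⟨b, ?_, DReal.lower_of_lt _ (r := a) (by linarith) (key W₂ l).1⟩⟩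
  · simpa using Sieve.downward_closed _ h₁ l
  · simpa using Sieve.downward_closed _ h₂ l

/-! ### Open subtypes and open intervals -/

/-- Decisions for all endpoints, chosen at once, turn the union into a countable disjunction of
pairs of decidable certificates. -/
theorem IsCountableUnionOfOpenIntervals.isOpenSub (dc : DependentChoice J) {U : C}
    {A : Fn (UnitInterval J) (Omega J) U} (hA : IsCountableUnionOfOpenIntervals A) :
    IsOpenSub J A := by
  intro V f x
  refine isOpenProp_of_dec (I := ℕ × RatQuad × RatQuad) ?_
  refine (hA.pullback f).bind fun W g ⟨a, b, hab⟩ => ?_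
  refine (((exists_decision dc a).and (exists_decision dc b)).and
    (exists_decision_one dc ((toReal x).restrict g))).mono ?_
  rintro W₁ k ⟨⟨⟨da, hda⟩, db, hdb⟩, d, hd⟩
  refine ⟨fun i => ltSieve (da i.1) d i.2.1 ⊓ ltSieve d (db i.1) i.2.2,
    fun i => (ltSieve_dec _ _ _).inf (ltSieve_dec _ _ _), fun W₂ l => ?_⟩
  have e : (A.app f x).1.arrows (l ≫ k ≫ g) ↔ _ :=
    (A.app_res_eq_top f (l ≫ k ≫ g) x).symm.trans
      ((by simp :
        (A.app ((l ≫ k ≫ g) ≫ f) (res (UnitInterval J) (l ≫ k ≫ g) x)).1 = (⊤ : Sieve W₂) ↔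
        (A.app ((l ≫ k) ≫ g ≫ f) (res (UnitInterval J) (l ≫ k ≫ g) x)).1 = (⊤ : Sieve W₂)).trans
        (hab W₂ _ _))
  rw [e]
  have ex : ∀ {W₃ : C} (h : W₃ ⟶ W₂),
      (toReal (res (UnitInterval J) (l ≫ k ≫ g) x)).restrict h =
        (((toReal x).restrict g).restrict k).restrict (h ≫ l) := fun h => by
    rw [toReal_res]
    simp only [DReal.restrict_restrict, Category.assoc]
  have ey : ∀ {W₃ : C} (h : W₃ ⟶ W₂) (y : DReal J W),
      y.restrict (h ≫ l ≫ k) = (y.restrict k).restrict (h ≫ l) := fun h y => by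
    simp only [DReal.restrict_restrict, Category.assoc]
  constructor
  · intro h
    refine h.bind fun W₃ h ⟨n, h₁, h₂⟩ => ?_
    rw [ex, ey] at h₁ h₂
    refine (((restrict_lt_iff (hda n) hd _).1 h₁).and ((restrict_lt_iff hd (hdb n) _).1 h₂)).mono ?_
    rintro W₄ m ⟨⟨t, ht⟩, t', ht'⟩
    exact ⟨(n, t, t'), by simpa using ht, by simpa using ht'⟩
  · intro h
    refine h.mono fun W₃ h ⟨⟨n, t, t'⟩, h₁, h₂⟩ => ⟨n, ?_⟩
    rw [ex, ey, ey]
    exact ⟨(restrict_lt_iff (hda n) hd _).2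
        (.of_forall fun W₄ m => ⟨t, Sieve.downward_closed _ h₁ m⟩),
      (restrict_lt_iff hd (hdb n) _).2
        (.of_forall fun W₄ m => ⟨t', Sieve.downward_closed _ h₂ m⟩)⟩

/-! ### Intervals switched on by a bit -/

/-- The rational number `φ z`, as a real number, for an element `z` of a constant sheaf. -/
def DReal.ofCst {A : Type} (φ : A → ℚ) {U : C} (z : (cst J A).obj (op U)) : DReal J U where
  lower q := locSieve J fun V f => ∃ a, res (cst J A) f z = num J a V ∧ q < φ a
  upper q := locSieve J fun V f => ∃ a, res (cst J A) f z = num J a V ∧ φ a < q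
  lower_closed _ := locSieve_isClosed _
  upper_closed _ := locSieve_isClosed _
  lower_inhabited := (exists_num z).mono fun V f ⟨a, ha⟩ => ⟨φ a - 1, .of_forall fun W g =>
    ⟨a, by rw [← res_res, ha, res_num], by linarith⟩⟩
  upper_inhabited := (exists_num z).mono fun V f ⟨a, ha⟩ => ⟨φ a + 1, .of_forall fun W g =>
    ⟨a, by rw [← res_res, ha, res_num], by linarith⟩⟩
  lower_rounded q V f := by
    constructor
    · intro h
      refine Locally.mono h fun W g ⟨a, h₁, h₂⟩ => ⟨(q + φ a) / 2, by linarith, ?_⟩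
      exact .of_forall fun W' k => ⟨a, by rw [← res_res, h₁, res_num], by linarith⟩
    · intro h
      refine Locally.bind h fun W g ⟨r, hr, h⟩ => ?_
      refine Locally.mono h fun W' k ⟨a, h₁, h₂⟩ => ⟨a, ?_, by linarith⟩
      simpa using h₁
  upper_rounded q V f := by
    constructor
    · intro h
      refine Locally.mono h fun W g ⟨a, h₁, h₂⟩ => ⟨(q + φ a) / 2, by linarith, ?_⟩
      exact .of_forall fun W' k => ⟨a, by rw [← res_res, h₁, res_num], by linarith⟩
    · intro h
      refine Locally.bind h fun W g ⟨r, hr, h⟩ => ?_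
      refine Locally.mono h fun W' k ⟨a, h₁, h₂⟩ => ⟨a, ?_, by linarith⟩
      simpa using h₁
  disjoint q V f h h' := by
    refine Locally.bot ((Locally.and h h').mono ?_)
    rintro W g ⟨⟨a, h₁, h₂⟩, b, h₃, h₄⟩
    refine num_bot_of_ne h₁ h₃ ?_
    rintro rfl
    linarith
  located q r h := by
    refine (exists_num z).mono fun V f ⟨a, ha⟩ => ?_
    rcases lt_or_ge q (φ a) with hq | hq
    · exact .inl (.of_forall fun W g => ⟨a, by rw [← res_res, ha, res_num], hq⟩)
    · exact .inr (.of_forall fun W g => ⟨a, by rw [← res_res, ha, res_num], by linarith⟩)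

theorem DReal.ofCst_lt_iff {A : Type} {φ : A → ℚ} {U V : C} {z : (cst J A).obj (op U)}
    {f : V ⟶ U} {a : A} (ha : res (cst J A) f z = num J a V) (x : DReal J V) :
    ((DReal.ofCst φ z).restrict f).lt x ↔ (x.lower (φ a)).arrows (𝟙 V) := by
  constructor
  · intro h
    refine closed_of_locally (x.lower_closed _) (𝟙 V) (h.bind fun W g ⟨q, h₁, h₂⟩ => ?_)
    refine Locally.bind h₁ fun W' k ⟨b, hb, hq⟩ => ?_
    have ha' : res (cst J A) (k ≫ g ≫ f) z = num J a W' := by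
      have := congrArg (res _ (k ≫ g)) ha
      simpa using this
    by_cases e : b = a
    · subst e
      refine .of_forall fun W'' l => ?_
      rw [Category.comp_id]
      exact x.lower_of_lt hq (by simpa using Sieve.downward_closed _ h₂ (l ≫ k))
    · exact .of_bot (num_bot_of_ne hb ha' e)
  · intro h
    refine ((x.lower_rounded _ V (𝟙 V)).1 h).mono fun W g ⟨r, hr, h'⟩ => ⟨r, ?_, by simpa using h'⟩
    refine .of_forall fun W' k => ⟨a, ?_, hr⟩
    have := congrArg (res _ (k ≫ g)) ha
    simpa using this

theorem DReal.lt_ofCst_iff {A : Type} {φ : A → ℚ} {U V : C} {z : (cst J A).obj (op U)}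
    {f : V ⟶ U} {a : A} (ha : res (cst J A) f z = num J a V) (x : DReal J V) :
    x.lt ((DReal.ofCst φ z).restrict f) ↔ (x.upper (φ a)).arrows (𝟙 V) := by
  constructor
  · intro h
    refine closed_of_locally (x.upper_closed _) (𝟙 V) (h.bind fun W g ⟨q, h₁, h₂⟩ => ?_)
    refine Locally.bind h₂ fun W' k ⟨b, hb, hq⟩ => ?_
    have ha' : res (cst J A) (k ≫ g ≫ f) z = num J a W' := by
      have := congrArg (res _ (k ≫ g)) ha
      simpa using this
    by_cases e : b = a
    · subst e
      refine .of_forall fun W'' l => ?_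
      rw [Category.comp_id]
      exact x.upper_of_lt hq (by simpa using Sieve.downward_closed _ h₁ (l ≫ k))
    · exact .of_bot (num_bot_of_ne hb ha' e)
  · intro h
    refine ((x.upper_rounded _ V (𝟙 V)).1 h).mono fun W g ⟨r, hr, h'⟩ => ⟨r, by simpa using h', ?_⟩
    refine .of_forall fun W' k => ⟨a, ?_, hr⟩
    have := congrArg (res _ (k ≫ g)) ha
    simpa using this

/-- Points of the closed interval `[q, r]` are close to points of the open interval `(q, r)`. -/
theorem DReal.near_of_not_lt {U : C} {x y : DReal J U} {q r δ : ℚ} (hδ : r - q < δ)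
    (hq : (x.lower q).arrows (𝟙 U)) (hr : (x.upper r).arrows (𝟙 U))
    (hq' : ∀ V (f : V ⟶ U), (y.upper q).arrows f → (⊥ : Sieve V) ∈ J V)
    (hr' : ∀ V (f : V ⟶ U), (y.lower r).arrows f → (⊥ : Sieve V) ∈ J V) : DReal.near δ x y := by
  constructor
  -- Since `r - δ < q`, locating `y` leaves only `r - δ < y`, as `y < q` is excluded.
  · refine (y.located (r - δ) q (by linarith)).bind fun V f h => ?_
    rcases h with h | h
    · exact .of_forall fun W g => ⟨r, by simpa using Sieve.downward_closed _ hr (g ≫ f),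
        Sieve.downward_closed _ h g⟩
    · exact .of_bot (hq' V f h)
  · refine (y.located r (q + δ) (by linarith)).bind fun V f h => ?_
    rcases h with h | h
    · exact .of_bot (hr' V f h)
    · refine .of_forall fun W g => ⟨q + δ, Sieve.downward_closed _ h g, ?_⟩
      rw [add_sub_cancel_right]
      simpa using Sieve.downward_closed _ hq (g ≫ f)

/-- For an open subtype `A`, it is an open proposition that `A` contains the points of the closed
interval `[q, r]`, up to shrinking to the open interval `(q, r)`. -/
theorem IsOpenSub.exists_contains (sd : StoneDuality J) (lc : LocalChoice J)
    (dc : DependentChoice J) {U : C} {A : Fn (UnitInterval J) (Omega J) U} (hA : IsOpenSub J A) :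
    Locally J U fun V f => ∃ γ : ℚ × ℚ → ℕ → (two J).obj (op V), ∀ i,
      (∀ N W (g : W ⟶ V), res (two J) g (γ i N) = num J false W →
        ∀ x : (UnitInterval J).obj (op W), ((toReal x).lower i.1).arrows (𝟙 W) →
          ((toReal x).upper i.2).arrows (𝟙 W) → (A.app (g ≫ f) x).1 = (⊤ : Sieve W)) ∧
      ∀ W (g : W ⟶ V), (∀ W' (h : W' ⟶ W) (x : (UnitInterval J).obj (op W')),
          (∀ W'' (k : W'' ⟶ W'), ((toReal x).upper i.1).arrows k → (⊥ : Sieve W'') ∈ J W'') →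
          (∀ W'' (k : W'' ⟶ W'), ((toReal x).lower i.2).arrows k → (⊥ : Sieve W'') ∈ J W'') →
          (A.app (h ≫ g ≫ f) x).1 = (⊤ : Sieve W')) →
        Locally J W fun W' h => ∃ N, res (two J) (h ≫ g) (γ i N) = num J false W' := by
  -- For `i = (q, r)`, three kinds of test justify `q < x < r → A x`: a bit of `A x`, a decision for
  -- `x < q`, or one for `r < x`.
  let K := ℕ ⊕ ℚ ⊕ ℚ
  obtain ⟨e, he⟩ := exists_surjective_nat K
  refine (interval_compactness sd lc dc (I := ℚ × ℚ) (U := U)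
    (fun i W g x =>
      (∀ W'' (k : W'' ⟶ W), ((toReal x).upper i.1).arrows k → (⊥ : Sieve W'') ∈ J W'') →
      (∀ W'' (k : W'' ⟶ W), ((toReal x).lower i.2).arrows k → (⊥ : Sieve W'') ∈ J W'') →
      (A.app g x).1 = (⊤ : Sieve W))
    (fun i _ W g x => ((toReal x).lower i.1).arrows (𝟙 W) →
      ((toReal x).upper i.2).arrows (𝟙 W) → (A.app g x).1 = (⊤ : Sieve W)) ?_).mono ?_
  · intro V f x
    refine (hA V f x).bind fun W₁ g₁ ⟨α, hα⟩ => ?_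
    refine (exists_decision_one dc ((toReal x).restrict g₁)).mono fun W₂ g₂ ⟨d, hd⟩ => ?_
    rw [DReal.restrict_restrict] at hd
    choose z hz using fun p q => (decSieve_val (J := J) (d p q) true).exists_two
    let ζ : ℚ × ℚ → K → (two J).obj (op W₂) := fun i =>
      Sum.elim (fun n => res (two J) g₂ (α n))
        -- Rationals on the wrong side of an endpoint give no test, so they receive the neutral bit
        -- 1. The bits `z` are negated decisions, so that 0 means `x < q`.
        (Sum.elim (fun p => if p < i.1 then z p i.1 else num J true W₂)
          fun s => if i.2 < s then d i.2 s else num J true W₂)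
    refine ⟨fun i j => ζ i (e j), fun i => ⟨fun j W' h hj hq hr => ?_, fun W' h hT hj => ?_⟩⟩
    · change res (two J) h (ζ i (e j)) = _ at hj
      revert hj
      generalize e j = κ
      rcases κ with n | p | s
      · intro hj
        have := (hα W' (h ≫ g₂)).2 (.of_forall fun W'' k => ⟨n, ?_⟩)
        · have := (A.app_res_eq_top f _ x).2 this
          simpa using this
        · have := congrArg (res _ k) hj
          simpa [ζ] using this
      · intro hj
        refine Fn.app_eq_top_of_locally (.of_bot ?_)
        by_cases hp : p < i.1
        · have : res (two J) h (z p i.1) = num J false W' := by simpa [ζ, hp] using hj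
          have := (hd p i.1 hp W' h).2 ((hz p i.1 W' h).1.1 this)
          refine (toReal x).bot_of_le le_rfl (q := i.1) (f := h ≫ g₂ ≫ g₁) ?_ this
          simpa [toReal_res, DReal.restrict] using hq
        · have : num J true W' = num J false W' := by simpa [ζ, hp] using hj
          exact num_inj this (by simp)
      · intro hj
        refine Fn.app_eq_top_of_locally (.of_bot ?_)
        by_cases hs : i.2 < s
        · have : res (two J) h (d i.2 s) = num J false W' := by simpa [ζ, hs] using hj
          have := (hd i.2 s hs W' h).1 this
          refine (toReal x).bot_of_le le_rfl (q := i.2) (f := h ≫ g₂ ≫ g₁) this ?_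
          simpa [toReal_res, DReal.restrict] using hr
        · have : num J true W' = num J false W' := by simpa [ζ, hs] using hj
          exact num_inj this (by simp)
    -- If every test fails, then `q ≤ x ≤ r`, because the cuts are rounded. The hypothesis then
    -- gives `A x`, contradicting that all bits of `α` are 1.
    · replace hj : ∀ κ, res (two J) h (ζ i κ) = num J true W' := fun κ => by
        obtain ⟨j, rfl⟩ := he κ
        exact hj j
      have hAx := hT ?_ ?_
      · have hx : (A.app f x).1.arrows ((h ≫ g₂) ≫ g₁) := by
          refine (A.app_res_eq_top _ _ x).1 ?_
          simpa using hAx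
        refine Locally.bot (((hα W' (h ≫ g₂)).1 hx).mono fun W'' k ⟨n, hn⟩ => ?_)
        have := congrArg (res _ k) (hj (.inl n))
        simp only [ζ, Sum.elim_inl, res_res, res_num] at this
        exact num_bot_of_ne (by simpa using hn) this (by simp)
      · intro W'' k hk
        refine Locally.bot ((((toReal _).upper_rounded i.1 W'' k).1 hk).bind ?_)
        rintro W₃ l ⟨p, hp, hp'⟩
        refine (exists_num (res (two J) (l ≫ k ≫ h) (d p i.1))).mono fun W₄ m ⟨b, hb⟩ => ?_
        rw [res_res] at hb
        cases b
        · refine (toReal x).bot_of_le le_rfl ((hd p i.1 hp _ _).1 hb) ?_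
          have := Sieve.downward_closed _ hp' m
          simpa [toReal_res, DReal.restrict] using this
        · have h₁ : res (two J) h (z p i.1) = num J true W' := by
            simpa [ζ, hp] using hj (.inr (.inl p))
          have := (hz p i.1 W' h).2.1 h₁ W₄ (m ≫ l ≫ k)
          refine this ?_
          simpa using hb
      · intro W'' k hk
        refine Locally.bot ((((toReal _).lower_rounded i.2 W'' k).1 hk).bind ?_)
        rintro W₃ l ⟨s, hs, hs'⟩
        have h₁ : res (two J) h (d i.2 s) = num J true W' := by
          simpa [ζ, hs] using hj (.inr (.inr s))
        have h₂ := (hd i.2 s hs W' h).2 h₁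
        refine .of_forall fun W₄ m => (toReal x).bot_of_le le_rfl (q := s)
          (f := m ≫ l ≫ k ≫ h ≫ g₂ ≫ g₁) ?_ ?_
        · have := Sieve.downward_closed _ hs' m
          simpa [toReal_res, DReal.restrict] using this
        · have := Sieve.downward_closed _ h₂ (m ≫ l ≫ k)
          simpa [DReal.restrict] using this
  · rintro V f ⟨γ, hγ⟩
    refine ⟨γ, fun i => ⟨fun N W g hN x hq hr => Fn.app_eq_top_of_locally ?_, (hγ i).2⟩⟩
    refine ((hγ i).1 N W g hN W (𝟙 W) x).mono fun W' k ⟨j, _, hR⟩ => ?_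
    have := hR ?_ ?_
    · simpa using this
    · simpa [toReal_res, DReal.restrict] using Sieve.downward_closed _ hq k
    · simpa [toReal_res, DReal.restrict] using Sieve.downward_closed _ hr k

/-- Around a point of `A` with radius `δ`, choose rationals `q < x < r` with `r - q < δ`. The closed
interval lies in `A`, so some bit certifies `(q, r)`; conversely, certified intervals lie in `A`. -/
theorem IsOpenSub.isCountableUnionOfOpenIntervals (sd : StoneDuality J) (lc : LocalChoice J)
    (dc : DependentChoice J) {U : C} {A : Fn (UnitInterval J) (Omega J) U} (hA : IsOpenSub J A) :
    IsCountableUnionOfOpenIntervals A := by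
  obtain ⟨e, he⟩ := exists_surjective_nat ((ℚ × ℚ) × ℕ)
  refine (hA.exists_contains sd lc dc).mono fun V f ⟨γ, hγ⟩ => ?_
  -- Bit 0 yields the interval `(q, r)`; bit 1 yields `(1, 0)`, which is empty. The endpoints are
  -- reals because the bit need not be a numeral at the given stage.
  refine ⟨fun n => .ofCst (fun b : Bool => if b then 1 else (e n).1.1) (γ (e n).1 (e n).2),
    fun n => .ofCst (fun b : Bool => if b then 0 else (e n).1.2) (γ (e n).1 (e n).2),
    fun W g x => ⟨fun h => ?_, fun h => Fn.app_eq_top_of_locally ?_⟩⟩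
  · refine (hA.exists_near sd lc dc (g ≫ f) x h).bind fun W₁ g₁ ⟨δ, hδ, hnear⟩ => ?_
    refine (((toReal x).restrict g₁).exists_mem_Ioo hδ).bind fun W₂ g₂ ⟨q, r, hq, hr, hqr⟩ => ?_
    have := (hγ (q, r)).2 W₂ (g₂ ≫ g₁ ≫ g) fun W' h y hyq hyr => ?_
    · refine this.mono fun W₃ g₃ ⟨N, hN⟩ => ?_
      obtain ⟨n, hn⟩ := he ((q, r), N)
      refine ⟨n, ?_⟩
      simp only [hn, Category.assoc]
      rw [DReal.ofCst_lt_iff hN, DReal.lt_ofCst_iff hN]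
      constructor
      · simpa [DReal.restrict] using Sieve.downward_closed _ hq g₃
      · simpa [DReal.restrict] using Sieve.downward_closed _ hr g₃
    · have := hnear W' (h ≫ g₂) y (DReal.near_of_not_lt hqr ?_ ?_ hyq hyr)
      · simpa using this
      · simpa [DReal.restrict] using Sieve.downward_closed _ hq h
      · simpa [DReal.restrict] using Sieve.downward_closed _ hr h
  · refine h.bind fun W₁ g₁ ⟨n, h₁, h₂⟩ => ?_
    refine (exists_num (res (two J) (g₁ ≫ g) (γ (e n).1 (e n).2))).bind fun W₂ g₂ ⟨b, hb⟩ => ?_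
    rw [res_res] at hb
    replace h₁ : ((DReal.ofCst (fun b : Bool => if b then 1 else (e n).1.1)
        (γ (e n).1 (e n).2)).restrict (g₂ ≫ g₁ ≫ g)).lt
        (toReal (res (UnitInterval J) (g₂ ≫ g₁) x)) := by
      rw [← DReal.restrict_restrict _ (g₁ ≫ g), toReal_res,
        ← DReal.restrict_restrict (toReal x)]
      exact h₁.pullback g₂
    replace h₂ : (toReal (res (UnitInterval J) (g₂ ≫ g₁) x)).lt
        ((DReal.ofCst (fun b : Bool => if b then 0 else (e n).1.2)
        (γ (e n).1 (e n).2)).restrict (g₂ ≫ g₁ ≫ g)) := by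
      rw [← DReal.restrict_restrict _ (g₁ ≫ g), toReal_res,
        ← DReal.restrict_restrict (toReal x)]
      exact h₂.pullback g₂
    rw [DReal.ofCst_lt_iff hb] at h₁
    rw [DReal.lt_ofCst_iff hb] at h₂
    cases b
    · have := (hγ (e n).1).1 (e n).2 W₂ (g₂ ≫ g₁ ≫ g) hb _ h₁ h₂
      refine .of_forall fun W₃ g₃ => ?_
      have := Fn.app_res_eq_top_of_eq_top this g₃
      simpa using this
    · refine .of_bot (DReal.bot_of_le _ ?_ h₁ h₂)
      norm_num

end SyntheticStone
end

theorem mainTheorem8 {C : Type u} [CategoryTheory.SmallCategory C]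
    (J : CategoryTheory.GrothendieckTopology C)
    (stoneDuality : SyntheticStone.StoneDuality J)
    (surjectionsAreFormalSurjections : SyntheticStone.SurjectionsAreFormalSurjections J)
    (localChoice : SyntheticStone.LocalChoice J)
    (dependentChoice : SyntheticStone.DependentChoice J) :
    SyntheticStone.IsCHaus J (SyntheticStone.UnitInterval J) ∧
    (∀ (U : C) (A : SyntheticStone.Fn (SyntheticStone.UnitInterval J) (SyntheticStone.Omega J) U),
      SyntheticStone.IsOpenSub J A ↔ SyntheticStone.IsCountableUnionOfOpenIntervals A) ∧
    (∀ (U : C) (F : SyntheticStone.Fn (SyntheticStone.UnitInterval J)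
      (SyntheticStone.UnitInterval J) U), SyntheticStone.IsEpsDeltaContinuous F) :=
  ⟨SyntheticStone.unitInterval_isCHaus dependentChoice,
    fun _ _ => ⟨fun hA => hA.isCountableUnionOfOpenIntervals stoneDuality localChoice
      dependentChoice, fun hA => hA.isOpenSub dependentChoice⟩,
    fun _ F => SyntheticStone.isEpsDeltaContinuous stoneDuality localChoice dependentChoice F⟩
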